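/- **Conventions.** Write $[n]=\{1,\dots,n\}$ and $\underline n=\{0,1,\dots,n\}$, based at $0$. Let $\Gamma^{\rm op}$ be the category of the based sets $\underline n$ and all based functions, and $\mathbf{Cat}_*$ the category of small categories with a base object and functors preserving it. The smash product $C_1\wedge\dots\wedge C_r$ of based categories is $C_1\times\dots\times C_r$ with all coordinate hyperplanes collapsed to the base object; the empty smash product is $S^0$, the discrete category with two objects. A $\Gamma$-category is a functor $X:\Gamma^{\rm op}\to\mathbf{Cat}_*$ such that $X(0)$ has one object and one morphism; maps are natural transformations. Multicategories are symmetric. In the multicategory $\mathbb N$ (with objects $[n]$) an $r$-morphism $([n_1],\dots,[n_r])\to[m]$ is a function $[m]\to[n_1]\amalg\dots\amalg[n_r]$; in the multicategory $\mathbf{Cat}_*^{\rm op}$ an $r$-morphism $(D_1,\dots,D_r)\to C$ is a based functor $C\to D_1\times\dots\times D_r$. $\mathbf{Mult}_*(\mathbb N,\mathbf{Cat}_*^{\rm op})$ is the collection of multifunctors $F:\mathbb N\to\mathbf{Cat}_*^{\rm op}$ such that $F[0]$ has one object and one morphism. We identify $[m_1]\times\dots\times[m_r]$ with $[m_1\cdots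 m_r]$ lexicographically, and correspondingly $\underline{m_1}\wedge\dots\wedge\underline{m_r}$ with $\underline{m_1\cdots m_r}$. For a $\Gamma$-category $X$ let $AX$ be the based multifunctor with $AX[n]=X(n)$ which sends $f:[m]\to[n_1]\amalg\dots\amalg[n_r]$ to the functor $X(m)\to\prod_iX(n_i)$ with coordinates $X(f_i)$, where $f_i:\underline m\to\underline{n_i}$ is $f$ with base points added, followed by the collapse of all summands but the $i$-th. **Theorem 2.1.** 1. There is a symmetric monoidal structure on $\Gamma\text{-}\mathbf{Cat}_*$ in which $X\wedge Y$ is the Day convolution, i.e. the left Kan extension of $(m,n)\mapsto X(m)\wedge Y(n)$ along $\wedge:\Gamma^{\rm op}\times\Gamma^{\rm op}\to\Gamma^{\rm op}$. Its underlying multicategory is the multicategory on $\Gamma\text{-}\mathbf{Cat}_*$ whose $r$-morphisms $(X_1,\dots,X_r)\to Y$ are the natural transformations $$X_1(n_1)\wedge\dots\wedge X_r(n_r)\to Y(n_1\cdots n_r)$$ of functors $(\Gamma^{\rm op})^r\to\mathbf{Cat}_*$, with the evident identities, composition and permutation actions. 2. There is a multicategory structure on $\mathbf{Mult}_*(\mathbb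 N,\mathbf{Cat}_*^{\rm op})$ whose $r$-morphisms $(F_1,\dots,F_r)\to G$ are the based $r$-linear transformations twisted by the products $\cdot$ on $\mathbb N$ and $\wedge$ on $\mathbf{Cat}_*^{\rm op}$, namely the families of based functors $$\varphi_{m_1,\dots,m_r}:F_1[m_1]\wedge\dots\wedge F_r[m_r]\to G[m_1\cdots m_r]$$ that are multinatural and multilinear in the following sense: for all $f_i:[m_i]\to\coprod_{a\in[s_i]}[p_{i,a}]$, $1\le i\le r$, and all $a_i\in[s_i]$, $$\varphi_{p_{1,a_1},\dots,p_{r,a_r}}\circ\big((F_1f_1)_{a_1}\wedge\dots\wedge(F_rf_r)_{a_r}\big)=G(f_1\times\dots\times f_r)_{(a_1,\dots,a_r)}\circ\varphi_{m_1,\dots,m_r},$$ where $f_1\times\dots\times f_r:[m_1\cdots m_r]\to\coprod_{(a_1,\dots,a_r)}[p_{1,a_1}\cdots p_{r,a_r}]$. Identities, composition and permutation actions are the evident ones: composition is $\psi\circ(\varphi_1\wedge\dots\wedge\varphi_s)$, and permutations permute the smash factors of the source and, correspondingly, the factors of $[m_1\cdots m_r]\cong[m_1]\times\dots\times[m_r]$.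 3. For these structures $A:\Gamma\text{-}\mathbf{Cat}_*\to\mathbf{Mult}_*(\mathbb N,\mathbf{Cat}_*^{\rm op})$ is a multifunctor; it sends an $r$-morphism $(X_1,\dots,X_r)\to Y$ with components $g_{n_1,\dots,n_r}$ to the $r$-linear transformation $(AX_1,\dots,AX_r)\to AY$ with the same components. -/

import Mathlib

open CategoryTheory

universe u v w

namespace Mandell

/-! ### Based categories -/

/-- A small category with a selected base object. -/
structure BasedCat where
  carrier : Type u
  [str : SmallCategory.{u} carrier]
  base : carrier

instance : CoeSort BasedCat.{u} (Type u) := ⟨BasedCat.carrier⟩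

instance (C : BasedCat.{u}) : SmallCategory.{u} C := C.str

/-- A functor that preserves the base object (strictly). -/
@[ext]
structure BasedFunctor (C D : BasedCat.{u}) where
  functor : C ⥤ D
  obj_base : functor.obj C.base = D.base

/-- The category `Cat_*` of small based categories and based functors. -/
instance : Category BasedCat.{u} where
  Hom := BasedFunctor
  id C := ⟨𝟭 C, rfl⟩
  comp F G := ⟨F.functor ⋙ G.functor, by simp [F.obj_base, G.obj_base]⟩

@[simp] theorem BasedCat.id_functor (C : BasedCat.{u}) :
    BasedFunctor.functor (𝟙 C) = 𝟭 C := rfl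

@[simp] theorem BasedCat.comp_functor {C D E : BasedCat.{u}} (F : C ⟶ D) (G : D ⟶ E) :
    BasedFunctor.functor (F ≫ G) = BasedFunctor.functor F ⋙ BasedFunctor.functor G := rfl

theorem BasedCat.hom_ext {C D : BasedCat.{u}} {F G : C ⟶ D}
    (h : BasedFunctor.functor F = BasedFunctor.functor G) : F = G := BasedFunctor.ext h

/-- `C` has exactly one object and exactly one morphism. -/
def BasedCat.IsPoint (C : BasedCat.{u}) : Prop :=
  (∀ x : C, x = C.base) ∧ ∀ f : C.base ⟶ C.base, f = 𝟙 C.base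

/-! ### Smash products of families of based categories

The smash product of a family `C i` is the product category `∀ i, C i` with every coordinate
hyperplane (the subcategory of tuples having some `i`-th coordinate equal to the base object, or to
its identity in the case of morphisms) collapsed to the base object.  For the empty
family there is no hyperplane, and a disjoint base object is added: the result is `S⁰`. -/

section Smash

variable {ι : Type} (C : ι → BasedCat.{u})

/-- The product category of the family. -/
abbrev Tuple : Type u := ∀ i, C i

/-- The hyperplanes are identified with the base object `none`. -/
inductive SmashObjRel : Option (Tuple C) → Option (Tuple C) → Prop
  | base (x : Tuple C) (i : ι) (h : x i = (C i).base) : SmashObjRel (some x) none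

/-- Objects of the smash product. -/
def SmashObj : Type u := Quot (SmashObjRel C)

variable {C}

/-- The base object of the smash product. -/
def SmashObj.base : SmashObj C := Quot.mk _ none

/-- The class of a tuple. -/
def SmashObj.mk (x : Tuple C) : SmashObj C := Quot.mk _ (some x)

theorem SmashObj.mk_eq_base {x : Tuple C} (i : ι) (h : x i = (C i).base) :
    SmashObj.mk x = SmashObj.base := Quot.sound (.base x i h)

variable (C)

/-- Generating morphisms of the smash product: the morphisms of the product category. -/
inductive SmashArrow : SmashObj C → SmashObj C → Type u
  | mk {x y : Tuple C} (f : x ⟶ y) : SmashArrow (SmashObj.mk x) (SmashObj.mk y)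

instance : Quiver (SmashObj C) := ⟨SmashArrow C⟩

variable {C}

/-- A morphism of the product category, as a path of length one. -/
def smashPath {x y : Tuple C} (f : x ⟶ y) :
    (Paths.of (SmashObj C)).obj (SmashObj.mk x) ⟶ (Paths.of (SmashObj C)).obj (SmashObj.mk y) :=
  (Paths.of (SmashObj C)).map (SmashArrow.mk f)

variable (C)

/-- The relations between generating morphisms: those of the product category, together with the
collapse of the hyperplanes. -/
inductive SmashRel : HomRel (Paths (SmashObj C))
  | id (x : Tuple C) : SmashRel (smashPath (𝟙 x)) (𝟙 _)
  | comp {x y z : Tuple C} (f : x ⟶ y) (g : y ⟶ z) :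
      SmashRel (smashPath (f ≫ g)) (smashPath f ≫ smashPath g)
  | base {x y : Tuple C} (f : x ⟶ y) (i : ι) (hx : x i = (C i).base) (hy : y i = (C i).base)
      (hf : f i = eqToHom (hx.trans hy.symm)) :
      SmashRel (smashPath f)
        (eqToHom ((SmashObj.mk_eq_base i hx).trans (SmashObj.mk_eq_base i hy).symm))

/-- The smash product of a family of based categories. -/
def Smash : BasedCat.{u} where
  carrier := CategoryTheory.Quotient (SmashRel C)
  base := ⟨SmashObj.base⟩

/-- The canonical functor from the product to the smash product. -/
def Smash.proj : Tuple C ⥤ Smash C where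
  obj x := ⟨SmashObj.mk x⟩
  map f := (CategoryTheory.Quotient.functor (SmashRel C)).map (smashPath f)
  map_id x := (CategoryTheory.Quotient.sound _ (SmashRel.id x)).trans (CategoryTheory.Functor.map_id _ _)
  map_comp f g := (CategoryTheory.Quotient.sound _ (SmashRel.comp f g)).trans (CategoryTheory.Functor.map_comp _ _ _)

variable {C}

/-- A functor from the product which collapses the hyperplanes to the base object. -/
structure MultiBased {D : BasedCat.{u}} (H : Tuple C ⥤ D) : Prop where
  obj : ∀ (x : Tuple C) (i : ι), x i = (C i).base → H.obj x = D.base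
  map : ∀ {x y : Tuple C} (f : x ⟶ y) (i : ι) (hx : x i = (C i).base) (hy : y i = (C i).base),
    f i = eqToHom (hx.trans hy.symm) → H.map f = eqToHom ((obj x i hx).trans (obj y i hy).symm)

theorem Smash.proj_multiBased : MultiBased (D := Smash C) (Smash.proj C) where
  obj x i h := congrArg CategoryTheory.Quotient.mk (SmashObj.mk_eq_base i h)
  map f i hx hy hf := by
    refine (CategoryTheory.Quotient.sound _ (SmashRel.base f i hx hy hf)).trans ?_
    exact eqToHom_map _ _

namespace Smash

variable {D : BasedCat.{u}} (H : Tuple C ⥤ D) (hH : MultiBased H)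

/-- Object part of `Smash.desc`. -/
def descObj : SmashObj C → D :=
  Quot.lift (fun o => o.elim D.base H.obj) (by rintro _ _ ⟨x, i, h⟩; exact hH.obj x i h)

/-- `Smash.desc` on paths. -/
def descPaths : Paths (SmashObj C) ⥤ D :=
  Paths.lift { obj := descObj H hH, map := fun f => match f with | SmashArrow.mk f => H.map f }

theorem descPaths_smashPath {x y : Tuple C} (f : x ⟶ y) :
    (descPaths H hH).map (smashPath f) = H.map f :=
  Paths.lift_toPath _ _

/-- The based functor out of the smash product induced by a functor out of the product that
collapses the hyperplanes. -/
def desc : Smash C ⟶ D where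
  functor := CategoryTheory.Quotient.lift _ (descPaths H hH) (by
    intro _ _ _ _ h
    cases h with
    | id x =>
      exact (descPaths_smashPath H hH _).trans
        ((H.map_id x).trans (CategoryTheory.Functor.map_id (descPaths H hH)
          ((Paths.of (SmashObj C)).obj (SmashObj.mk x))).symm)
    | comp f g =>
      rw [descPaths_smashPath, H.map_comp, CategoryTheory.Functor.map_comp, descPaths_smashPath,
        descPaths_smashPath]; rfl
    | base f i hx hy hf =>
      exact (descPaths_smashPath H hH f).trans ((hH.map f i hx hy hf).trans
        (eqToHom_map (descPaths H hH)
          ((SmashObj.mk_eq_base i hx).trans (SmashObj.mk_eq_base i hy).symm)).symm))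
  obj_base := rfl

theorem proj_desc : Smash.proj C ⋙ BasedFunctor.functor (desc H hH) = H :=
  CategoryTheory.Functor.hext (fun _ => rfl) (fun _ _ f =>
    heq_of_eq (descPaths_smashPath H hH f))

theorem hom_ext {F G : Smash C ⟶ D}
    (h : Smash.proj C ⋙ BasedFunctor.functor F = Smash.proj C ⋙ BasedFunctor.functor G) :
    F = G := by
  apply BasedFunctor.ext
  refine CategoryTheory.Quotient.lift_unique' _ _ _ ?_
  have hob : ∀ a : Paths (SmashObj C), (BasedFunctor.functor F).obj ⟨a⟩ =
      (BasedFunctor.functor G).obj ⟨a⟩ := by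
    rintro ⟨_ | x⟩
    · exact (BasedFunctor.obj_base F).trans (BasedFunctor.obj_base G).symm
    · exact Functor.congr_obj h x
  refine Paths.ext_functor (funext hob) ?_
  rintro _ _ ⟨f⟩
  exact Functor.congr_hom h f

/-- The map between smash products induced by a surjection `σ` of index sets and based functors
`C (σ k) ⟶ D k`. -/
def mapAlong {κ : Type} {D : κ → BasedCat.{u}} (σ : κ → ι) (hσ : Function.Surjective σ)
    (h : ∀ k, C (σ k) ⟶ D k) : Smash C ⟶ Smash D :=
  desc (Functor.pi' (fun k => Pi.eval (fun i => C i) (σ k) ⋙ BasedFunctor.functor (h k)) ⋙ proj D)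
    { obj := by
        intro x i hx
        obtain ⟨k, rfl⟩ := hσ i
        refine proj_multiBased.obj _ k ?_
        simp [hx, BasedFunctor.obj_base]
      map := by
        intro x y f i hx hy hf
        obtain ⟨k, rfl⟩ := hσ i
        refine proj_multiBased.map _ k ?_ ?_ ?_
        · simp [hx, BasedFunctor.obj_base]
        · simp [hy, BasedFunctor.obj_base]
        · change (BasedFunctor.functor (h k)).map (f (σ k)) = _
          rw [hf]
          exact eqToHom_map _ _ }

/-- The functoriality of the smash product. -/
def map {D : ι → BasedCat.{u}} (h : ∀ i, C i ⟶ D i) : Smash C ⟶ Smash D :=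
  mapAlong id Function.surjective_id h

theorem map_id : map (fun i => 𝟙 (C i)) = 𝟙 (Smash C) :=
  hom_ext (proj_desc _ _)

theorem map_comp {D E : ι → BasedCat.{u}} (h : ∀ i, C i ⟶ D i) (k : ∀ i, D i ⟶ E i) :
    map (fun i => h i ≫ k i) = map h ≫ map k := by
  apply hom_ext
  rw [BasedCat.comp_functor, ← Functor.assoc]
  unfold map mapAlong
  rw [proj_desc, proj_desc, Functor.assoc, proj_desc]
  rfl

end Smash
end Smash
/-! ### Symmetric multicategories -/

section Multicategory

/-- The concatenation of a list of lists. -/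
abbrev concat {O : Type*} {s : ℕ} {t : Fin s → ℕ} (w : ∀ i, Fin (t i) → O) :
    Fin (∑ i, t i) → O :=
  fun p => w (finSigmaFinEquiv.symm p).1 (finSigmaFinEquiv.symm p).2

theorem concat_apply {O : Type*} {s : ℕ} {t : Fin s → ℕ} (w : ∀ i, Fin (t i) → O)
    (q : Σ i, Fin (t i)) : concat w (finSigmaFinEquiv q) = w q.1 q.2 :=
  congrArg (fun q : Σ i, Fin (t i) => w q.1 q.2) (Equiv.symm_apply_apply finSigmaFinEquiv q)

/-- The bijection between the index sets of two concatenated lists that is induced by a bijection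
between the sets of double indices. -/
def blockEquiv {s s' : ℕ} {t : Fin s → ℕ} {t' : Fin s' → ℕ}
    (e : (Σ i, Fin (t i)) ≃ Σ i, Fin (t' i)) : Fin (∑ i, t i) ≃ Fin (∑ i, t' i) :=
  finSigmaFinEquiv.symm.trans (e.trans finSigmaFinEquiv)

variable {O : Type v}

/-- The data of a multicategory with objects `O` and with `Hom x y` as set of `r`-morphisms
`(x 0, …, x (r-1)) → y`: identities, composition, and the action of the symmetric groups.  A
bijection `σ : Fin m ≃ Fin n` forces `m = n`; allowing it to be written with two names for
the same number is merely a convenience. -/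
structure MultiOps (Hom : ∀ ⦃r : ℕ⦄, (Fin r → O) → O → Type w) where
  id (x : O) : Hom (fun _ : Fin 1 => x) x
  comp {s : ℕ} {t : Fin s → ℕ} {w : ∀ i, Fin (t i) → O} {x : Fin s → O} {y : O}
    (f : Hom x y) (g : ∀ i, Hom (w i) (x i)) : Hom (concat w) y
  perm {m n : ℕ} (σ : Fin m ≃ Fin n) {x : Fin n → O} {y : O} (f : Hom x y) :
    Hom (fun i => x (σ i)) y

/-- The action of a bijection, when the permuted list is given up to equality. -/
def MultiOps.reindex {Hom : ∀ ⦃r : ℕ⦄, (Fin r → O) → O → Type w} (M : MultiOps Hom) {m n : ℕ} (σ : Fin m ≃ Fin n) {x' : Fin m → O}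
    {x : Fin n → O} (h : ∀ i, x' i = x (σ i)) {y : O} (f : Hom x y) : Hom x' y :=
  cast (by rw [funext h]) (M.perm σ f)

/-- A (symmetric) multicategory with objects `O` and `r`-morphisms `Hom`. -/
structure Multicategory (Hom : ∀ ⦃r : ℕ⦄, (Fin r → O) → O → Type w) extends MultiOps Hom where
  perm_refl {n : ℕ} {x : Fin n → O} {y : O} (f : Hom x y) : perm (Equiv.refl _) f = f
  perm_perm {l m n : ℕ} (σ : Fin l ≃ Fin m) (τ : Fin m ≃ Fin n) {x : Fin n → O} {y : O}
    (f : Hom x y) : perm σ (perm τ f) = perm (σ.trans τ) f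
  id_comp {n : ℕ} {x : Fin n → O} {y : O} (f : Hom x y) :
    comp (id y) (fun _ => f) =
      perm (finSigmaFinEquiv.symm.trans
        ((Equiv.sigmaEquivProd (Fin 1) (Fin n)).trans (Equiv.uniqueProd (Fin n) (Fin 1)))) f
  comp_id {n : ℕ} {x : Fin n → O} {y : O} (f : Hom x y) :
    comp f (fun i => id (x i)) =
      perm (finSigmaFinEquiv.symm.trans
        ((Equiv.sigmaEquivProd (Fin n) (Fin 1)).trans (Equiv.prodUnique (Fin n) (Fin 1)))) f
  assoc {s : ℕ} {t : Fin s → ℕ} {u : ∀ i, Fin (t i) → ℕ} {v : ∀ i j, Fin (u i j) → O}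
    {w : ∀ i, Fin (t i) → O} {x : Fin s → O} {y : O}
    (f : Hom x y) (g : ∀ i, Hom (w i) (x i)) (h : ∀ i j, Hom (v i j) (w i j)) :
    comp (comp f g) (fun p => h (finSigmaFinEquiv.symm p).1 (finSigmaFinEquiv.symm p).2) =
      toMultiOps.reindex
        (blockEquiv ((Equiv.sigmaCongrLeft (β := fun q : Σ i, Fin (t i) => Fin (u q.1 q.2))
            finSigmaFinEquiv.symm).trans
          ((Equiv.sigmaAssoc (fun i j => Fin (u i j))).trans
            (Equiv.sigmaCongrRight fun _ => finSigmaFinEquiv))))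
        (fun _ => ((concat_apply (fun i => concat (v i)) _).trans (concat_apply (v _) _)).symm)
        (comp f (fun i => comp (g i) (h i)))
  comp_perm_left {m n : ℕ} (σ : Fin m ≃ Fin n) {t : Fin n → ℕ} {w : ∀ i, Fin (t i) → O}
    {x : Fin n → O} {y : O} (f : Hom x y) (g : ∀ i, Hom (w i) (x i)) :
    comp (perm σ f) (fun i => g (σ i)) =
      toMultiOps.reindex
        (blockEquiv (Equiv.sigmaCongrLeft (β := fun i => Fin (t i)) σ))
        (fun _ => (concat_apply w _).symm) (comp f g)
  comp_perm_right {s : ℕ} {t t' : Fin s → ℕ} (τ : ∀ i, Fin (t i) ≃ Fin (t' i))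
    {w : ∀ i, Fin (t' i) → O} {x : Fin s → O} {y : O} (f : Hom x y) (g : ∀ i, Hom (w i) (x i)) :
    comp f (fun i => perm (τ i) (g i)) =
      toMultiOps.reindex (blockEquiv (Equiv.sigmaCongrRight τ))
        (fun _ => (concat_apply w _).symm) (comp f g)

variable {Hom : ∀ ⦃r : ℕ⦄, (Fin r → O) → O → Type w}

/-- A multifunctor with object function `obj`. -/
structure MultifunctorOn {P : Type*} {HomP : ∀ ⦃r : ℕ⦄, (Fin r → P) → P → Type*}
    (M : MultiOps Hom) (N : MultiOps HomP) (obj : O → P) where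
  map {r : ℕ} {x : Fin r → O} {y : O} (f : Hom x y) : HomP (fun i => obj (x i)) (obj y)
  map_id (x : O) : map (M.id x) = N.id (obj x)
  map_comp {s : ℕ} {t : Fin s → ℕ} {w : ∀ i, Fin (t i) → O} {x : Fin s → O} {y : O}
    (f : Hom x y) (g : ∀ i, Hom (w i) (x i)) :
    map (M.comp f g) = N.comp (map f) (fun i => map (g i))
  map_perm {m n : ℕ} (σ : Fin m ≃ Fin n) {x : Fin n → O} {y : O} (f : Hom x y) :
    map (M.perm σ f) = N.perm σ (map f)

/-! #### The underlying multicategory of a symmetric monoidal category -/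

namespace MultiOps

variable (M : MultiOps Hom)

/-- Composition of an `r`-morphism with a `1`-morphism. -/
def post {r : ℕ} {x : Fin r → O} {y z : O} (f : Hom x y) (g : Hom (fun _ : Fin 1 => y) z) :
    Hom x z :=
  M.reindex
    (finSigmaFinEquiv.symm.trans ((Equiv.sigmaEquivProd (Fin 1) (Fin r)).trans
      (Equiv.uniqueProd (Fin r) (Fin 1)))).symm
    (by intro i; simp [concat]) (M.comp g (fun _ => f))

/-- The composite `f ∘ (g, h)` for a `2`-morphism `f`. -/
def comp₂ {r s : ℕ} {x : Fin r → O} {x' : Fin s → O} {a b c : O} (f : Hom ![a, b] c)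
    (g : Hom x a) (h : Hom x' b) : Hom (Fin.append x x') c :=
  let t : Fin 2 → ℕ := ![r, s]
  let w : ∀ i, Fin (t i) → O := fun i => match i with
    | 0 => x
    | 1 => x'
  M.reindex (x := concat w)
    (finSumFinEquiv.symm.trans
      ((Equiv.mk
        (fun q : Fin r ⊕ Fin s => (match q with
          | .inl i => ⟨0, i⟩
          | .inr j => ⟨1, j⟩ : Σ i, Fin (t i)))
        (fun q => match q with
          | ⟨0, i⟩ => .inl i
          | ⟨1, j⟩ => .inr j)
        (by rintro (_ | _) <;> rfl)
        (by rintro ⟨i, j⟩; fin_cases i <;> rfl)).trans finSigmaFinEquiv))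
    (by
      intro i
      refine Fin.addCases (fun i => ?_) (fun i => ?_) i
      · rw [Fin.append_left, Equiv.trans_apply, finSumFinEquiv_symm_apply_castAdd]
        exact (concat_apply w ⟨0, i⟩).symm
      · rw [Fin.append_right, Equiv.trans_apply, finSumFinEquiv_symm_apply_natAdd]
        exact (concat_apply w ⟨1, i⟩).symm)
    (M.comp f (fun i => match i with
      | 0 => g
      | 1 => h))

end MultiOps

open MonoidalCategory

/-- The iterated tensor product `((𝟙 ⊗ x 0) ⊗ x 1) ⊗ …`. -/
def tensorList [Category.{w} O] [MonoidalCategory O] : ∀ {r : ℕ}, (Fin r → O) → O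
  | 0, _ => 𝟙_ O
  | _ + 1, x => tensorList (fun i => x i.castSucc) ⊗ x (Fin.last _)

/-- The iterated composite `(x 0, …, x (r-1)) → ((𝟙 ⊗ x 0) ⊗ x 1) ⊗ …` of `2`-morphisms
`(x, y) → x ⊗ y` and of a `0`-morphism `() → 𝟙`. -/
def MultiOps.tensorMor [Category.{w} O] [MonoidalCategory O] (M : MultiOps Hom)
    (pair : ∀ x y : O, Hom ![x, y] (x ⊗ y)) (unit : Hom ![] (𝟙_ O)) :
    ∀ {r : ℕ} (x : Fin r → O), Hom x (tensorList x)
  | 0, _ => M.reindex (Equiv.refl _) (fun i => i.elim0) unit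
  | r + 1, x => M.reindex (Equiv.refl (Fin (r + 1)))
      (by
        intro i
        refine Fin.lastCases ?_ (fun i => ?_) i
        · exact (Fin.append_right (fun i : Fin r => x i.castSucc)
            (fun _ : Fin 1 => x (Fin.last r)) 0).symm
        · exact (Fin.append_left (fun i : Fin r => x i.castSucc)
            (fun _ : Fin 1 => x (Fin.last r)) i).symm)
      (M.comp₂ (pair _ _) (M.tensorMor pair unit (fun i => x i.castSucc)) (M.id (x (Fin.last r))))

/-- `Underlying M` exhibits `M` as the underlying multicategory of the symmetric monoidal
category `O`: `1`-morphisms are the morphisms of the category; more generally, the `r`-morphisms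
`(x 0, …, x (r-1)) → y` are the morphisms from the iterated tensor product to `y`; and the
composition and the symmetric group actions are the ones determined by the functoriality of the
tensor product, the associativity, unit and symmetry isomorphisms. -/
structure Underlying [Category.{w} O] [MonoidalCategory O] [SymmetricCategory O]
    (M : MultiOps Hom) where
  /-- morphisms of the category are `1`-morphisms -/
  one (x y : O) : (x ⟶ y) ≃ Hom (fun _ : Fin 1 => x) y
  /-- the `2`-morphism that corresponds to the identity of `x ⊗ y` -/
  pair (x y : O) : Hom ![x, y] (x ⊗ y)
  /-- the `0`-morphism that corresponds to the identity of the unit object -/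
  unit : Hom ![] (𝟙_ O)
  one_id (x : O) : one x x (𝟙 x) = M.id x
  one_comp {x y z : O} (f : x ⟶ y) (g : y ⟶ z) :
    one x z (f ≫ g) = M.post (one x y f) (one y z g)
  bijective {r : ℕ} (x : Fin r → O) (y : O) :
    Function.Bijective
      (fun f : tensorList x ⟶ y => M.post (M.tensorMor pair unit x) (one _ _ f))
  tensor {x x' y y' : O} (f : x ⟶ x') (g : y ⟶ y') :
    M.post (pair x y) (one _ _ (f ⊗ₘ g)) =
      M.reindex (Equiv.refl (Fin 2)) (by intro i; fin_cases i <;> rfl)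
        (M.comp₂ (pair x' y') (one _ _ f) (one _ _ g))
  associator (x y z : O) :
    M.post (M.comp₂ (pair (x ⊗ y) z) (pair x y) (M.id z)) (one _ _ (α_ x y z).hom) =
      M.reindex (Equiv.refl (Fin 3)) (by intro i; fin_cases i <;> rfl)
        (M.comp₂ (pair x (y ⊗ z)) (M.id x) (pair y z))
  leftUnitor (x : O) :
    M.post (M.comp₂ (pair (𝟙_ O) x) unit (M.id x)) (one _ _ (λ_ x).hom) =
      M.reindex (finCongr (Nat.zero_add 1)) (by intro i; fin_cases i; rfl) (M.id x)
  rightUnitor (x : O) :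
    M.post (M.comp₂ (pair x (𝟙_ O)) (M.id x) unit) (one _ _ (ρ_ x).hom) =
      M.reindex (Equiv.refl (Fin 1)) (by intro i; fin_cases i; rfl) (M.id x)
  braiding (x y : O) :
    M.post (pair x y) (one _ _ (β_ x y).hom) =
      M.reindex (Equiv.swap (0 : Fin 2) 1) (by intro i; fin_cases i <;> rfl) (pair y x)

end Multicategory

/-! ### Lexicographic order -/

section Lexicographic

/-- The identification `[m 0] × ⋯ × [m (r-1)] ≅ [m 0 ⋯ m (r-1)]` given by lexicographic order. -/
noncomputable def lexEquiv {r : ℕ} (m : Fin r → ℕ) : (∀ i, Fin (m i)) ≃ Fin (∏ i, m i) :=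
  toLex.trans (monoEquivOfFin (Lex (∀ i, Fin (m i))) (by
    change Fintype.card (∀ i, Fin (m i)) = _
    simp)).symm.toEquiv

end Lexicographic
/-! ### The multicategories `ℕ` and `Cat_*ᵒᵖ` -/

section NCat

/-- An `r`-morphism `([x 0], …, [x (r-1)]) → [m]` of `ℕ`: a function
`[m] → [x 0] ⨿ ⋯ ⨿ [x (r-1)]`. -/
abbrev NHom ⦃r : ℕ⦄ (x : Fin r → ℕ) (m : ℕ) : Type := Fin m → Σ i, Fin (x i)

theorem NHom.sigma_ext {r : ℕ} {x : Fin r → ℕ} {a b : Σ i, Fin (x i)} (h₁ : a.1 = b.1)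
    (h₂ : a.2.val = b.2.val) : a = b := by
  obtain ⟨i, a⟩ := a
  obtain ⟨j, b⟩ := b
  obtain rfl : i = j := h₁
  obtain rfl : a = b := Fin.ext h₂
  rfl

/-- The multicategory structure of `ℕ`: composition is composition of functions (followed by
the identification of iterated with total disjoint unions), and bijections permute the summands. -/
def nOps : MultiOps NHom where
  id _ := fun t => ⟨0, t⟩
  comp {_ _ w _ _} f g := fun t =>
    ⟨finSigmaFinEquiv ⟨(f t).1, (g (f t).1 (f t).2).1⟩,
      Fin.cast (concat_apply w ⟨_, _⟩).symm (g (f t).1 (f t).2).2⟩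
  perm {_ _} σ {_ _} f := fun t =>
    ⟨σ.symm (f t).1, Fin.cast (by simp) (f t).2⟩

theorem nOps_reindex {m n : ℕ} (σ : Fin m ≃ Fin n) {x' : Fin m → ℕ} {x : Fin n → ℕ}
    (h : ∀ i, x' i = x (σ i)) {y : ℕ} (f : NHom x y) :
    nOps.reindex σ h f = fun t =>
      ⟨σ.symm (f t).1, Fin.cast (by rw [h, Equiv.apply_symm_apply]) (f t).2⟩ := by
  obtain rfl : x' = fun i => x (σ i) := funext h
  rfl

theorem nComp_snd_congr {s : ℕ} {t : Fin s → ℕ} {w : ∀ i, Fin (t i) → ℕ} {x : Fin s → ℕ}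
    (g : ∀ i, NHom (w i) (x i)) {a b : Σ i, Fin (x i)} (h : a = b) :
    (⟨a.1, (g a.1 a.2).1⟩ : Σ i, Fin (t i)) = ⟨b.1, (g b.1 b.2).1⟩ ∧
      ((g a.1 a.2).2 : ℕ) = (g b.1 b.2).2 := by
  subst h; exact ⟨rfl, rfl⟩

/-- The multicategory `ℕ`. -/
def nMulticategory : Multicategory NHom where
  toMultiOps := nOps
  perm_refl f := by
    funext t; exact NHom.sigma_ext rfl rfl
  perm_perm σ τ _ _ f := by
    funext t; exact NHom.sigma_ext rfl rfl
  id_comp f := by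
    funext t
    exact NHom.sigma_ext rfl rfl
  comp_id f := by
    funext t
    exact NHom.sigma_ext rfl rfl
  assoc {s t u v w x y} f g h := by
    refine Eq.trans ?_ (nOps_reindex _ _ _).symm
    funext a
    have key : ∀ (p : Fin (∑ i, t i)) (q : Σ i, Fin (t i)) (hpq : p = finSigmaFinEquiv q)
        (z : Fin (concat w p)) (z' : Fin (w q.1 q.2)) (hz : z.val = z'.val),
        (⟨finSigmaFinEquiv.symm p,
          (h (finSigmaFinEquiv.symm p).1 (finSigmaFinEquiv.symm p).2 z).1⟩ :
            Σ q : Σ i, Fin (t i), Fin (u q.1 q.2)) = ⟨q, (h q.1 q.2 z').1⟩ ∧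
        (h (finSigmaFinEquiv.symm p).1 (finSigmaFinEquiv.symm p).2 z).2.val =
          (h q.1 q.2 z').2.val := by
      intro p q hpq z z' hz
      obtain rfl : q = finSigmaFinEquiv.symm p := by rw [hpq, Equiv.symm_apply_apply]
      obtain rfl : z = z' := Fin.ext hz
      exact ⟨rfl, rfl⟩
    obtain ⟨h1, h2⟩ := key _ ⟨(f a).1, (g (f a).1 (f a).2).1⟩ rfl
      (Fin.cast (concat_apply w ⟨(f a).1, (g (f a).1 (f a).2).1⟩).symm (g (f a).1 (f a).2).2)
      (g (f a).1 (f a).2).2 rfl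
    refine NHom.sigma_ext ?_ h2
    rw [Equiv.eq_symm_apply]
    refine congrArg finSigmaFinEquiv
      ((congrArg _ (Equiv.symm_apply_apply finSigmaFinEquiv _)).trans ?_)
    exact congrArg (fun q : Σ q : Σ i, Fin (t i), Fin (u q.1 q.2) =>
      (⟨q.1.1, finSigmaFinEquiv ⟨q.1.2, q.2⟩⟩ : Σ i, Fin (∑ j, u i j))) h1
  comp_perm_left {m n} σ {t w x y} f g := by
    refine Eq.trans ?_ (nOps_reindex _ _ _).symm
    funext a
    have key : ∀ (i j : Fin n) (hij : i = j) (z : Fin (x i)) (z' : Fin (x j))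
        (hz : z.val = z'.val),
        (⟨i, (g i z).1⟩ : Σ i, Fin (t i)) = ⟨j, (g j z').1⟩ ∧ (g i z).2.val = (g j z').2.val := by
      rintro i _ rfl z z' hz
      obtain rfl : z = z' := Fin.ext hz
      exact ⟨rfl, rfl⟩
    obtain ⟨h1, h2⟩ := key (σ (σ.symm (f a).1)) (f a).1 (Equiv.apply_symm_apply _ _)
      (Fin.cast (by rw [Equiv.apply_symm_apply]) (f a).2) (f a).2 rfl
    refine NHom.sigma_ext ?_ ?_
    · rw [Equiv.eq_symm_apply]
      exact congrArg finSigmaFinEquiv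
        ((congrArg _ (Equiv.symm_apply_apply finSigmaFinEquiv _)).trans h1)
    · exact h2
  comp_perm_right τ w x y f g := by
    refine Eq.trans ?_ (nOps_reindex _ _ _).symm
    funext a
    refine NHom.sigma_ext ?_ rfl
    rw [Equiv.eq_symm_apply]
    refine congrArg finSigmaFinEquiv
      ((congrArg _ (Equiv.symm_apply_apply finSigmaFinEquiv _)).trans ?_)
    refine NHom.sigma_ext rfl (congrArg Fin.val (Equiv.apply_symm_apply (τ _) _))

/-- An `r`-morphism `(D 0, …, D (r-1)) → C` of `Cat_*ᵒᵖ`: a based functor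
`C ⟶ D 0 × ⋯ × D (r-1)`, given by its coordinate functors. -/
abbrev CatHom ⦃r : ℕ⦄ (D : Fin r → BasedCat.{u}) (C : BasedCat.{u}) : Type u := ∀ i, C ⟶ D i

/-- The multicategory structure of `Cat_*ᵒᵖ`. -/
def catOps : MultiOps CatHom.{u} where
  id C := fun _ => 𝟙 C
  comp f g := fun p => f (finSigmaFinEquiv.symm p).1 ≫ g _ (finSigmaFinEquiv.symm p).2
  perm σ _ _ f := fun i => f (σ i)

theorem catOps_reindex {m n : ℕ} (σ : Fin m ≃ Fin n) {D' : Fin m → BasedCat.{u}}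
    {D : Fin n → BasedCat.{u}} (h : ∀ i, D' i = D (σ i)) {C : BasedCat.{u}} (f : CatHom D C) :
    catOps.reindex σ h f = fun i => f (σ i) ≫ eqToHom (h i).symm := by
  obtain rfl : D' = fun i => D (σ i) := funext h
  funext i
  simp [MultiOps.reindex, catOps]

theorem CatHom.comp_congr {s : ℕ} {t : Fin s → ℕ} {w : ∀ i, Fin (t i) → BasedCat.{u}}
    {x : Fin s → BasedCat.{u}} {y : BasedCat.{u}} (f : CatHom x y) (g : ∀ i, CatHom (w i) (x i))
    {a b : Σ i, Fin (t i)} (h : a = b) :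
    f a.1 ≫ g a.1 a.2 = (f b.1 ≫ g b.1 b.2) ≫ eqToHom (by rw [h]) := by
  subst h; simp

theorem comp_eqToHom_eqToHom {C D E F : BasedCat.{u}} (f : C ⟶ D) (h : D = E) (k : E = F)
    (l : F = D) : f ≫ eqToHom h ≫ eqToHom k ≫ eqToHom l = f := by
  subst h; subst k; simp

/-- The multicategory `Cat_*ᵒᵖ`. -/
def catMulticategory : Multicategory CatHom.{u} where
  toMultiOps := catOps
  perm_refl f := rfl
  perm_perm σ τ _ _ f := rfl
  id_comp f := by
    funext p
    exact Category.id_comp _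
  comp_id f := by
    funext p
    exact Category.comp_id _
  assoc {s t u v w x y} f g h := by
    refine Eq.trans ?_ (catOps_reindex _ _ _).symm
    funext p
    have h₁ := CatHom.comp_congr f (fun i => catOps.comp (g i) (h i))
      (Equiv.symm_apply_apply finSigmaFinEquiv
        ⟨(finSigmaFinEquiv.symm (finSigmaFinEquiv.symm p).1).1,
          finSigmaFinEquiv ⟨(finSigmaFinEquiv.symm (finSigmaFinEquiv.symm p).1).2,
            (finSigmaFinEquiv.symm p).2⟩⟩)
    have h₂ := CatHom.comp_congr (g (finSigmaFinEquiv.symm (finSigmaFinEquiv.symm p).1).1)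
      (h (finSigmaFinEquiv.symm (finSigmaFinEquiv.symm p).1).1)
      (Equiv.symm_apply_apply finSigmaFinEquiv
        ⟨(finSigmaFinEquiv.symm (finSigmaFinEquiv.symm p).1).2, (finSigmaFinEquiv.symm p).2⟩)
    have h₃ := h₁.trans (congrArg (· ≫ eqToHom _) (congrArg (f _ ≫ ·) h₂))
    refine Eq.trans ?_ (congrArg (· ≫ eqToHom _) h₃).symm
    simp only [Category.assoc]
    exact (Category.assoc _ _ _).trans (congrArg (f _ ≫ ·) (congrArg (g _ _ ≫ ·)
      (comp_eqToHom_eqToHom _ _ _ _).symm))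
  comp_perm_left σ t w x y f g := by
    refine Eq.trans ?_ (catOps_reindex _ _ _).symm
    funext p
    exact CatHom.comp_congr f g (Equiv.symm_apply_apply finSigmaFinEquiv
      ((Equiv.sigmaCongrLeft (β := fun i => Fin (t i)) σ) (finSigmaFinEquiv.symm p))).symm
  comp_perm_right τ w x y f g := by
    refine Eq.trans ?_ (catOps_reindex _ _ _).symm
    funext p
    exact CatHom.comp_congr f g (Equiv.symm_apply_apply finSigmaFinEquiv
      ((Equiv.sigmaCongrRight τ) (finSigmaFinEquiv.symm p))).symm

end NCat
/-! ### `Γ`-categories -/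

section Gamma

/-- The category `Γᵒᵖ`: the object `⟨n⟩` is the based set `{0, 1, …, n}`, written as the set
`[n]` with a disjoint base point added. -/
structure GammaOp where
  card : ℕ

namespace GammaOp

/-- The underlying based set; the base point is `none`. -/
abbrev toSet (a : GammaOp) : Type := Option (Fin a.card)

instance : Category GammaOp where
  Hom a b := { f : a.toSet → b.toSet // f none = none }
  id a := ⟨id, rfl⟩
  comp f g := ⟨g.1 ∘ f.1, by simp [f.2, g.2]⟩

@[simp] theorem id_val (a : GammaOp) : (𝟙 a : a ⟶ a).1 = id := rfl

@[simp] theorem comp_val {a b c : GammaOp} (f : a ⟶ b) (g : b ⟶ c) : (f ≫ g).1 = g.1 ∘ f.1 := rfl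

theorem hom_ext {a b : GammaOp} {f g : a ⟶ b} (h : ∀ t, f.1 (some t) = g.1 (some t)) : f = g := by
  apply Subtype.ext
  funext t
  cases t with
  | none => exact f.2.trans g.2.symm
  | some t => exact h t

open Classical in
/-- The canonical map `∏ᵢ (α i)₊ → (∏ᵢ α i)₊`, which sends a tuple to the base point if some
entry is the base point. -/
noncomputable def combine {ι : Type} {α : ι → Type} (x : ∀ i, Option (α i)) : Option (∀ i, α i) :=
  if h : ∀ i, (x i).isSome then some (fun i => (x i).get (h i)) else none

theorem combine_some {ι : Type} {α : ι → Type} (x : ∀ i, α i) :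
    combine (fun i => some (x i)) = some x := by
  simp [combine]

theorem combine_none {ι : Type} {α : ι → Type} {x : ∀ i, Option (α i)} {i : ι} (h : x i = none) :
    combine x = none := by
  unfold combine
  rw [dif_neg]
  intro hx
  simpa [h] using hx i

/-- The smash product `⋀ᵢ {0, …, m i} ≅ {0, …, ∏ᵢ m i}` as a functor, where the identification
is given by the lexicographic order. -/
noncomputable def smash (r : ℕ) : (Fin r → GammaOp) ⥤ GammaOp where
  obj a := ⟨∏ i, (a i).card⟩
  map {a b} f := ⟨fun t => t.bind fun t => (combine fun i =>
    (f i).1 (some ((lexEquiv fun i => (a i).card).symm t i))).map (lexEquiv fun i => (b i).card), rfl⟩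
  map_id a := by
    apply hom_ext
    intro t
    simp [combine_some]
  map_comp {a b c} f g := by
    apply hom_ext
    intro t
    simp only [Pi.comp_apply, comp_val, Function.comp_apply, Option.bind_some]
    by_cases h : ∃ i, (f i).1 (some ((lexEquiv fun i => (a i).card).symm t i)) = none
    · obtain ⟨i, hi⟩ := h
      have hi' : (g i).1 ((f i).1 (some ((lexEquiv fun i => (a i).card).symm t i))) = none := by
        rw [hi]; exact (g i).2
      rw [combine_none (i := i) hi', combine_none (i := i) hi]
      rfl
    · push Not at h
      choose y hy using fun i => Option.ne_none_iff_exists'.mp (h i)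
      simp only [hy, combine_some, Option.map_some, Option.bind_some, Equiv.symm_apply_apply]

/-- The isomorphism induced by a bijection `[m] ≅ [n]`. -/
def ofEquiv {m n : ℕ} (e : Fin m ≃ Fin n) : (⟨m⟩ : GammaOp) ⟶ ⟨n⟩ :=
  ⟨Option.map e, rfl⟩

end GammaOp

/-- A `Γ`-category: a functor `X : Γᵒᵖ ⥤ Cat_*` such that `X(0)` is a category with one object and
one morphism. -/
structure GammaCat where
  functor : GammaOp ⥤ BasedCat.{u}
  point : (functor.obj ⟨0⟩).IsPoint

/-- Maps of `Γ`-categories are natural transformations. -/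
instance : Category GammaCat.{u} where
  Hom X Y := X.functor ⟶ Y.functor
  id X := 𝟙 X.functor
  comp f g := NatTrans.vcomp f g

/-- The functor `(n 0, …, n (r-1)) ↦ X 0 (n 0) ∧ ⋯ ∧ X (r-1) (n (r-1))`. -/
def externalSmash {r : ℕ} (X : Fin r → GammaCat.{u}) : (Fin r → GammaOp) ⥤ BasedCat.{u} where
  obj n := Smash fun i => (X i).functor.obj (n i)
  map f := Smash.map fun i => (X i).functor.map (f i)
  map_id n := by
    simp only [Pi.id_apply, CategoryTheory.Functor.map_id]
    exact Smash.map_id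
  map_comp f g := by
    simp only [Pi.comp_apply, CategoryTheory.Functor.map_comp]
    exact Smash.map_comp _ _

/-- The `r`-morphisms of the multicategory of `Γ`-categories: the natural transformations from
`X 0 (n 0) ∧ ⋯ ∧ X (r-1) (n (r-1))` to `Y (n 0 ⋯ n (r-1))`. -/
abbrev GammaHom ⦃r : ℕ⦄ (X : Fin r → GammaCat.{u}) (Y : GammaCat.{u}) : Type u :=
  externalSmash X ⟶ GammaOp.smash r ⋙ Y.functor

end Gamma

/-! ### Based multifunctors and multilinear transformations -/

section Mult

/-- A based multifunctor `ℕ → Cat_*ᵒᵖ`.  The base object of `ℕ` is `[0]`, with its unique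
`r`-morphisms `([0], …, [0]) → [0]`, and that of `Cat_*ᵒᵖ` is any category with one object and one
morphism. -/
structure BasedMultifunctor where
  obj : ℕ → BasedCat.{u}
  toMultifunctor : MultifunctorOn nOps catOps.{u} obj
  based : (obj 0).IsPoint

/-- The based functor `F [m] ⟶ F [x 0] × ⋯ × F [x (r-1)]`, in coordinates, that is induced by
an `r`-morphism of `ℕ`. -/
def BasedMultifunctor.map (F : BasedMultifunctor.{u}) {r : ℕ} {x : Fin r → ℕ} {m : ℕ}
    (f : NHom x m) : CatHom (fun i => F.obj (x i)) (F.obj m) :=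
  F.toMultifunctor.map f

/-- The iterated product `λ_r` of the ring structure of `ℕ`, on morphisms: the product of the
functions `f i : [m i] → ∐ₐ [p i a]`, followed by the distributive law, where products are
identified with `[∏ᵢ m i]`, `[∏ᵢ s i]` and `[∏ᵢ p i (a i)]` by lexicographic order. -/
noncomputable def nRing {r : ℕ} {s : Fin r → ℕ} {p : ∀ i, Fin (s i) → ℕ} {m : Fin r → ℕ}
    (f : ∀ i, NHom (p i) (m i)) :
    NHom (fun q : Fin (∏ i, s i) => ∏ i, p i ((lexEquiv s).symm q i)) (∏ i, m i) :=
  fun t =>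
    let y := fun i => f i ((lexEquiv m).symm t i)
    ⟨lexEquiv s (fun i => (y i).1),
      Fin.cast (by simp [y]) (lexEquiv (fun i => p i (y i).1) (fun i => (y i).2))⟩

/-- The iterated product `λ_r` of the ring structure of `Cat_*ᵒᵖ`, on morphisms: the coordinates of
the product are the smash products of the coordinates. -/
noncomputable def catRing {r : ℕ} {s : Fin r → ℕ} {D : ∀ i, Fin (s i) → BasedCat.{u}}
    {C : Fin r → BasedCat.{u}} (f : ∀ i, CatHom (D i) (C i)) :
    CatHom (fun q : Fin (∏ i, s i) => Smash fun i => D i ((lexEquiv s).symm q i)) (Smash C) :=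
  fun q => Smash.map fun i => f i ((lexEquiv s).symm q i)

/-- Families of based functors `F 0 (m 0) ∧ ⋯ ∧ F (r-1) (m (r-1)) ⟶ G (m 0 ⋯ m (r-1))`. -/
abbrev Family {r : ℕ} (F : Fin r → ℕ → BasedCat.{u}) (G : ℕ → BasedCat.{u}) : Type u :=
  ∀ m : Fin r → ℕ, (Smash fun i => F i (m i)) ⟶ G (∏ i, m i)

/-- The `r`-morphisms of the twisted multicategory of based multifunctors: the based `r`-linear
transformations `φ : λ_r ∘ (F 0, …, F (r-1)) → G ∘ λ_r`.  Multinaturality is required for all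
`r`-tuples of morphisms `f i` of `ℕ`.  If all `f i` but one are identities, this is
multinaturality in one variable; if all but two are identities, it says that the two composites
in the bilinearity diagram both agree with the canonical one. -/
@[ext]
structure MultilinearTrans ⦃r : ℕ⦄ (F : Fin r → BasedMultifunctor.{u})
    (G : BasedMultifunctor.{u}) where
  fam : Family (fun i => (F i).obj) G.obj
  natural : ∀ {s : Fin r → ℕ} {p : ∀ i, Fin (s i) → ℕ} {m : Fin r → ℕ}
    (f : ∀ i, NHom (p i) (m i)) (q : Fin (∏ i, s i)),
    catRing (fun i => (F i).map (f i)) q ≫ fam (fun i => p i ((lexEquiv s).symm q i)) =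
      fam m ≫ G.map (nRing f) q

end Mult

/-! ### The structure maps of the two multicategories, in components -/

section Levels

/-- A sequence of based categories on which the bijections `[m] ≅ [n]` act. -/
structure Levels where
  obj : ℕ → BasedCat.{u}
  act : ∀ {m n : ℕ}, (Fin m ≃ Fin n) → (obj m ⟶ obj n)

/-- The levels `X(n)` of a `Γ`-category. -/
def GammaCat.levels (X : GammaCat.{u}) : Levels.{u} where
  obj n := X.functor.obj ⟨n⟩
  act e := X.functor.map (GammaOp.ofEquiv e)

/-- The levels `F[n]` of a based multifunctor.  A bijection `[m] ≅ [n]` is a `1`-morphism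
`[n] → [m]` of `ℕ`, so that it induces a functor `F[m] ⟶ F[n]`. -/
def BasedMultifunctor.levels (F : BasedMultifunctor.{u}) : Levels.{u} where
  obj := F.obj
  act {_ n} e := F.map (x := fun _ : Fin 1 => n) (fun t => ⟨0, e t⟩) 0

/-- The identity `F m ≅ F (m)`, where `(m)` is a product with only one factor. -/
noncomputable def idFamily (F : Levels.{u}) : Family (fun _ : Fin 1 => F.obj) F.obj := fun m =>
  Smash.desc (Pi.eval (fun i : Fin 1 => F.obj (m i)) 0)
      { obj := by intro x i hx; obtain rfl : i = 0 := Subsingleton.elim _ _; exact hx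
        map := by
          intro x y f i hx hy hf; obtain rfl : i = 0 := Subsingleton.elim _ _; exact hf } ≫
    F.act ((Equiv.piUnique fun i : Fin 1 => Fin (m i)).symm.trans (lexEquiv m))

/-- The canonical functor from a smash product to an iterated smash product. -/
def Smash.nest {P : Type} {I : Type} {J : I → Type} {C : P → BasedCat.{u}}
    {D : ∀ i, J i → BasedCat.{u}} (e : (Σ i, J i) ≃ P) (h : ∀ i j, C (e ⟨i, j⟩) ⟶ D i j) :
    Smash C ⟶ Smash fun i => Smash (D i) :=
  Smash.desc
    (Functor.pi' (fun i => Functor.pi' (fun j =>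
      Pi.eval (fun p => C p) (e ⟨i, j⟩) ⋙ BasedFunctor.functor (h i j)) ⋙ Smash.proj (D i)) ⋙
        Smash.proj fun i => Smash (D i))
    { obj := by
        intro x p hx
        obtain ⟨⟨i, j⟩, rfl⟩ := e.surjective p
        refine Smash.proj_multiBased.obj _ i (Smash.proj_multiBased.obj _ j ?_)
        simp [hx, BasedFunctor.obj_base]
      map := by
        intro x y f p hx hy hf
        obtain ⟨⟨i, j⟩, rfl⟩ := e.surjective p
        have hx' : (BasedFunctor.functor (h i j)).obj (x (e ⟨i, j⟩)) = (D i j).base := by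
          rw [hx, BasedFunctor.obj_base]
        have hy' : (BasedFunctor.functor (h i j)).obj (y (e ⟨i, j⟩)) = (D i j).base := by
          rw [hy, BasedFunctor.obj_base]
        refine Smash.proj_multiBased.map _ i (Smash.proj_multiBased.obj _ j hx')
          (Smash.proj_multiBased.obj _ j hy') (Smash.proj_multiBased.map _ j hx' hy' ?_)
        change (BasedFunctor.functor (h i j)).map (f (e ⟨i, j⟩)) = _
        rw [hf]
        exact eqToHom_map _ _ }

/-- The composite of families: the functor
`⋀ᵢ ⋀ⱼ F i j (m i j) ⟶ ⋀ᵢ G i (∏ⱼ m i j) ⟶ H (∏ᵢ ∏ⱼ m i j)`. -/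
noncomputable def compFamily {s : ℕ} {t : Fin s → ℕ} {F : ∀ i, Fin (t i) → Levels.{u}}
    {G : Fin s → Levels.{u}} {H : Levels.{u}}
    (ψ : Family (fun i => (G i).obj) H.obj)
    (φ : ∀ i, Family (fun j => (F i j).obj) (G i).obj) :
    Family (fun p => (concat F p).obj) H.obj := fun m =>
  Smash.nest (D := fun i j => (F i j).obj (m (finSigmaFinEquiv ⟨i, j⟩))) finSigmaFinEquiv
      (fun i j => eqToHom (congrArg (fun L : Levels.{u} => L.obj _) (concat_apply F ⟨i, j⟩))) ≫
    Smash.map (fun i => φ i fun j => m (finSigmaFinEquiv ⟨i, j⟩)) ≫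
    ψ (fun i => ∏ j, m (finSigmaFinEquiv ⟨i, j⟩)) ≫
    H.act ((lexEquiv _).symm.trans ((Equiv.piCongrRight fun _ => (lexEquiv _).symm).trans
      ((Equiv.piCurry fun i j => Fin (m (finSigmaFinEquiv ⟨i, j⟩))).symm.trans
        ((Equiv.piCongrLeft (fun p => Fin (m p)) finSigmaFinEquiv).trans (lexEquiv m)))))

/-- The action of a bijection on families: the functor
`⋀ᵢ F (σ i) (m i) ≅ ⋀ⱼ F j (m (σ⁻¹ j)) ⟶ G (∏ⱼ m (σ⁻¹ j)) ≅ G (∏ᵢ m i)`. -/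
noncomputable def permFamily {k n : ℕ} (σ : Fin k ≃ Fin n) {F : Fin n → Levels.{u}}
    {G : Levels.{u}} (φ : Family (fun j => (F j).obj) G.obj) :
    Family (fun i => (F (σ i)).obj) G.obj := fun m =>
  Smash.mapAlong (D := fun j => (F j).obj (m (σ.symm j))) σ.symm σ.symm.surjective
      (fun j => eqToHom (congrArg (fun j' => (F j').obj _) (Equiv.apply_symm_apply σ j))) ≫
    φ (fun j => m (σ.symm j)) ≫
    G.act ((lexEquiv _).symm.trans
      ((Equiv.piCongrLeft (fun i => Fin (m i)) σ.symm).trans (lexEquiv m)))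

/-- The family underlying an `r`-morphism of `Γ`-categories. -/
def gammaFam {r : ℕ} {X : Fin r → GammaCat.{u}} {Y : GammaCat.{u}} (f : GammaHom X Y) :
    Family (fun i => (X i).levels.obj) Y.levels.obj :=
  fun m => f.app fun i => ⟨m i⟩

/-- The multicategory structures of interest are computed in components by the families above. -/
structure Levelwise {O : Type v} {Hom : ∀ ⦃r : ℕ⦄, (Fin r → O) → O → Type w}
    (M : MultiOps Hom) (lev : O → Levels.{u})
    (fam : ∀ {r : ℕ} {x : Fin r → O} {y : O}, Hom x y →
      Family (fun i => (lev (x i)).obj) (lev y).obj) : Prop where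
  id (x : O) : fam (M.id x) = idFamily (lev x)
  comp {s : ℕ} {t : Fin s → ℕ} {w : ∀ i, Fin (t i) → O} {x : Fin s → O} {y : O}
    (f : Hom x y) (g : ∀ i, Hom (w i) (x i)) :
    fam (M.comp f g) = compFamily (F := fun i j => lev (w i j)) (G := fun i => lev (x i))
      (fam f) (fun i => fam (g i))
  perm {k n : ℕ} (σ : Fin k ≃ Fin n) {x : Fin n → O} {y : O} (f : Hom x y) :
    fam (M.perm σ f) = permFamily σ (F := fun i => lev (x i)) (fam f)

end Levels

/-! ### The construction `A` -/

section A

/-- The map of based sets `([x 0] ⨿ ⋯ ⨿ [x (r-1)])₊ → [x i]₊` that collapses all summands but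
the `i`-th one. -/
def collapse {r : ℕ} {x : Fin r → ℕ} (i : Fin r) (z : Σ i, Fin (x i)) : Option (Fin (x i)) :=
  if h : z.1 = i then some (h ▸ z.2) else none

theorem collapse_self {r : ℕ} {x : Fin r → ℕ} (i : Fin r) (a : Fin (x i)) :
    collapse i ⟨i, a⟩ = some a := by simp [collapse]

theorem collapse_ne {r : ℕ} {x : Fin r → ℕ} (i : Fin r) (z : Σ i, Fin (x i)) (h : z.1 ≠ i) :
    collapse i z = none := by simp [collapse, h]

/-- The map `f_i : [m]₊ → [x i]₊` in `Γᵒᵖ` obtained from `f : [m] → [x 0] ⨿ ⋯ ⨿ [x (r-1)]` by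
adding base points and collapsing all summands but the `i`-th one. -/
def gammaCoord {r : ℕ} {x : Fin r → ℕ} {m : ℕ} (f : NHom x m) (i : Fin r) :
    (⟨m⟩ : GammaOp) ⟶ ⟨x i⟩ :=
  ⟨fun t => t.bind fun t => collapse i (f t), rfl⟩

theorem collapse_eq_some {r : ℕ} {x : Fin r → ℕ} (i : Fin r) (z : Σ i, Fin (x i)) (a : Fin (x i))
    (h : z.1 = i) (ha : z.2.val = a.val) : collapse i z = some a := by
  obtain ⟨j, b⟩ := z
  obtain rfl : j = i := h
  obtain rfl : b = a := Fin.ext ha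
  exact collapse_self _ _

theorem gammaCoord_comp {s : ℕ} {t : Fin s → ℕ} {w : ∀ i, Fin (t i) → ℕ} {x : Fin s → ℕ} {y : ℕ}
    (f : NHom x y) (g : ∀ i, NHom (w i) (x i)) (p : Fin (∑ i, t i)) :
    gammaCoord (nOps.comp f g) p =
      gammaCoord f (finSigmaFinEquiv.symm p).1 ≫ gammaCoord (g _) (finSigmaFinEquiv.symm p).2 := by
  apply GammaOp.hom_ext
  intro a
  change collapse p (⟨finSigmaFinEquiv ⟨(f a).1, (g (f a).1 (f a).2).1⟩,
      Fin.cast (concat_apply w ⟨_, _⟩).symm (g (f a).1 (f a).2).2⟩ : Σ p, Fin (concat w p)) =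
    (collapse (finSigmaFinEquiv.symm p).1 (f a)).bind fun a =>
      collapse (finSigmaFinEquiv.symm p).2 (g _ a)
  generalize f a = z
  obtain ⟨i, z⟩ := z
  by_cases h : i = (finSigmaFinEquiv.symm p).1
  · subst h
    rw [collapse_self, Option.bind_some]
    change collapse p (⟨finSigmaFinEquiv ⟨_, (g _ z).1⟩,
      Fin.cast (concat_apply w ⟨_, _⟩).symm (g _ z).2⟩ : Σ p, Fin (concat w p)) = _
    generalize g _ z = b
    obtain ⟨j, b⟩ := b
    by_cases h : j = (finSigmaFinEquiv.symm p).2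
    · subst h
      rw [collapse_self]
      exact collapse_eq_some p _ _ (Equiv.apply_symm_apply _ _) rfl
    · rw [collapse_ne _ ⟨j, b⟩ h]
      refine collapse_ne _ _ fun hp => h ?_
      have hp' : (⟨_, j⟩ : Σ i, Fin (t i)) = finSigmaFinEquiv.symm p :=
        (Equiv.eq_symm_apply _).mpr hp
      exact eq_of_heq (Sigma.mk.inj hp').2
  · rw [collapse_ne _ ⟨i, z⟩ h]
    refine collapse_ne _ _ fun hp => h ?_
    exact congrArg Sigma.fst ((Equiv.eq_symm_apply _).mpr hp)

theorem gammaCoord_perm {m n : ℕ} (σ : Fin m ≃ Fin n) {x : Fin n → ℕ} {y : ℕ} (f : NHom x y)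
    (i : Fin m) : gammaCoord (nOps.perm σ f) i = gammaCoord f (σ i) := by
  apply GammaOp.hom_ext
  intro a
  change collapse i (nOps.perm σ f a) = collapse (σ i) (f a)
  by_cases h : (f a).1 = σ i
  · have hz : ∃ b : Fin (x (σ i)), f a = ⟨σ i, b⟩ := by
      generalize f a = z at h
      obtain ⟨j, z⟩ := z
      obtain rfl : j = σ i := h
      exact ⟨z, rfl⟩
    obtain ⟨b, hb⟩ := hz
    rw [hb, collapse_self]
    refine collapse_eq_some i _ _ ?_ ?_
    · exact (Equiv.symm_apply_eq σ).mpr h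
    · change (f a).2.val = b.val
      rw [hb]
  · rw [collapse_ne _ _ h]
    exact collapse_ne _ _ fun hi => h ((Equiv.symm_apply_eq σ).mp hi)

theorem gammaCoord_id (m : ℕ) (i : Fin 1) : gammaCoord (nOps.id m) i = 𝟙 (⟨m⟩ : GammaOp) := by
  apply GammaOp.hom_ext
  intro a
  exact collapse_eq_some i _ _ (Subsingleton.elim _ _) rfl

/-- The based multifunctor `A X : [n] ↦ X(n)` of a `Γ`-category `X`.  The `i`-th coordinate of
`AX(f)` is `X(f_i)`. -/
def constructionA (X : GammaCat.{u}) : BasedMultifunctor.{u} where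
  obj n := X.functor.obj ⟨n⟩
  toMultifunctor :=
    { map := fun f i => X.functor.map (gammaCoord f i)
      map_id := fun m => funext fun i => by
        rw [gammaCoord_id]; exact X.functor.map_id _
      map_comp := fun f g => funext fun p => by
        rw [gammaCoord_comp]; exact X.functor.map_comp _ _
      map_perm := fun σ x y f => funext fun i => by
        rw [gammaCoord_perm]; rfl }
  based := X.point

end A
end Mandell

open Mandell MonoidalCategory

/-! Both multicategories rest on one description of multimorphisms, `GMor`, in which no enumeration
of products occurs. A natural transformation X_1(m_1) ∧ … ∧ X_r(m_r) → Y(m_1⋯m_r) is the same as a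
family of functors ∏ X_i(m_i) → Y(k), one for every map θ : ⋀ m_i → k of based sets, which is
natural and collapses the coordinate hyperplanes (`GMor.equivHom`): the component at m is the value
at the universal θ. Variables can then be indexed by any set, a permutation renames variables, and a
composite can be evaluated through any factorization of θ (`GMor.ev_compU`). The multicategory
axioms become equalities of bijections between index sets, and the lexicographic order returns only
when components are computed (`gammaMulticategory_levelwise`). Functors are handled through their
action on arrows (`Arr`), with identities and composites as predicates, which avoids transport along
equalities of objects.

Based multifunctors carry no more information than Γ-categories. By `BasedMultifunctor.map_eq_hat` a
coordinate of F(f) depends only on the based map f_i, and every based map g is such a coordinate: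
`hat g` sends the points with value the base point to an extra summand. So F has an associated
Γ-category `toGamma` with the same levels. Since the coordinates of f_1 × … × f_r are smash products
of coordinates (`gammaCoord_nRing`), multilinear transformations are exactly natural transformations
(`MultilinearTrans.equivGammaHom`). The second multicategory is transported from the first, and A is
a multifunctor because both structures are given by the same formulas in components.

The Day convolution at level k is the category presented by two coends of sets over the maps m ∧ n →
k, one of objects and one of arrows, with the composites that come from pairs of composites. No
hyperplane has to be collapsed, because X(0) and Y(0) are points. It represents bilinear maps
(`BiMor.desc`), which gives the left Kan extension property. Maps out of iterated products come from
currying into an internal hom (`ihom`); this yields the associativity and, by induction on r, the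
bijection between r-morphisms and maps out of the iterated tensor product (`tensorU_bijective`).
Coherence diagrams are checked on generators, where they reduce to identities between maps of finite
based sets. -/

namespace Mandell

/-! ### Arrows of a category -/

section Arrows

/-- An arrow of a category, together with its source and its target. -/
structure Arr (C : Type u) [SmallCategory C] : Type u where
  src : C
  tgt : C
  hom : src ⟶ tgt

namespace Arr

variable {C D E : Type u} [SmallCategory C] [SmallCategory D] [SmallCategory E]

/-- The arrow given by a morphism. -/
def of {x y : C} (f : x ⟶ y) : Arr C := ⟨x, y, f⟩

theorem of_inj {x y : C} {f g : x ⟶ y} (h : of f = of g) : f = g := by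
  simpa [of] using h

/-- The gain from bundling: a transport morphism is invisible as an arrow, so equalities of objects
need no bookkeeping. -/
theorem of_eqToHom {x y : C} (h : x = y) : of (eqToHom h) = of (𝟙 x) := by
  subst h; rfl

/-- The action of a functor on arrows. -/
def map (F : C ⥤ D) (a : Arr C) : Arr D := of (F.map a.hom)

@[simp] theorem map_of (F : C ⥤ D) {x y : C} (f : x ⟶ y) : map F (of f) = of (F.map f) := rfl

theorem functor_ext {F G : C ⥤ D} (h : ∀ a, map F a = map G a) : F = G := by
  refine CategoryTheory.Functor.hext (fun x => congrArg Arr.src (h (of (𝟙 x)))) fun x y f => ?_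
  have := h (of f)
  simp only [of] at this
  injection this

/-- Identity arrows. -/
inductive IsId : Arr C → Prop
  | mk (x : C) : IsId (of (𝟙 x))

/-- `IsComp a b c` means that `c` is the composite of `a` and `b`. -/
inductive IsComp : Arr C → Arr C → Arr C → Prop
  | mk {x y z : C} (f : x ⟶ y) (g : y ⟶ z) : IsComp (of f) (of g) (of (f ≫ g))

/-- The identity of the source. -/
def srcId (a : Arr C) : Arr C := of (𝟙 a.src)

/-- The identity of the target. -/
def tgtId (a : Arr C) : Arr C := of (𝟙 a.tgt)

theorem isId_srcId (a : Arr C) : IsId a.srcId := .mk _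

theorem isId_tgtId (a : Arr C) : IsId a.tgtId := .mk _

theorem IsId.srcId_eq {a : Arr C} (h : IsId a) : a.srcId = a := by cases h; rfl

theorem IsId.tgtId_eq {a : Arr C} (h : IsId a) : a.tgtId = a := by cases h; rfl

theorem IsId.eq_of {a : Arr C} (h : IsId a) : a = of (𝟙 a.src) := by cases h; rfl

theorem isComp_srcId (a : Arr C) : IsComp a.srcId a a := by
  have := IsComp.mk (𝟙 a.src) a.hom
  rwa [Category.id_comp] at this

theorem isComp_tgtId (a : Arr C) : IsComp a a.tgtId a := by
  have := IsComp.mk a.hom (𝟙 a.tgt)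
  rwa [Category.comp_id] at this

theorem IsId.isComp {a : Arr C} (h : IsId a) : IsComp a a a := by
  have := isComp_srcId a
  rwa [h.srcId_eq] at this

theorem IsComp.src_eq {a b c : Arr C} (h : IsComp a b c) : c.src = a.src := by cases h; rfl

theorem IsComp.tgt_eq {a b c : Arr C} (h : IsComp a b c) : c.tgt = b.tgt := by cases h; rfl

theorem IsComp.mid_eq {a b c : Arr C} (h : IsComp a b c) : a.tgt = b.src := by cases h; rfl

theorem IsComp.srcId_eq {a b c : Arr C} (h : IsComp a b c) : c.srcId = a.srcId := by cases h; rfl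

theorem IsComp.tgtId_eq {a b c : Arr C} (h : IsComp a b c) : c.tgtId = b.tgtId := by cases h; rfl

theorem IsComp.midId_eq {a b c : Arr C} (h : IsComp a b c) : a.tgtId = b.srcId := by cases h; rfl

/-- The composite is determined by the two arrows. The generalizations in the proof free the indices
of `IsComp`, so that case analysis can unify them. -/
theorem isComp_iff {x y z : C} (f : x ⟶ y) (g : y ⟶ z) (c : Arr C) :
    IsComp (of f) (of g) c ↔ c = of (f ≫ g) := by
  constructor
  · generalize ha : of f = a
    generalize hb : of g = b
    rintro ⟨f', g'⟩
    cases ha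
    cases hb
    rfl
  · rintro rfl
    exact .mk f g

/-- The composite of two arrows. -/
def comp (a b : Arr C) (h : a.tgt = b.src) : Arr C := of (a.hom ≫ eqToHom h ≫ b.hom)

theorem isComp_comp (a b : Arr C) (h : a.tgt = b.src) : IsComp a b (comp a b h) := by
  obtain ⟨x, y, f⟩ := a
  obtain ⟨y', z, g⟩ := b
  obtain rfl : y = y' := h
  have := IsComp.mk f g
  change IsComp (of f) (of g) (of (f ≫ 𝟙 y ≫ g))
  rwa [Category.id_comp]

theorem IsComp.unique {a b c c' : Arr C} (h : IsComp a b c) (h' : IsComp a b c') : c = c' := by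
  cases h with
  | mk f g => exact ((isComp_iff f g c').mp h').symm

theorem IsComp.assoc {a b c ab bc abc : Arr C} (h₁ : IsComp a b ab) (h₂ : IsComp ab c abc)
    (h₃ : IsComp b c bc) : IsComp a bc abc := by
  cases h₃ with
  | mk g h =>
    generalize hb : of g = b at h₁
    cases h₁ with
    | mk f g' =>
      cases hb
      rw [(isComp_iff _ _ _).mp h₂, Category.assoc]
      exact .mk _ _

/-- Composability of `ab` and `c` is read off from the other composites; `IsComp.assoc` and
uniqueness then identify the result. -/
theorem IsComp.assoc' {a b c ab bc abc : Arr C} (h₁ : IsComp b c bc) (h₂ : IsComp a bc abc)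
    (h₃ : IsComp a b ab) : IsComp ab c abc := by
  have h : IsComp ab c (comp ab c (h₃.tgt_eq.trans h₁.mid_eq)) := isComp_comp _ _ _
  rwa [h₂.unique (h₃.assoc h h₁)]

theorem isId_map (F : C ⥤ D) {a : Arr C} (h : IsId a) : IsId (map F a) := by
  cases h
  rw [map_of, CategoryTheory.Functor.map_id]
  exact .mk _

theorem isComp_map (F : C ⥤ D) {a b c : Arr C} (h : IsComp a b c) :
    IsComp (map F a) (map F b) (map F c) := by
  cases h
  simp only [map_of, CategoryTheory.Functor.map_comp]
  exact .mk _ _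

/-- An arrow, as a morphism between objects that are equal to its source and its target. -/
def homOf (a : Arr C) {x y : C} (hx : a.src = x) (hy : a.tgt = y) : x ⟶ y :=
  eqToHom hx.symm ≫ a.hom ≫ eqToHom hy

@[simp] theorem of_homOf (a : Arr C) {x y : C} (hx : a.src = x) (hy : a.tgt = y) :
    of (a.homOf hx hy) = a := by
  subst hx hy
  simp [homOf, of]

theorem IsComp.of_homOf_comp {a b c : Arr C} (h : IsComp a b c) {x y z : C} (hx : a.src = x)
    (hy : a.tgt = y) (hy' : b.src = y) (hz : b.tgt = z) :
    of (a.homOf hx hy ≫ b.homOf hy' hz) = c := by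
  have := IsComp.mk (a.homOf hx hy) (b.homOf hy' hz)
  rw [of_homOf, of_homOf] at this
  exact this.unique h

section

variable (e : Arr C → Arr D) (hid : ∀ a, IsId a → IsId (e a))
  (hcomp : ∀ a b c, IsComp a b c → IsComp (e a) (e b) (e c))

include hcomp in
theorem src_of_isComp {x y : C} (f : x ⟶ y) : (e (of f)).src = (e (of (𝟙 x))).src :=
  (hcomp _ _ _ (isComp_srcId (of f))).src_eq

include hid hcomp in
-- The image of `𝟙 y` is again an identity, so its target, which is where the image of `f` ends, is
-- also its source.
theorem tgt_of_isComp {x y : C} (f : x ⟶ y) : (e (of f)).tgt = (e (of (𝟙 y))).src :=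
  (hcomp _ _ _ (isComp_tgtId (of f))).tgt_eq.trans (congrArg Arr.tgt (hid _ (IsId.mk y)).eq_of)

/-- A functor from its action on arrows. -/
def toFunctor : C ⥤ D where
  obj x := (e (of (𝟙 x))).src
  map f := (e (of f)).homOf (src_of_isComp e hcomp f) (tgt_of_isComp e hid hcomp f)
  map_id x := of_inj ((of_homOf _ _ _).trans (hid _ (IsId.mk x)).eq_of)
  map_comp f g := of_inj ((of_homOf _ _ _).trans
    ((hcomp _ _ _ (IsComp.mk f g)).of_homOf_comp _ _ _ _).symm)

@[simp] theorem map_toFunctor (a : Arr C) : map (toFunctor e hid hcomp) a = e a :=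
  of_homOf (e a) (src_of_isComp e hcomp a.hom) (tgt_of_isComp e hid hcomp a.hom)

end

end Arr

open Arr

/-- The arrows of a product category. -/
def arrPi {ι : Type} {C : ι → Type u} [∀ i, SmallCategory (C i)] (a : ∀ i, Arr (C i)) :
    Arr (∀ i, C i) :=
  @Arr.mk (∀ i, C i) _ (fun i => (a i).src) (fun i => (a i).tgt) fun i => (a i).hom

/-- The coordinates of an arrow of a product category. -/
def arrCoord {ι : Type} {C : ι → Type u} [∀ i, SmallCategory (C i)] (a : Arr (∀ i, C i)) (i : ι) :
    Arr (C i) := of (a.hom i)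

theorem isId_arrPi {ι : Type} {C : ι → Type u} [∀ i, SmallCategory (C i)] {a : ∀ i, Arr (C i)}
    (h : ∀ i, IsId (a i)) : IsId (arrPi a) := by
  rw [show a = fun i => of (𝟙 (a i).src) from funext fun i => (h i).eq_of]
  exact IsId.mk (C := ∀ i, C i) fun i => (a i).src

theorem isComp_arrPi {ι : Type} {C : ι → Type u} [∀ i, SmallCategory (C i)]
    {a b c : ∀ i, Arr (C i)} (h : ∀ i, IsComp (a i) (b i) (c i)) :
    IsComp (arrPi a) (arrPi b) (arrPi c) := by
  have hm : (arrPi a).tgt = (arrPi b).src := funext fun i => (h i).mid_eq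
  have key := isComp_comp (arrPi a) (arrPi b) hm
  have hc : c = fun i => comp (a i) (b i) (h i).mid_eq :=
    funext fun i => (h i).unique (isComp_comp _ _ _)
  convert key using 1
  rw [hc]
  unfold comp of arrPi
  congr 1
  funext i
  -- In a product category `eqToHom` is computed coordinatewise.
  exact congrArg (fun f => (a i).hom ≫ f ≫ (b i).hom) (CategoryTheory.Functor.eqToHom_proj hm i).symm

theorem isId_arrCoord {ι : Type} {C : ι → Type u} [∀ i, SmallCategory (C i)] {a : Arr (∀ i, C i)}
    (h : IsId a) (i : ι) : IsId (arrCoord a i) := by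
  cases h; exact IsId.mk _

theorem isComp_arrCoord {ι : Type} {C : ι → Type u} [∀ i, SmallCategory (C i)]
    {a b c : Arr (∀ i, C i)} (h : IsComp a b c) (i : ι) :
    IsComp (arrCoord a i) (arrCoord b i) (arrCoord c i) := by
  cases h; exact IsComp.mk _ _

/-- The base arrow of a based category. -/
def BasedCat.baseArr (C : BasedCat.{u}) : Arr C := of (𝟙 C.base)

theorem BasedCat.isId_baseArr (C : BasedCat.{u}) : IsId C.baseArr := .mk _

/-- The action of a based functor on arrows. -/
def BasedFunctor.arr {C D : BasedCat.{u}} (F : C ⟶ D) (a : Arr C) : Arr D :=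
  Arr.map (BasedFunctor.functor F) a

theorem BasedFunctor.arr_ext {C D : BasedCat.{u}} {F G : C ⟶ D} (h : ∀ a, arr F a = arr G a) :
    F = G :=
  BasedCat.hom_ext (functor_ext h)

@[simp] theorem BasedFunctor.arr_comp {C D E : BasedCat.{u}} (F : C ⟶ D) (G : D ⟶ E) (a : Arr C) :
    arr (F ≫ G) a = arr G (arr F a) := rfl

@[simp] theorem BasedFunctor.arr_base {C D : BasedCat.{u}} (F : C ⟶ D) :
    arr F C.baseArr = D.baseArr := by
  refine (isId_map _ C.isId_baseArr).eq_of.trans ?_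
  exact congrArg (fun x => Arr.of (𝟙 x)) F.obj_base

theorem BasedFunctor.isId_arr {C D : BasedCat.{u}} (F : C ⟶ D) {a : Arr C} (h : IsId a) :
    IsId (arr F a) := isId_map _ h

theorem BasedFunctor.isComp_arr {C D : BasedCat.{u}} (F : C ⟶ D) {a b c : Arr C}
    (h : IsComp a b c) : IsComp (arr F a) (arr F b) (arr F c) := isComp_map _ h

/-- A based functor from its action on arrows. -/
def BasedFunctor.ofArr {C D : BasedCat.{u}} (e : Arr C → Arr D) (hid : ∀ a, IsId a → IsId (e a))
    (hcomp : ∀ a b c, IsComp a b c → IsComp (e a) (e b) (e c)) (hbase : e C.baseArr = D.baseArr) :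
    C ⟶ D where
  functor := toFunctor e hid hcomp
  obj_base := congrArg Arr.src hbase

@[simp] theorem BasedFunctor.arr_ofArr {C D : BasedCat.{u}} (e : Arr C → Arr D)
    (hid : ∀ a, IsId a → IsId (e a))
    (hcomp : ∀ a b c, IsComp a b c → IsComp (e a) (e b) (e c)) (hbase : e C.baseArr = D.baseArr)
    (a : Arr C) : arr (ofArr e hid hcomp hbase) a = e a :=
  map_toFunctor e hid hcomp a

/-- Lets the transports in `compFamily` and `permFamily` be dropped when arrows are compared
heterogeneously. -/
theorem BasedFunctor.arr_eqToHom_heq {C D : BasedCat.{u}} (h : C = D) (a : Arr C) :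
    HEq (arr (eqToHom h) a) a := by
  subst h; rfl

theorem BasedCat.IsPoint.eq_base {C : BasedCat.{u}} (h : C.IsPoint) (a : Arr C) :
    a = C.baseArr := by
  obtain ⟨x, y, f⟩ := a
  obtain rfl := h.1 x
  obtain rfl := h.1 y
  rw [h.2 f]
  rfl

theorem BasedCat.isPoint_of_arr {C : BasedCat.{u}} (h : ∀ a : Arr C, a = C.baseArr) : C.IsPoint :=
  ⟨fun x => congrArg Arr.src (h (of (𝟙 x))), fun f => of_inj (h (of f))⟩

end Arrows

/-! ### Smash products in terms of arrows -/

namespace Smash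

open Arr

variable {ι : Type} {C : ι → BasedCat.{u}}

/-- The arrow of the smash product given by a tuple of arrows. -/
def tup (a : ∀ i, Arr (C i)) : Arr (Smash C) := Arr.map (Smash.proj C) (arrPi a)

/-- Apart from the base object, the smash product is generated by the product category, and an arrow
of the latter is a tuple of arrows. -/
theorem arr_ext {D : BasedCat.{u}} {F G : Smash C ⟶ D}
    (h : ∀ a : ∀ i, Arr (C i), BasedFunctor.arr F (tup a) = BasedFunctor.arr G (tup a)) : F = G :=
  Smash.hom_ext (functor_ext fun a => h (arrCoord a))

theorem isId_tup {a : ∀ i, Arr (C i)} (h : ∀ i, IsId (a i)) : IsId (tup a) :=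
  isId_map _ (isId_arrPi h)

theorem isComp_tup {a b c : ∀ i, Arr (C i)} (h : ∀ i, IsComp (a i) (b i) (c i)) :
    IsComp (tup a) (tup b) (tup c) :=
  isComp_map _ (isComp_arrPi h)

/-- Both clauses of `MultiBased`, for objects and for morphisms, become one condition on arrows; the
`eqToHom` disappears by `of_eqToHom`. -/
theorem _root_.Mandell.MultiBased.map_eq_base {D : BasedCat.{u}} {H : Tuple C ⥤ D}
    (hH : MultiBased H) {a : ∀ i, Arr (C i)} {i : ι} (h : a i = (C i).baseArr) :
    Arr.map H (arrPi a) = D.baseArr := by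
  have hx : (a i).src = (C i).base := congrArg Arr.src h
  have hy : (a i).tgt = (C i).base := congrArg Arr.tgt h
  change Arr.of (H.map (arrPi a).hom) = _
  rw [hH.map (arrPi a).hom i hx hy, of_eqToHom, hH.obj _ i hx]
  · rfl
  · apply of_inj
    rw [of_eqToHom]
    change a i = of (𝟙 (a i).src)
    rw [hx]
    exact h

theorem tup_eq_base {a : ∀ i, Arr (C i)} {i : ι} (h : a i = (C i).baseArr) :
    tup a = (Smash C).baseArr :=
  Smash.proj_multiBased.map_eq_base h

@[simp] theorem arr_desc_tup {D : BasedCat.{u}} (H : Tuple C ⥤ D) (hH : MultiBased H)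
    (a : ∀ i, Arr (C i)) : BasedFunctor.arr (Smash.desc H hH) (tup a) = Arr.map H (arrPi a) := by
  conv_rhs => rw [← Smash.proj_desc H hH]
  rfl

/-- A based functor out of a smash product, from its action on tuples of arrows. -/
def ofArr {D : BasedCat.{u}} (e : (∀ i, Arr (C i)) → Arr D)
    (hid : ∀ a, (∀ i, IsId (a i)) → IsId (e a))
    (hcomp : ∀ a b c, (∀ i, IsComp (a i) (b i) (c i)) → IsComp (e a) (e b) (e c))
    (hbase : ∀ a i, a i = (C i).baseArr → e a = D.baseArr) : Smash C ⟶ D :=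
  Smash.desc (toFunctor (C := Tuple C) (fun a => e (arrCoord a))
    (fun _ h => hid _ (isId_arrCoord h)) fun _ _ _ h => hcomp _ _ _ (isComp_arrCoord h))
    (by
      have hobj : ∀ (x : Tuple C) (i : ι), x i = (C i).base →
          (e (arrCoord (of (𝟙 x)))).src = D.base := fun x i hx =>
        congrArg Arr.src (hbase _ i (by
          change of (𝟙 (x i)) = _
          rw [hx]
          rfl))
      refine ⟨hobj, fun {x y} f i hx hy hf => of_inj ?_⟩
      refine (map_toFunctor _ _ _ (of (C := Tuple C) f)).trans ?_
      rw [of_eqToHom, hbase _ i, BasedCat.baseArr]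
      · exact congrArg (fun z => of (𝟙 z)) (hobj x i hx).symm
      · change of (f i) = _
        rw [hf, of_eqToHom, hx]
        rfl)

@[simp] theorem arr_ofArr_tup {D : BasedCat.{u}} (e : (∀ i, Arr (C i)) → Arr D)
    (hid : ∀ a, (∀ i, IsId (a i)) → IsId (e a))
    (hcomp : ∀ a b c, (∀ i, IsComp (a i) (b i) (c i)) → IsComp (e a) (e b) (e c))
    (hbase : ∀ a i, a i = (C i).baseArr → e a = D.baseArr) (a : ∀ i, Arr (C i)) :
    BasedFunctor.arr (ofArr e hid hcomp hbase) (tup a) = e a :=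
  (arr_desc_tup _ _ _).trans (map_toFunctor (C := Tuple C) (fun a => e (arrCoord a)) _ _ (arrPi a))

@[simp] theorem arr_mapAlong_tup {κ : Type} {D : κ → BasedCat.{u}} (σ : κ → ι)
    (hσ : Function.Surjective σ) (h : ∀ k, C (σ k) ⟶ D k) (a : ∀ i, Arr (C i)) :
    BasedFunctor.arr (mapAlong σ hσ h) (tup a) = tup fun k => BasedFunctor.arr (h k) (a (σ k)) :=
  arr_desc_tup _ _ _

@[simp] theorem arr_map_tup {D : ι → BasedCat.{u}} (h : ∀ i, C i ⟶ D i) (a : ∀ i, Arr (C i)) :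
    BasedFunctor.arr (Smash.map h) (tup a) = tup fun i => BasedFunctor.arr (h i) (a i) :=
  arr_desc_tup _ _ _

@[simp] theorem arr_nest_tup {P I : Type} {J : I → Type} {C : P → BasedCat.{u}}
    {D : ∀ i, J i → BasedCat.{u}} (e : (Σ i, J i) ≃ P) (h : ∀ i j, C (e ⟨i, j⟩) ⟶ D i j)
    (a : ∀ p, Arr (C p)) :
    BasedFunctor.arr (Smash.nest e h) (tup a) =
      tup fun i => tup fun j => BasedFunctor.arr (h i j) (a (e ⟨i, j⟩)) :=
  arr_desc_tup _ _ _

end Smash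

/-! ### Categories presented by arrows and composites -/

section Presented

open Arr

/-- Objects, arrows, identities, and some of the composites of a category. -/
structure PreCat where
  O : Type u
  A : Type u
  src : A → O
  tgt : A → O
  one : O → A
  comp : A → A → A → Prop
  src_one : ∀ x, src (one x) = x
  tgt_one : ∀ x, tgt (one x) = x
  one_comp : ∀ a, comp (one (src a)) a a
  comp_one : ∀ a, comp a (one (tgt a)) a

namespace PreCat

variable (P : PreCat.{u})

/-- The objects of the presented category. -/
def Ob : Type u := P.O

/-- The generating morphisms of the presented category. -/
def Gen (x y : P.Ob) : Type u := { a : P.A // P.src a = x ∧ P.tgt a = y }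

instance : Quiver P.Ob := ⟨P.Gen⟩

variable {P} in
/-- A generating morphism, as a path of length one. -/
def path (a : P.A) {x y : P.Ob} (hx : P.src a = x) (hy : P.tgt a = y) :
    (Paths.of P.Ob).obj x ⟶ (Paths.of P.Ob).obj y :=
  (Paths.of P.Ob).map (⟨a, hx, hy⟩ : P.Gen x y)

/-- The relations between the generating morphisms. -/
inductive Rel : HomRel (Paths P.Ob)
  | one (x : P.Ob) : Rel (path (P.one x) (P.src_one x) (P.tgt_one x)) (𝟙 _)
  | comp {a b c : P.A} (h : P.comp a b c) {x y z : P.Ob} (ha : P.src a = x) (ha' : P.tgt a = y)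
      (hb : P.src b = y) (hb' : P.tgt b = z) (hc : P.src c = x) (hc' : P.tgt c = z) :
      Rel (path c hc hc') (path a ha ha' ≫ path b hb hb')

/-- The presented category. -/
abbrev Cat : Type u := CategoryTheory.Quotient P.Rel

instance : SmallCategory P.Cat := inferInstance

variable {P}

/-- The class of an object. -/
def obj (x : P.O) : P.Cat := ⟨x⟩

/-- The arrow of the presented category given by a generating morphism. -/
def gen (a : P.A) : Arr P.Cat :=
  of ((CategoryTheory.Quotient.functor P.Rel).map (path a (rfl : P.src a = P.src a) rfl))

theorem gen_eq (a : P.A) {x y : P.Ob} (hx : P.src a = x) (hy : P.tgt a = y) :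
    of ((CategoryTheory.Quotient.functor P.Rel).map (path a hx hy)) = gen a := by
  subst hx hy; rfl

theorem gen_one (x : P.O) : gen (P.one x) = of (𝟙 (obj x)) := by
  rw [← gen_eq (P.one x) (P.src_one x) (P.tgt_one x)]
  exact congrArg of ((CategoryTheory.Quotient.sound _ (Rel.one x)).trans
    (CategoryTheory.Functor.map_id _ _))

/-- The three equations between endpoints make the relation `Rel.comp` well typed; `P.comp` alone
does not imply them. -/
theorem isComp_gen {a b c : P.A} (h : P.comp a b c) (h₁ : P.tgt a = P.src b)
    (h₂ : P.src c = P.src a) (h₃ : P.tgt c = P.tgt b) : IsComp (gen a) (gen b) (gen c) := by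
  rw [← gen_eq c h₂ h₃, ← gen_eq b h₁.symm rfl]
  rw [CategoryTheory.Quotient.sound _ (Rel.comp h rfl rfl h₁.symm rfl h₂ h₃),
    CategoryTheory.Functor.map_comp]
  exact .mk _ _

/-- The presented category is a quotient of a path category, so each arrow is an identity or extends
a shorter path by one generator. Identities are themselves generators. -/
theorem induction {p : Arr P.Cat → Prop} (hgen : ∀ a, p (gen a))
    (hcomp : ∀ a b c, IsComp a b c → p a → p b → p c) (a : Arr P.Cat) : p a := by
  obtain ⟨⟨x⟩, ⟨y⟩, f⟩ := a
  obtain ⟨f, rfl⟩ := (CategoryTheory.Quotient.functor P.Rel).map_surjective f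
  refine Paths.induction (fun f => p (of ((CategoryTheory.Quotient.functor P.Rel).map f)))
    (fun {x} => ?_) (fun {x y z} f g ih => ?_) f
  · rw [CategoryTheory.Functor.map_id]
    exact gen_one x ▸ hgen (P.one x)
  · rw [CategoryTheory.Functor.map_comp]
    exact hcomp _ _ _ (IsComp.mk _ _) ih (gen_eq g.1 g.2.1 g.2.2 ▸ hgen g.1)

variable {D : Type u} [SmallCategory D]

section

variable (e : P.A → Arr D) (hcomp : ∀ a b c, P.comp a b c → IsComp (e a) (e b) (e c))

include hcomp in
-- The unit laws of `PreCat` are among the composites that `e` respects, so the image of an arrow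
-- starts where the image of the identity of its source does. Hence values on arrows alone yield a
-- functor.
theorem src_eq_of_comp (a : P.A) {x : P.O} (hx : P.src a = x) : (e a).src = (e (P.one x)).src := by
  subst hx
  exact (hcomp _ _ _ (P.one_comp a)).src_eq

include hcomp in
theorem tgt_eq_of_comp (a : P.A) {y : P.O} (hy : P.tgt a = y) : (e a).tgt = (e (P.one y)).src := by
  subst hy
  exact (hcomp _ _ _ (P.comp_one a)).mid_eq

/-- The functor on the category of paths given by the images of the generating arrows. -/
def descPaths : Paths P.Ob ⥤ D :=
  Paths.lift
    { obj := fun x => (e (P.one x)).src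
      map := fun a => (e a.1).homOf (src_eq_of_comp e hcomp a.1 a.2.1)
        (tgt_eq_of_comp e hcomp a.1 a.2.2) }

theorem of_descPaths_path (a : P.A) {x y : P.Ob} (hx : P.src a = x) (hy : P.tgt a = y) :
    of ((descPaths e hcomp).map (path a hx hy)) = e a :=
  (congrArg of (Paths.lift_toPath _ _)).trans
    (of_homOf (e a) (src_eq_of_comp e hcomp a hx) (tgt_eq_of_comp e hcomp a hy))

end

/-- The functor out of the presented category given by the images of the generating arrows. -/
def desc (e : P.A → Arr D) (hone : ∀ x, IsId (e (P.one x)))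
    (hcomp : ∀ a b c, P.comp a b c → IsComp (e a) (e b) (e c)) : P.Cat ⥤ D :=
  CategoryTheory.Quotient.lift _ (descPaths e hcomp) (by
    intro _ _ _ _ h
    cases h with
    | one x =>
      apply of_inj
      rw [of_descPaths_path, CategoryTheory.Functor.map_id]
      exact (hone x).eq_of
    | comp h ha ha' hb hb' hc hc' =>
      apply of_inj
      rw [of_descPaths_path, CategoryTheory.Functor.map_comp]
      refine (hcomp _ _ _ h).unique ?_
      have := IsComp.mk ((descPaths e hcomp).map (path _ ha ha'))
        ((descPaths e hcomp).map (path _ hb hb'))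
      rwa [of_descPaths_path, of_descPaths_path] at this)

@[simp] theorem map_desc_gen (e : P.A → Arr D) (hone : ∀ x, IsId (e (P.one x)))
    (hcomp : ∀ a b c, P.comp a b c → IsComp (e a) (e b) (e c)) (a : P.A) :
    Arr.map (desc e hone hcomp) (gen a) = e a :=
  of_descPaths_path e hcomp a rfl rfl

end PreCat

end Presented

open Arr

/-! ### The action of `Γᵒᵖ` on arrows -/

section Elements

/-- The arrows of the `n`-th category of a functor `Γᵒᵖ ⥤ Cat_*`. -/
abbrev El (X : GammaOp ⥤ BasedCat.{u}) (n : GammaOp) : Type u := Arr (X.obj n)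

/-- The action of the morphisms of `Γᵒᵖ` on arrows. -/
def act {X : GammaOp ⥤ BasedCat.{u}} {m n : GammaOp} (g : m ⟶ n) (x : El X m) : El X n :=
  BasedFunctor.arr (X.map g) x

variable {X : GammaOp ⥤ BasedCat.{u}}

@[simp] theorem act_id {n : GammaOp} (x : El X n) : act (𝟙 n) x = x := by
  unfold act
  rw [CategoryTheory.Functor.map_id]
  rfl

theorem act_comp {l m n : GammaOp} (f : l ⟶ m) (g : m ⟶ n) (x : El X l) :
    act (f ≫ g) x = act g (act f x) := by
  unfold act
  rw [CategoryTheory.Functor.map_comp]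
  rfl

@[simp] theorem act_base {m n : GammaOp} (g : m ⟶ n) :
    act g (X.obj m).baseArr = (X.obj n).baseArr :=
  BasedFunctor.arr_base _

theorem isId_act {m n : GammaOp} (g : m ⟶ n) {x : El X m} (h : IsId x) : IsId (act g x) :=
  BasedFunctor.isId_arr _ h

theorem isComp_act {m n : GammaOp} (g : m ⟶ n) {x y z : El X m} (h : IsComp x y z) :
    IsComp (act g x) (act g y) (act g z) :=
  BasedFunctor.isComp_arr _ h

end Elements

/-! ### Maps of based sets in several variables -/

section PMap

/-- A map of several variables between finite based sets, which is based in each variable. -/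
@[ext]
structure PMap {ι : Type} (m : ι → GammaOp) (k : GammaOp) where
  toFun : (∀ i, (m i).toSet) → k.toSet
  map_none : ∀ t i, t i = none → toFun t = none

/-- The case distinction behind the identities of maps of several variables: on a hyperplane both
sides are the base point, and elsewhere all entries are proper elements. -/
theorem none_or_some {ι : Type} {α : ι → Type} (t : ∀ i, Option (α i)) :
    (∃ i, t i = none) ∨ ∃ s : ∀ i, α i, t = fun i => some (s i) := by
  by_cases h : ∃ i, t i = none
  · exact .inl h
  · push Not at h
    choose s hs using fun i => Option.ne_none_iff_exists'.mp (h i)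
    exact .inr ⟨s, funext hs⟩

namespace PMap

variable {ι : Type} {m : ι → GammaOp} {k : GammaOp}

/-- Composition with a based map. -/
def post (θ : PMap m k) {l : GammaOp} (g : k ⟶ l) : PMap m l :=
  ⟨fun t => g.1 (θ.toFun t), fun _ i h => by rw [θ.map_none _ i h]; exact g.2⟩

/-- Composition with a based map in each variable. -/
def pre (θ : PMap m k) {n : ι → GammaOp} (f : ∀ i, n i ⟶ m i) : PMap n k :=
  ⟨fun t => θ.toFun fun i => (f i).1 (t i), fun t i h => θ.map_none _ i (by rw [h]; exact (f i).2)⟩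

/-- Substitution of maps of several variables. -/
def sub {J : ι → Type} {n : (Σ i, J i) → GammaOp} (θ : PMap m k)
    (φ : ∀ i, PMap (fun j => n ⟨i, j⟩) (m i)) : PMap n k :=
  ⟨fun t => θ.toFun fun i => (φ i).toFun fun j => t ⟨i, j⟩,
    fun _ q h => θ.map_none _ q.1 ((φ q.1).map_none _ q.2 h)⟩

/-- A map of the variables indexed by `ι'` as a map of the variables indexed by `ι`. -/
def unperm {ι' : Type} (σ : ι' ≃ ι) (θ : PMap (fun i => m (σ i)) k) : PMap m k :=
  ⟨fun t => θ.toFun fun i => t (σ i), fun t j h => θ.map_none _ (σ.symm j) (by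
    obtain ⟨i, rfl⟩ := σ.surjective j
    rwa [Equiv.symm_apply_apply])⟩

/-- The universal map of several variables given by an enumeration of the product. -/
noncomputable def ofEquiv (e : (∀ i, Fin (m i).card) ≃ Fin k.card) : PMap m k :=
  ⟨fun t => (GammaOp.combine t).map e, fun _ _ h => by rw [GammaOp.combine_none h]; rfl⟩

theorem ofEquiv_some (e : (∀ i, Fin (m i).card) ≃ Fin k.card) (s : ∀ i, Fin (m i).card) :
    (ofEquiv e).toFun (fun i => some (s i)) = some (e s) := by
  simp only [ofEquiv, GammaOp.combine_some]
  rfl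

/-- The factorization of a map of several variables over a universal one. -/
def lift {p : GammaOp} (e : (∀ i, Fin (m i).card) ≃ Fin p.card) (θ : PMap m k) : p ⟶ k :=
  ⟨fun s => s.bind fun s => θ.toFun fun i => some (e.symm s i), rfl⟩

theorem lift_ofEquiv {p : GammaOp} (e : (∀ i, Fin (m i).card) ≃ Fin p.card) (θ : PMap m k)
    (t : ∀ i, (m i).toSet) : (lift e θ).1 ((ofEquiv e).toFun t) = θ.toFun t := by
  obtain ⟨i, hi⟩ | ⟨s, rfl⟩ := none_or_some t
  · rw [(ofEquiv e).map_none t i hi, θ.map_none t i hi]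
    rfl
  · rw [ofEquiv_some]
    change θ.toFun _ = _
    rw [Equiv.symm_apply_apply]

/-- Together with `hom_ext_ofEquiv` this is the universal property of the smash product: it is the
product of the sets of proper elements, with a base point added. -/
theorem ofEquiv_post_lift {p : GammaOp} (e : (∀ i, Fin (m i).card) ≃ Fin p.card) (θ : PMap m k) :
    (ofEquiv e).post (lift e θ) = θ :=
  PMap.ext (funext fun t => lift_ofEquiv e θ t)

theorem hom_ext_ofEquiv {p : GammaOp} (e : (∀ i, Fin (m i).card) ≃ Fin p.card) {f g : p ⟶ k}
    (h : ∀ t, f.1 ((ofEquiv e).toFun t) = g.1 ((ofEquiv e).toFun t)) : f = g := by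
  apply GammaOp.hom_ext
  intro s
  have := h fun i => some (e.symm s i)
  rwa [ofEquiv_some, Equiv.apply_symm_apply] at this

/-- The factorization of a map of several variables over a family of universal ones. -/
noncomputable def lifts {J : ι → Type} {n : (Σ i, J i) → GammaOp}
    (e : ∀ i, (∀ j, Fin (n ⟨i, j⟩).card) ≃ Fin (m i).card) (θ : PMap n k) : PMap m k :=
  ⟨fun t => (GammaOp.combine t).bind fun s => θ.toFun fun q => some ((e q.1).symm (s q.1) q.2),
    fun _ _ h => by rw [GammaOp.combine_none h]; rfl⟩

theorem lifts_some {J : ι → Type} {n : (Σ i, J i) → GammaOp}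
    (e : ∀ i, (∀ j, Fin (n ⟨i, j⟩).card) ≃ Fin (m i).card) (θ : PMap n k)
    (s : ∀ i, Fin (m i).card) :
    (lifts e θ).toFun (fun i => some (s i)) =
      θ.toFun fun q => some ((e q.1).symm (s q.1) q.2) := by
  simp only [lifts, GammaOp.combine_some]
  rfl

theorem lifts_ofEquiv {J : ι → Type} {n : (Σ i, J i) → GammaOp}
    (e : ∀ i, (∀ j, Fin (n ⟨i, j⟩).card) ≃ Fin (m i).card) (θ : PMap n k)
    (t : ∀ q, (n q).toSet) :
    (lifts e θ).toFun (fun i => (ofEquiv (e i)).toFun fun j => t ⟨i, j⟩) = θ.toFun t := by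
  obtain ⟨q, hq⟩ | ⟨s, rfl⟩ := none_or_some t
  · rw [θ.map_none t q hq]
    exact (lifts e θ).map_none _ q.1 ((ofEquiv _).map_none _ q.2 hq)
  · simp only [ofEquiv_some, lifts_some, Equiv.symm_apply_apply]

/-- Uniqueness of the factorization: away from the hyperplanes every entry is a value of a universal
map, because each `e i` is surjective. -/
theorem eq_lifts {J : ι → Type} {n : (Σ i, J i) → GammaOp}
    (e : ∀ i, (∀ j, Fin (n ⟨i, j⟩).card) ≃ Fin (m i).card) (θ : PMap n k) (θ' : PMap m k)
    (h : ∀ t : ∀ q, (n q).toSet,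
      θ'.toFun (fun i => (ofEquiv (e i)).toFun fun j => t ⟨i, j⟩) = θ.toFun t) :
    θ' = lifts e θ := by
  refine PMap.ext (funext fun t => ?_)
  obtain ⟨q, hq⟩ | ⟨s, rfl⟩ := none_or_some t
  · rw [θ'.map_none t q hq, (lifts e θ).map_none t q hq]
  · rw [lifts_some, ← h]
    simp only [ofEquiv_some]
    congr 1
    funext i
    change _ = some (e i ((e i).symm (s i)))
    rw [Equiv.apply_symm_apply]

end PMap

end PMap

/-! ### Morphisms of several variables indexed by an arbitrary set -/

section GMor

/-- A natural family of functors `∏ᵢ X i (m i) ⥤ Y(k)` that collapse the coordinate hyperplanes, one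
for every map `⋀ᵢ m i → k` of based sets, in terms of its action on arrows. -/
structure GMor {ι : Type} (X : ι → GammaCat.{u}) (Y : GammaOp ⥤ BasedCat.{u}) where
  ev : ∀ {m : ι → GammaOp} {k : GammaOp}, PMap m k → (∀ i, El (X i).functor (m i)) → El Y k
  isId : ∀ {m : ι → GammaOp} {k : GammaOp} (θ : PMap m k) {a : ∀ i, El (X i).functor (m i)},
    (∀ i, IsId (a i)) → IsId (ev θ a)
  isComp : ∀ {m : ι → GammaOp} {k : GammaOp} (θ : PMap m k) {a b c : ∀ i, El (X i).functor (m i)},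
    (∀ i, IsComp (a i) (b i) (c i)) → IsComp (ev θ a) (ev θ b) (ev θ c)
  base : ∀ {m : ι → GammaOp} {k : GammaOp} (θ : PMap m k) {a : ∀ i, El (X i).functor (m i)} (i : ι),
    a i = ((X i).functor.obj (m i)).baseArr → ev θ a = (Y.obj k).baseArr
  post : ∀ {m : ι → GammaOp} {k l : GammaOp} (θ : PMap m k) (g : k ⟶ l)
    (a : ∀ i, El (X i).functor (m i)), ev (θ.post g) a = act g (ev θ a)
  pre : ∀ {m n : ι → GammaOp} {k : GammaOp} (θ : PMap m k) (f : ∀ i, n i ⟶ m i)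
    (a : ∀ i, El (X i).functor (n i)), ev (θ.pre f) a = ev θ fun i => act (f i) (a i)

namespace GMor

variable {ι : Type} {X : ι → GammaCat.{u}} {Y : GammaOp ⥤ BasedCat.{u}}

@[ext]
theorem ext {Φ Ψ : GMor X Y} (h : ∀ {m : ι → GammaOp} {k : GammaOp} (θ : PMap m k)
    (a : ∀ i, El (X i).functor (m i)), Φ.ev θ a = Ψ.ev θ a) : Φ = Ψ := by
  have : @Φ.ev = @Ψ.ev := by
    funext m k θ a
    exact h θ a
  cases Φ
  cases Ψ
  cases this
  rfl

/-- Levels, arrows and maps are allowed to agree only up to propositional equality, so that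
dependent tuples can be compared without casts. -/
theorem ev_congr (Φ : GMor X Y) {m m' : ι → GammaOp} {k : GammaOp} {θ : PMap m k} {θ' : PMap m' k}
    {a : ∀ i, El (X i).functor (m i)} {a' : ∀ i, El (X i).functor (m' i)}
    (hm : ∀ i, m i = m' i) (ha : ∀ i, HEq (a i) (a' i))
    (hθ : ∀ t t', (∀ i, HEq (t i) (t' i)) → θ.toFun t = θ'.toFun t') : Φ.ev θ a = Φ.ev θ' a' := by
  obtain rfl : m = m' := funext hm
  obtain rfl : a = a' := funext fun i => eq_of_heq (ha i)
  obtain rfl : θ = θ' := PMap.ext (funext fun t => hθ t t fun _ => HEq.rfl)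
  rfl

/-! #### Permutations -/

section perm

variable {ι' : Type} (σ : ι' ≃ ι) (Φ : GMor X Y)

theorem cast_eq_none {m n : GammaOp} (h : m = n) {x : m.toSet} (hx : x = none) :
    cast (congrArg GammaOp.toSet h) x = none := by
  subst h; exact hx

/-- The action of a permuted morphism on arrows. -/
def permEv {m : ι' → GammaOp} {k : GammaOp} (θ : PMap m k)
    (a : ∀ i, El (X (σ i)).functor (m i)) : El Y k :=
  Φ.ev (m := fun j => m (σ.symm j))
    ⟨fun t => θ.toFun fun i =>
        cast (congrArg GammaOp.toSet (congrArg m (σ.symm_apply_apply i))) (t (σ i)),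
      fun t j hj => by
        obtain ⟨i, rfl⟩ := σ.surjective j
        exact θ.map_none _ i (cast_eq_none (congrArg m (σ.symm_apply_apply i)) hj)⟩
    fun j => cast (congrArg (fun j' => El (X j').functor (m (σ.symm j))) (σ.apply_symm_apply j))
      (a (σ.symm j))

/-- The casts in `permEv` vanish on data pulled back along `σ`. By `exists_levels` and
`exists_tuple` all data are of this form. -/
theorem permEv_eq {m : ι → GammaOp} {k : GammaOp} (θ : PMap (fun i => m (σ i)) k)
    (a : ∀ i, El (X i).functor (m i)) :
    permEv σ Φ θ (fun i => a (σ i)) = Φ.ev (θ.unperm σ) a := by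
  refine Φ.ev_congr (fun j => congrArg m (σ.apply_symm_apply j)) (fun j => ?_) fun t t' h => ?_
  · exact (cast_heq _ _).trans (congr_arg_heq a (σ.apply_symm_apply j))
  · change θ.toFun _ = θ.toFun _
    congr 1
    funext i
    exact eq_of_heq ((cast_heq _ _).trans (h (σ i)))

theorem exists_levels (m : ι' → GammaOp) : ∃ n : ι → GammaOp, m = fun i => n (σ i) :=
  ⟨fun j => m (σ.symm j), by simp⟩

theorem exists_tuple {α : ι → Sort*} (a : ∀ i, α (σ i)) : ∃ b : ∀ j, α j, a = fun i => b (σ i) :=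
  ⟨Equiv.piCongrLeft α σ a, funext fun i => (Equiv.piCongrLeft_apply_apply α σ a i).symm⟩

/-- The action of a bijection between the sets of variables. -/
def permU : GMor (fun i => X (σ i)) Y where
  ev := permEv σ Φ
  isId {m k} θ a h := by
    obtain ⟨m, rfl⟩ := exists_levels σ m
    obtain ⟨a, rfl⟩ := exists_tuple σ (α := fun j => El (X j).functor (m j)) a
    rw [permEv_eq]
    exact Φ.isId _ (σ.surjective.forall.mpr h)
  isComp {m k} θ a b c h := by
    obtain ⟨m, rfl⟩ := exists_levels σ m
    obtain ⟨a, rfl⟩ := exists_tuple σ (α := fun j => El (X j).functor (m j)) a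
    obtain ⟨b, rfl⟩ := exists_tuple σ (α := fun j => El (X j).functor (m j)) b
    obtain ⟨c, rfl⟩ := exists_tuple σ (α := fun j => El (X j).functor (m j)) c
    simp only [permEv_eq]
    exact Φ.isComp _ (σ.surjective.forall.mpr h)
  base {m k} θ a i h := by
    obtain ⟨m, rfl⟩ := exists_levels σ m
    obtain ⟨a, rfl⟩ := exists_tuple σ (α := fun j => El (X j).functor (m j)) a
    rw [permEv_eq]
    exact Φ.base _ (σ i) h
  post {m k l} θ g a := by
    obtain ⟨m, rfl⟩ := exists_levels σ m
    obtain ⟨a, rfl⟩ := exists_tuple σ (α := fun j => El (X j).functor (m j)) a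
    simp only [permEv_eq]
    exact Φ.post (θ.unperm σ) g a
  pre {m n k} θ f a := by
    obtain ⟨m, rfl⟩ := exists_levels σ m
    obtain ⟨n, rfl⟩ := exists_levels σ n
    obtain ⟨a, rfl⟩ := exists_tuple σ (α := fun j => El (X j).functor (n j)) a
    obtain ⟨f, rfl⟩ := exists_tuple σ (α := fun j => n j ⟶ m j) f
    rw [permEv_eq]
    exact (Φ.pre (θ.unperm σ) f a).trans (permEv_eq σ Φ θ fun i => act (f i) (a i)).symm

theorem ev_permU {m : ι → GammaOp} {k : GammaOp} (θ : PMap (fun i => m (σ i)) k)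
    (a : ∀ i, El (X i).functor (m i)) :
    (permU σ Φ).ev θ (fun i => a (σ i)) = Φ.ev (θ.unperm σ) a := permEv_eq σ Φ θ a

/-- The value of a permuted morphism, when the permuted data are given up to equality. -/
theorem ev_permU_of_heq {m' : ι' → GammaOp} {m : ι → GammaOp} {k : GammaOp} {θ' : PMap m' k}
    {θ : PMap m k} {a' : ∀ i, El (X (σ i)).functor (m' i)} {a : ∀ i, El (X i).functor (m i)}
    (hm : ∀ i, m' i = m (σ i)) (ha : ∀ i, HEq (a' i) (a (σ i)))
    (hθ : ∀ t' t, (∀ i, HEq (t' i) (t (σ i))) → θ'.toFun t' = θ.toFun t) :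
    (permU σ Φ).ev θ' a' = Φ.ev θ a := by
  obtain rfl : m' = fun i => m (σ i) := funext hm
  obtain rfl : a' = fun i => a (σ i) := funext fun i => eq_of_heq (ha i)
  rw [ev_permU]
  congr 1
  exact PMap.ext (funext fun t => hθ _ t fun _ => HEq.rfl)

variable {σ} in
-- Equality can be tested on pulled-back data, where `ev_permU` computes.
theorem ext_perm {Φ Ψ : GMor (fun i => X (σ i)) Y}
    (h : ∀ {m : ι → GammaOp} {k : GammaOp} (θ : PMap (fun i => m (σ i)) k)
      (a : ∀ i, El (X i).functor (m i)),
      Φ.ev θ (fun i => a (σ i)) = Ψ.ev θ fun i => a (σ i)) : Φ = Ψ := by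
  ext m k θ a
  obtain ⟨m, rfl⟩ := exists_levels σ m
  obtain ⟨a, rfl⟩ := exists_tuple σ (α := fun j => El (X j).functor (m j)) a
  exact h θ a

end perm

theorem permU_refl (Φ : GMor X Y) : permU (Equiv.refl ι) Φ = Φ := by
  ext m k θ a
  exact ev_permU (Equiv.refl ι) Φ θ a

theorem permU_permU {ι' ι'' : Type} (σ : ι'' ≃ ι') (τ : ι' ≃ ι) (Φ : GMor X Y) :
    permU σ (permU τ Φ) = permU (σ.trans τ) Φ := by
  refine ext_perm (σ := σ.trans τ) (X := X) fun {m} k θ a => ?_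
  refine (ev_permU σ (permU τ Φ) (m := fun i => m (τ i)) θ fun i => a (τ i)).trans ?_
  exact (ev_permU τ Φ _ a).trans (ev_permU (σ.trans τ) Φ θ a).symm

/-! #### Composition -/

section comp

variable {J : ι → Type} {W : ∀ i, J i → GammaCat.{u}}

/-- The value of a composite does not depend on the factorization. Each `φ i` factors over the
universal map of `e i`; `GMor.post` moves the factor out of `Φ i`, and `GMor.pre` moves it into the
map of `Ψ`, which is then forced to be `PMap.lifts e θ`. -/
theorem ev_lifts (Ψ : GMor X Y) (Φ : ∀ i, GMor (W i) (X i).functor) {m : (Σ i, J i) → GammaOp}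
    {p n : ι → GammaOp} {k : GammaOp}
    (e : ∀ i, (∀ j, Fin (m ⟨i, j⟩).card) ≃ Fin (p i).card) (θ : PMap m k)
    (a : ∀ q : Σ i, J i, El (W q.1 q.2).functor (m q))
    (ψ : PMap n k) (φ : ∀ i, PMap (fun j => m ⟨i, j⟩) (n i))
    (h : ∀ t : ∀ q, (m q).toSet, ψ.toFun (fun i => (φ i).toFun fun j => t ⟨i, j⟩) = θ.toFun t) :
    Ψ.ev (PMap.lifts e θ) (fun i => (Φ i).ev (PMap.ofEquiv (e i)) fun j => a ⟨i, j⟩) =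
      Ψ.ev ψ fun i => (Φ i).ev (φ i) fun j => a ⟨i, j⟩ := by
  have h₁ : ∀ i, (Φ i).ev (φ i) (fun j => a ⟨i, j⟩) =
      act (PMap.lift (e i) (φ i)) ((Φ i).ev (PMap.ofEquiv (e i)) fun j => a ⟨i, j⟩) := fun i => by
    rw [← GMor.post, PMap.ofEquiv_post_lift]
  simp only [h₁]
  rw [← Ψ.pre]
  congr 1
  refine (PMap.eq_lifts e θ _ fun t => ?_).symm
  rw [← h]
  change ψ.toFun _ = _
  simp only [PMap.lift_ofEquiv]

/-- The canonical enumeration of a product of finite sets. -/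
noncomputable def prodEnum {κ : Type} [Finite κ] (m : κ → GammaOp) :
    (∀ j, Fin (m j).card) ≃ Fin (GammaOp.mk (Nat.card (∀ j, Fin (m j).card))).card :=
  Finite.equivFin _

/-- The composition of morphisms of several variables. -/
noncomputable def compU [∀ i, Finite (J i)] (Ψ : GMor X Y) (Φ : ∀ i, GMor (W i) (X i).functor) :
    GMor (fun q : Σ i, J i => W q.1 q.2) Y where
  -- Any enumeration of the inner products would do; by `ev_lifts` the choice does not affect the
  -- value.
  ev {m k} θ a := Ψ.ev (PMap.lifts (fun i => prodEnum fun j => m ⟨i, j⟩) θ)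
    fun i => (Φ i).ev (PMap.ofEquiv (prodEnum fun j => m ⟨i, j⟩)) fun j => a ⟨i, j⟩
  isId θ a h := Ψ.isId _ fun i => (Φ i).isId _ fun j => h ⟨i, j⟩
  isComp θ a b c h := Ψ.isComp _ fun i => (Φ i).isComp _ fun j => h ⟨i, j⟩
  base θ a q h := Ψ.base _ q.1 ((Φ q.1).base _ q.2 h)
  post {m k l} θ g a := by
    rw [← Ψ.post]
    congr 1
    refine (PMap.eq_lifts _ _ _ fun t => ?_).symm
    change g.1 _ = g.1 _
    rw [PMap.lifts_ofEquiv]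
  pre {m n k} θ f a := by
    -- The left side uses enumerations at the levels `n`. It is evaluated instead through those at
    -- the levels `m`, precomposed with `f`.
    refine (ev_lifts Ψ Φ _ _ a (PMap.lifts (fun i => prodEnum fun j => m ⟨i, j⟩) θ)
      (fun i => (PMap.ofEquiv (prodEnum fun j => m ⟨i, j⟩)).pre fun j => f ⟨i, j⟩)
      fun t => ?_).trans ?_
    · exact PMap.lifts_ofEquiv _ θ fun q => (f q).1 (t q)
    · simp only [GMor.pre]

/-- The value of a composite, for any factorization of the map of based sets. -/
theorem ev_compU [∀ i, Finite (J i)] (Ψ : GMor X Y) (Φ : ∀ i, GMor (W i) (X i).functor)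
    {m : (Σ i, J i) → GammaOp} {n : ι → GammaOp} {k : GammaOp} (θ : PMap m k)
    (a : ∀ q : Σ i, J i, El (W q.1 q.2).functor (m q))
    (ψ : PMap n k) (φ : ∀ i, PMap (fun j => m ⟨i, j⟩) (n i))
    (h : ∀ t : ∀ q, (m q).toSet, ψ.toFun (fun i => (φ i).toFun fun j => t ⟨i, j⟩) = θ.toFun t) :
    (compU Ψ Φ).ev θ a = Ψ.ev ψ fun i => (Φ i).ev (φ i) fun j => a ⟨i, j⟩ :=
  ev_lifts Ψ Φ _ θ a ψ φ h

end comp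

/-! #### Identities -/

/-- The element of a product of one factor. -/
def single {α : Fin 1 → Type*} (x : α 0) : ∀ i, α i
  | 0 => x

/-- A map of one variable. -/
def _root_.Mandell.PMap.toHom {m : Fin 1 → GammaOp} {k : GammaOp} (θ : PMap m k) : m 0 ⟶ k :=
  ⟨fun x => θ.toFun (single x), θ.map_none _ 0 rfl⟩

/-- The morphism of one variable given by a natural transformation. -/
def ofNat {X : GammaCat.{u}} (f : X.functor ⟶ Y) : GMor (fun _ : Fin 1 => X) Y where
  ev {m k} θ a := act θ.toHom (BasedFunctor.arr (f.app (m 0)) (a 0))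
  isId θ a h := isId_act _ (BasedFunctor.isId_arr _ (h 0))
  isComp θ a b c h := isComp_act _ (BasedFunctor.isComp_arr _ (h 0))
  base θ a i h := by
    obtain rfl : i = 0 := Subsingleton.elim _ _
    rw [h, BasedFunctor.arr_base, act_base]
  post θ g a := act_comp θ.toHom g _
  pre {m n k} θ g a := by
    have h : (θ.pre g).toHom = g 0 ≫ θ.toHom := Subtype.ext (funext fun x => by
      change θ.toFun _ = θ.toFun _
      congr 1
      funext i
      obtain rfl : i = 0 := Subsingleton.elim _ _
      rfl)
    rw [h, act_comp]
    congr 1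
    change BasedFunctor.arr (f.app _ ≫ Y.map (g 0)) _ = BasedFunctor.arr (X.functor.map _ ≫ _) _
    rw [f.naturality]

/-- The identity. -/
def idU (X : GammaCat.{u}) : GMor (fun _ : Fin 1 => X) X.functor := ofNat (𝟙 X.functor)

theorem ev_idU {X : GammaCat.{u}} {m : Fin 1 → GammaOp} {k : GammaOp} (θ : PMap m k)
    (a : ∀ i, El X.functor (m i)) : (idU X).ev θ a = act θ.toHom (a 0) := rfl

/-- The map of one variable given by a based map. -/
def _root_.Mandell.PMap.ofHom {k l : GammaOp} (g : k ⟶ l) : PMap (fun _ : Fin 1 => k) l :=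
  ⟨fun t => g.1 (t 0), fun t i h => by
    obtain rfl : i = 0 := Subsingleton.elim _ _
    rw [h]
    exact g.2⟩

@[simp] theorem _root_.Mandell.PMap.toHom_ofHom {k l : GammaOp} (g : k ⟶ l) :
    (PMap.ofHom g).toHom = g := rfl

/-- The composite is evaluated through the factorization whose outer map is the identity of `k`; for
`compU_idU` the inner maps are the identities. -/
theorem idU_compU {X : ι → GammaCat.{u}} [Finite ι] {y : GammaCat.{u}} (f : GMor X y.functor) :
    compU (idU y) (fun _ => f) =
      permU ((Equiv.sigmaEquivProd (Fin 1) ι).trans (Equiv.uniqueProd ι (Fin 1))) f := by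
  refine ext_perm (σ := (Equiv.sigmaEquivProd (Fin 1) ι).trans (Equiv.uniqueProd ι (Fin 1)))
    (X := X) fun {m k} θ a => ?_
  rw [ev_permU]
  refine (ev_compU (idU y) (fun _ => f) θ _ (n := fun _ => k) (PMap.ofHom (𝟙 k))
    (fun i => θ.unperm _) fun t => ?_).trans ?_
  · change θ.toFun _ = θ.toFun _
    congr 1
    funext ⟨i, j⟩
    obtain rfl : i = 0 := Subsingleton.elim _ _
    rfl
  · rw [ev_idU, PMap.toHom_ofHom, act_id]
    rfl

theorem compU_idU (f : GMor X Y) :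
    compU f (fun i => idU (X i)) =
      permU ((Equiv.sigmaEquivProd ι (Fin 1)).trans (Equiv.prodUnique ι (Fin 1))) f := by
  refine ext_perm (σ := (Equiv.sigmaEquivProd ι (Fin 1)).trans (Equiv.prodUnique ι (Fin 1)))
    (X := X) fun {m k} θ a => ?_
  rw [ev_permU]
  refine (ev_compU f (fun i => idU (X i)) θ _ (n := m) (θ.unperm _)
    (fun i => PMap.ofHom (𝟙 (m i))) fun t => ?_).trans ?_
  · change θ.toFun _ = θ.toFun _
    congr 1
    funext ⟨i, j⟩
    obtain rfl : j = 0 := Subsingleton.elim _ _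
    rfl
  · congr 1
    funext i
    exact act_id (a i)

/-- Both sides are values of `f` at values of `g` at values of `h`. One side is unfolded with its
own enumerations, and `ev_compU` allows the other side to be evaluated through the same ones. -/
theorem compU_assoc {J : ι → Type} {K : ∀ i, J i → Type} [∀ i, Finite (J i)]
    [∀ i j, Finite (K i j)] {W : ∀ i, J i → GammaCat.{u}} {V : ∀ i j, K i j → GammaCat.{u}}
    (f : GMor X Y) (g : ∀ i, GMor (W i) (X i).functor) (h : ∀ i j, GMor (V i j) (W i j).functor) :
    compU (compU f g) (fun q : Σ i, J i => h q.1 q.2) =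
      permU (Equiv.sigmaAssoc K) (compU f fun i => compU (g i) (h i)) := by
  refine ext_perm (σ := Equiv.sigmaAssoc K) (X := fun q => V q.1 q.2.1 q.2.2)
    fun {m k} θ a => ?_
  rw [ev_permU]
  symm
  refine (ev_compU f (fun i => compU (g i) (h i)) _ a
    (PMap.lifts (fun i => prodEnum fun j => _)
      (PMap.lifts (fun q : Σ i, J i => prodEnum fun k => m ⟨q.1, q.2, k⟩) θ))
    (fun i => PMap.sub (PMap.ofEquiv (prodEnum _)) fun j => PMap.ofEquiv (prodEnum _))
    fun t => ?_).trans ?_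
  · refine (PMap.lifts_ofEquiv _ _ (fun q : Σ i, J i =>
      (PMap.ofEquiv (prodEnum fun k => m ⟨q.1, q.2, k⟩)).toFun fun k => t ⟨q.1, q.2, k⟩)).trans ?_
    exact PMap.lifts_ofEquiv _ θ fun q => t ⟨q.1.1, q.1.2, q.2⟩
  · change _ = f.ev _ _
    congr 1
    funext i
    exact ev_compU (g i) (h i) _ _ _ _ fun t => rfl

theorem compU_permU_left {ι' : Type} (σ : ι' ≃ ι) {J : ι → Type} [∀ i, Finite (J i)]
    {W : ∀ i, J i → GammaCat.{u}} (f : GMor X Y) (g : ∀ i, GMor (W i) (X i).functor) :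
    compU (permU σ f) (fun i => g (σ i)) =
      permU (Equiv.sigmaCongrLeft (β := J) σ) (compU f g) := by
  refine ext_perm (σ := Equiv.sigmaCongrLeft (β := J) σ) (X := fun q => W q.1 q.2)
    fun {m k} θ a => ?_
  rw [ev_permU]
  refine (ev_permU σ f (PMap.lifts (fun i' => prodEnum fun j => m ⟨σ i', j⟩) θ) fun i =>
    (g i).ev (PMap.ofEquiv (prodEnum fun j => m ⟨i, j⟩)) fun j => a ⟨i, j⟩).trans ?_
  exact (ev_compU f g _ _ _ _ fun t => PMap.lifts_ofEquiv _ θ fun q => t ⟨σ q.1, q.2⟩).symm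

theorem compU_permU_right {J J' : ι → Type} [∀ i, Finite (J i)] [∀ i, Finite (J' i)]
    (τ : ∀ i, J i ≃ J' i) {W : ∀ i, J' i → GammaCat.{u}} (f : GMor X Y)
    (g : ∀ i, GMor (W i) (X i).functor) :
    compU f (fun i => permU (τ i) (g i)) =
      permU (Equiv.sigmaCongrRight τ) (compU f g) := by
  refine ext_perm (σ := Equiv.sigmaCongrRight τ) (X := fun q => W q.1 q.2)
    fun {m k} θ a => ?_
  rw [ev_permU]
  refine Eq.trans ?_ (ev_compU f g _ _
    (PMap.lifts (fun i => prodEnum fun j => m ⟨i, τ i j⟩) θ)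
    (fun i => PMap.unperm (m := fun j => m ⟨i, j⟩) (τ i) (PMap.ofEquiv (prodEnum _)))
    fun t => PMap.lifts_ofEquiv _ θ fun q => t ⟨q.1, τ q.1 q.2⟩).symm
  change f.ev _ _ = f.ev _ _
  congr 1
  funext i
  exact ev_permU (τ i) (g i) (m := fun j => m ⟨i, j⟩) _ fun j => a ⟨i, j⟩

end GMor

end GMor

/-! ### The multicategory of `Γ`-categories -/

section GammaMulticategory

/-- The identities, composition and permutation actions of morphisms of several variables. -/
noncomputable def gOps : MultiOps (O := GammaCat.{u}) (fun _ x y => GMor x y.functor) where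
  id := GMor.idU
  comp f g := GMor.permU finSigmaFinEquiv.symm (GMor.compU f g)
  perm σ _ _ f := GMor.permU σ f

/-- Composites live on double indices, so `κ` is an arbitrary type here. This reduces the axioms
involving `reindex` to equalities of bijections such as `hπ`. -/
theorem gOps_reindex_permU {m n : ℕ} {κ : Type} (σ : Fin m ≃ Fin n) (τ : Fin n ≃ κ) (π : Fin m ≃ κ)
    (hπ : π = σ.trans τ) {X : κ → GammaCat.{u}} {y : GammaCat.{u}}
    (h : ∀ i, X (π i) = X (τ (σ i))) (F : GMor X y.functor) :
    gOps.reindex (x' := fun i => X (π i)) (x := fun i => X (τ i)) σ h (GMor.permU τ F) =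
      GMor.permU π F := by
  subst hπ
  exact GMor.permU_permU σ τ F

/-- The multicategory of `Γ`-categories, in terms of the action of its morphisms on arrows. -/
noncomputable def gMulticategory : Multicategory (O := GammaCat.{u})
    (fun _ x y => GMor x y.functor) where
  toMultiOps := gOps
  perm_refl f := GMor.permU_refl f
  perm_perm σ τ _ _ f := GMor.permU_permU σ τ f
  id_comp f := (congrArg (GMor.permU _) (GMor.idU_compU f)).trans (GMor.permU_permU _ _ f)
  comp_id f := (congrArg (GMor.permU _) (GMor.compU_idU f)).trans (GMor.permU_permU _ _ f)
  assoc {s t u v w x y} f g h := by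
    -- On both sides the flattenings of double indices are moved outwards, past the composites.
    -- After `compU_assoc` only two bijections of index sets remain to be compared.
    refine (congrArg (GMor.permU _) ((GMor.compU_permU_left finSigmaFinEquiv.symm
      (GMor.compU f g) fun q : Σ i, Fin (t i) => h q.1 q.2).trans
        (congrArg (GMor.permU _) (GMor.compU_assoc f g h)))).trans ?_
    refine Eq.trans ?_ (congrArg (fun F => gOps.reindex _ _ (GMor.permU finSigmaFinEquiv.symm F))
      (GMor.compU_permU_right (fun _ => finSigmaFinEquiv.symm) f
        fun i => GMor.compU (g i) (h i))).symm
    refine (congrArg (GMor.permU _) (GMor.permU_permU _ _ _)).trans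
      ((GMor.permU_permU _ _ _).trans ?_)
    refine Eq.trans ?_ (congrArg (gOps.reindex _ _) (GMor.permU_permU _ _ _)).symm
    refine (gOps_reindex_permU _ _ _ ?_ _ _).symm
    refine Equiv.ext fun p => ?_
    simp [blockEquiv]
  comp_perm_left {m n} σ {t w x y} f g := by
    refine (congrArg (GMor.permU _) (GMor.compU_permU_left σ f g)).trans
      ((GMor.permU_permU _ _ _).trans ?_)
    refine (gOps_reindex_permU _ _ _ ?_ _ _).symm
    refine Equiv.ext fun p => ?_
    simp [blockEquiv]
  comp_perm_right {s t t'} τ {w x y} f g := by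
    refine (congrArg (GMor.permU _) (GMor.compU_permU_right τ f g)).trans
      ((GMor.permU_permU _ _ _).trans ?_)
    refine (gOps_reindex_permU _ _ _ ?_ _ _).symm
    refine Equiv.ext fun p => ?_
    simp [blockEquiv]

end GammaMulticategory

/-! ### Transport of multicategory structures -/

section Transport

variable {O : Type v} {O' : Type*} {Hom : ∀ ⦃r : ℕ⦄, (Fin r → O) → O → Type w}
  {Hom' : ∀ ⦃r : ℕ⦄, (Fin r → O') → O' → Type*} (lev : O' → O)
  (e : ∀ {r : ℕ} (x : Fin r → O') (y : O'), Hom' x y ≃ Hom (fun i => lev (x i)) (lev y))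

/-- The operations transported along bijections between the sets of morphisms. -/
def MultiOps.transport (M : MultiOps Hom) : MultiOps Hom' where
  id x := (e _ _).symm (M.id (lev x))
  comp f g := (e _ _).symm (M.comp (e _ _ f) fun i => e _ _ (g i))
  perm σ _ _ f := (e _ _).symm (M.perm σ (e _ _ f))

/-- The cast in `reindex` disappears once the permuted list is the literal one. -/
theorem MultiOps.transport_reindex (M : MultiOps Hom) {m n : ℕ} (σ : Fin m ≃ Fin n)
    {x' : Fin m → O'} {x : Fin n → O'} (h : ∀ i, x' i = x (σ i)) {y : O'} (f : Hom' x y) :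
    e _ _ ((M.transport lev e).reindex σ h f) =
      M.reindex σ (fun i => congrArg lev (h i)) (e _ _ f) := by
  obtain rfl : x' = fun i => x (σ i) := funext h
  exact (e _ _).apply_symm_apply _

/-- The multicategory structure transported along bijections between the sets of morphisms. -/
def Multicategory.transport (M : Multicategory Hom) : Multicategory Hom' where
  toMultiOps := M.toMultiOps.transport lev e
  perm_refl f := (e _ _).injective (by
    refine ((e _ _).apply_symm_apply _).trans (M.perm_refl _))
  perm_perm σ τ _ _ f := (e _ _).injective (by
    refine ((e _ _).apply_symm_apply _).trans (Eq.trans ?_ ((e _ _).apply_symm_apply _).symm)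
    refine (congrArg _ ((e _ _).apply_symm_apply _)).trans (M.perm_perm _ _ _))
  id_comp f := (e _ _).injective (by
    refine ((e _ _).apply_symm_apply _).trans (Eq.trans ?_ ((e _ _).apply_symm_apply _).symm)
    refine (congrArg (fun g => M.comp g fun _ => e _ _ f) ((e _ _).apply_symm_apply _)).trans
      (M.id_comp _))
  comp_id f := (e _ _).injective (by
    refine ((e _ _).apply_symm_apply _).trans (Eq.trans ?_ ((e _ _).apply_symm_apply _).symm)
    refine (congrArg (fun g => M.comp (e _ _ f) g)
      (funext fun i => (e _ _).apply_symm_apply _)).trans (M.comp_id _))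
  assoc f g h := (e _ _).injective (by
    refine ((e _ _).apply_symm_apply _).trans
      (Eq.trans ?_ (M.toMultiOps.transport_reindex lev e _ _ _).symm)
    refine (congrArg (fun f => M.comp f _) ((e _ _).apply_symm_apply _)).trans ?_
    refine (M.assoc (e _ _ f) (fun i => e _ _ (g i)) fun i j => e _ _ (h i j)).trans ?_
    refine congrArg (M.reindex _ _) (Eq.trans ?_ ((e _ _).apply_symm_apply _).symm)
    exact congrArg (M.comp _) (funext fun i => ((e _ _).apply_symm_apply _).symm))
  comp_perm_left σ _ _ _ _ f g := (e _ _).injective (by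
    refine ((e _ _).apply_symm_apply _).trans
      (Eq.trans ?_ (M.toMultiOps.transport_reindex lev e _ _ _).symm)
    refine (congrArg (fun f => M.comp f _) ((e _ _).apply_symm_apply _)).trans ?_
    refine (M.comp_perm_left σ (e _ _ f) (fun i => e _ _ (g i))).trans ?_
    exact congrArg (M.reindex _ _) ((e _ _).apply_symm_apply _).symm)
  comp_perm_right τ _ _ _ f g := (e _ _).injective (by
    refine ((e _ _).apply_symm_apply _).trans
      (Eq.trans ?_ (M.toMultiOps.transport_reindex lev e _ _ _).symm)
    refine (congrArg (M.comp _) (funext fun i => (e _ _).apply_symm_apply _)).trans ?_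
    refine (M.comp_perm_right τ (e _ _ f) (fun i => e _ _ (g i))).trans ?_
    exact congrArg (M.reindex _ _) ((e _ _).apply_symm_apply _).symm)

end Transport

/-! ### Natural transformations out of external smash products -/

section GammaHom

/-- The universal map of several variables `⋀ᵢ m i → {0, …, ∏ᵢ m i}`. -/
noncomputable def lexMap {r : ℕ} (m : Fin r → GammaOp) : PMap m ((GammaOp.smash r).obj m) :=
  PMap.ofEquiv (lexEquiv fun i => (m i).card)

/-- The factorization of a map of several variables over the universal one. -/
noncomputable def lexLift {r : ℕ} {m : Fin r → GammaOp} {k : GammaOp} (θ : PMap m k) :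
    (GammaOp.smash r).obj m ⟶ k :=
  PMap.lift (p := (GammaOp.smash r).obj m) (lexEquiv fun i => (m i).card) θ

theorem lexLift_lexMap {r : ℕ} {m : Fin r → GammaOp} {k : GammaOp} (θ : PMap m k)
    (t : ∀ i, (m i).toSet) : (lexLift θ).1 ((lexMap m).toFun t) = θ.toFun t :=
  PMap.lift_ofEquiv _ _ _

theorem lexMap_hom_ext {r : ℕ} {m : Fin r → GammaOp} {k : GammaOp}
    {f g : (GammaOp.smash r).obj m ⟶ k}
    (h : ∀ t, f.1 ((lexMap m).toFun t) = g.1 ((lexMap m).toFun t)) : f = g :=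
  PMap.hom_ext_ofEquiv _ h

theorem lexMap_some {r : ℕ} (m : Fin r → GammaOp) (s : ∀ i, Fin (m i).card) :
    (lexMap m).toFun (fun i => some (s i)) = some (lexEquiv (fun i => (m i).card) s) :=
  PMap.ofEquiv_some _ _

/-- Naturality of the universal map. With `lexMap_hom_ext` it takes the place of the explicit
formula in `GammaOp.smash`. -/
theorem smash_map_lexMap {r : ℕ} {m n : Fin r → GammaOp} (f : m ⟶ n) (t : ∀ i, (m i).toSet) :
    ((GammaOp.smash r).map f).1 ((lexMap m).toFun t) =
      (lexMap n).toFun fun i => (f i).1 (t i) := by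
  obtain ⟨i, hi⟩ | ⟨s, rfl⟩ := none_or_some t
  · rw [(lexMap m).map_none t i hi, (lexMap n).map_none _ i (by rw [hi]; exact (f i).2)]
    rfl
  · rw [lexMap_some]
    change Option.map _ (GammaOp.combine _) = Option.map _ (GammaOp.combine _)
    rw [Equiv.symm_apply_apply]
    rfl

namespace GMor

variable {r : ℕ} {X : Fin r → GammaCat.{u}} {Y : GammaOp ⥤ BasedCat.{u}}

/-- The components of the natural transformation given by a morphism of several variables. -/
noncomputable def homApp (Φ : GMor X Y) (m : Fin r → GammaOp) :
    (Smash fun i => (X i).functor.obj (m i)) ⟶ Y.obj ((GammaOp.smash r).obj m) :=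
  Smash.ofArr (fun a => Φ.ev (lexMap m) a) (fun _ h => Φ.isId _ h)
    (fun _ _ _ h => Φ.isComp _ h) (fun _ i h => Φ.base _ i h)

theorem arr_homApp_tup (Φ : GMor X Y) (m : Fin r → GammaOp) (a : ∀ i, El (X i).functor (m i)) :
    BasedFunctor.arr (Φ.homApp m) (Smash.tup a) = Φ.ev (lexMap m) a :=
  Smash.arr_ofArr_tup (fun a => Φ.ev (lexMap m) a) (fun _ h => Φ.isId _ h)
    (fun _ _ _ h => Φ.isComp _ h) (fun _ i h => Φ.base _ i h) a

/-- The natural transformation given by a morphism of several variables. -/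
noncomputable def toHom (Φ : GMor X Y) : externalSmash X ⟶ GammaOp.smash r ⋙ Y where
  app := Φ.homApp
  naturality m n f := by
    refine Smash.arr_ext fun a => ?_
    refine (congrArg (BasedFunctor.arr (Φ.homApp n)) (Smash.arr_map_tup _ _)).trans
      ((arr_homApp_tup Φ n _).trans ?_)
    refine Eq.trans ?_ (congrArg (act ((GammaOp.smash r).map f)) (arr_homApp_tup Φ m a)).symm
    refine (Φ.pre (lexMap n) f a).symm.trans (Eq.trans ?_ (Φ.post (lexMap m) _ a))
    congr 1
    exact PMap.ext (funext fun t => (smash_map_lexMap f t).symm)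

theorem arr_toHom_tup (Φ : GMor X Y) (m : Fin r → GammaOp) (a : ∀ i, El (X i).functor (m i)) :
    BasedFunctor.arr (Φ.toHom.app m) (Smash.tup a) = Φ.ev (lexMap m) a :=
  arr_homApp_tup Φ m a

/-- The morphism of several variables given by a natural transformation. -/
noncomputable def ofHom (f : externalSmash X ⟶ GammaOp.smash r ⋙ Y) : GMor X Y where
  -- As in the Yoneda lemma, the value at the universal map is pushed forward along the
  -- factorization of `θ`.
  ev {m _} θ a := act (lexLift θ) (BasedFunctor.arr (f.app m) (Smash.tup a))
  isId θ _ h := isId_act _ (BasedFunctor.isId_arr _ (Smash.isId_tup h))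
  isComp θ _ _ _ h := isComp_act _ (BasedFunctor.isComp_arr _ (Smash.isComp_tup h))
  base {m _} θ _ i h := by
    have h₁ := congrArg (BasedFunctor.arr (f.app m)) (Smash.tup_eq_base h)
    exact (congrArg (act (lexLift θ)) (h₁.trans (BasedFunctor.arr_base _))).trans (act_base _)
  post θ g a := by
    rw [← act_comp]
    congr 1
    refine lexMap_hom_ext fun t => ?_
    rw [lexLift_lexMap]
    exact (congrArg g.1 (lexLift_lexMap θ t)).symm
  pre {m n k} θ g a := by
    have h : lexLift (θ.pre g) = (GammaOp.smash r).map g ≫ lexLift θ := by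
      refine lexMap_hom_ext fun t => ?_
      rw [lexLift_lexMap]
      change _ = (lexLift θ).1 (((GammaOp.smash r).map g).1 ((lexMap n).toFun t))
      rw [smash_map_lexMap, lexLift_lexMap]
      rfl
    rw [h, act_comp]
    congr 1
    have h₁ := congrArg (fun F => BasedFunctor.arr F (Smash.tup a)) (f.naturality g)
    exact h₁.symm.trans (congrArg (BasedFunctor.arr (f.app m)) (Smash.arr_map_tup _ _))

theorem ev_ofHom_lexMap (f : externalSmash X ⟶ GammaOp.smash r ⋙ Y) (m : Fin r → GammaOp)
    (a : ∀ i, El (X i).functor (m i)) :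
    (ofHom f).ev (lexMap m) a = BasedFunctor.arr (f.app m) (Smash.tup a) := by
  have h : lexLift (lexMap m) = 𝟙 _ := lexMap_hom_ext fun t => lexLift_lexMap _ _
  change act (lexLift (lexMap m)) _ = _
  rw [h]
  exact act_id _

/-- Morphisms of several variables are natural transformations. -/
noncomputable def equivHom (X : Fin r → GammaCat.{u}) (Y : GammaOp ⥤ BasedCat.{u}) :
    (externalSmash X ⟶ GammaOp.smash r ⋙ Y) ≃ GMor X Y where
  toFun := ofHom
  invFun := toHom
  left_inv f := by
    ext m
    exact Smash.arr_ext fun a => (arr_toHom_tup _ _ _).trans (ev_ofHom_lexMap f m a)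
  right_inv Φ := by
    ext m k θ a
    -- By `post`, the value at the universal map determines the value at every `θ`.
    refine (congrArg (act (lexLift θ)) (arr_toHom_tup Φ m a)).trans ((Φ.post _ _ _).symm.trans ?_)
    congr 1
    exact PMap.ofEquiv_post_lift _ _

end GMor

/-- The multicategory of `Γ`-categories. -/
noncomputable def gammaMulticategory : Multicategory GammaHom.{u} :=
  gMulticategory.transport id fun x y => GMor.equivHom x y.functor

theorem arr_gammaFam_tup {r : ℕ} {X : Fin r → GammaCat.{u}} {Y : GammaCat.{u}}
    (Φ : GMor X Y.functor) (m : Fin r → ℕ)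
    (a : ∀ i, El (X i).functor ⟨m i⟩) :
    BasedFunctor.arr (gammaFam (Y := Y) Φ.toHom m) (Smash.tup a) =
      Φ.ev (lexMap fun i => ⟨m i⟩) a :=
  GMor.arr_toHom_tup _ _ _

/-- The bijection is the one written in `compFamily`: it decodes the nested lexicographic codes,
flattens the double tuple and encodes again. Away from the hyperplanes both sides thus encode the
same tuple. -/
theorem lexMap_concat {s : ℕ} {t : Fin s → ℕ} (m : Fin (∑ i, t i) → ℕ)
    (x : ∀ p, (GammaOp.mk (m p)).toSet) :
    (lexMap fun p => ⟨m p⟩).toFun x =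
      (GammaOp.ofEquiv ((lexEquiv _).symm.trans
        ((Equiv.piCongrRight fun _ => (lexEquiv _).symm).trans
        ((Equiv.piCurry fun i j => Fin (m (finSigmaFinEquiv ⟨i, j⟩))).symm.trans
        ((Equiv.piCongrLeft (fun p => Fin (m p)) finSigmaFinEquiv).trans (lexEquiv m)))))).1
      ((lexMap fun i => ⟨∏ j, m (finSigmaFinEquiv ⟨i, j⟩)⟩).toFun fun i =>
        (lexMap fun j => ⟨m (finSigmaFinEquiv ⟨i, j⟩)⟩).toFun fun j =>
          x (finSigmaFinEquiv ⟨i, j⟩)) := by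
  obtain ⟨p, hp⟩ | ⟨y, rfl⟩ := none_or_some x
  · obtain ⟨⟨i, j⟩, rfl⟩ := finSigmaFinEquiv.surjective p
    rw [(lexMap _).map_none x _ hp]
    refine Eq.symm (?_ : (GammaOp.ofEquiv _).1 _ = none)
    refine (congrArg (GammaOp.ofEquiv _).1
      ((lexMap fun i => ⟨∏ j, m (finSigmaFinEquiv ⟨i, j⟩)⟩).map_none _ i ?_))
    exact (lexMap fun j => ⟨m (finSigmaFinEquiv ⟨i, j⟩)⟩).map_none _ j hp
  · rw [lexMap_some]
    have h : ∀ i, (lexMap fun j => ⟨m (finSigmaFinEquiv ⟨i, j⟩)⟩).toFun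
        (fun j => some (y (finSigmaFinEquiv ⟨i, j⟩))) = some (lexEquiv _ fun j =>
          y (finSigmaFinEquiv ⟨i, j⟩)) := fun i => lexMap_some _ _
    rw [funext h]
    refine Eq.trans ?_ (congrArg _ (lexMap_some _ _).symm)
    refine congrArg some ?_
    simp only [Equiv.trans_apply, Equiv.symm_apply_apply]
    congr 1
    refine ((Equiv.piCongrLeft (fun p => Fin (m p)) finSigmaFinEquiv).symm_apply_eq).mp ?_
    funext ⟨i, j⟩
    exact (congrFun ((lexEquiv _).symm_apply_apply fun j => y (finSigmaFinEquiv ⟨i, j⟩)) j).symm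

theorem lexMap_perm {k n : ℕ} (σ : Fin k ≃ Fin n) (m : Fin k → ℕ)
    (x : ∀ p, (GammaOp.mk (m p)).toSet) :
    (lexMap fun p => ⟨m p⟩).toFun x =
      (GammaOp.ofEquiv ((lexEquiv _).symm.trans
        ((Equiv.piCongrLeft (fun i => Fin (m i)) σ.symm).trans (lexEquiv m)))).1
      ((lexMap fun j => ⟨m (σ.symm j)⟩).toFun fun j => x (σ.symm j)) := by
  obtain ⟨p, hp⟩ | ⟨y, rfl⟩ := none_or_some x
  · obtain ⟨j, rfl⟩ := σ.symm.surjective p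
    rw [(lexMap _).map_none x _ hp, (lexMap _).map_none _ j hp]
    rfl
  · rw [lexMap_some]
    refine Eq.trans ?_ (congrArg _ (lexMap_some _ _).symm)
    refine congrArg some ?_
    simp only [Equiv.trans_apply, Equiv.symm_apply_apply]
    congr 1
    refine ((Equiv.piCongrLeft (fun p => Fin (m p)) σ.symm).symm_apply_eq).mp ?_
    funext j
    simp

theorem arr_idFamily (F : Levels.{u}) (m : Fin 1 → ℕ) (a : ∀ i, Arr (F.obj (m i))) :
    BasedFunctor.arr (idFamily F m) (Smash.tup a) =
      BasedFunctor.arr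
        (F.act ((Equiv.piUnique fun i : Fin 1 => Fin (m i)).symm.trans (lexEquiv m))) (a 0) :=
  congrArg (BasedFunctor.arr (F.act _)) (Smash.arr_desc_tup _ _ _)

theorem arr_compFamily {s : ℕ} {t : Fin s → ℕ} {F : ∀ i, Fin (t i) → Levels.{u}}
    {G : Fin s → Levels.{u}} {H : Levels.{u}} (ψ : Family (fun i => (G i).obj) H.obj)
    (φ : ∀ i, Family (fun j => (F i j).obj) (G i).obj) (m : Fin (∑ i, t i) → ℕ)
    (a : ∀ p, Arr ((concat F p).obj (m p))) :
    BasedFunctor.arr (compFamily ψ φ m) (Smash.tup a) =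
      BasedFunctor.arr (H.act ((lexEquiv _).symm.trans
        ((Equiv.piCongrRight fun _ => (lexEquiv _).symm).trans
        ((Equiv.piCurry fun i j => Fin (m (finSigmaFinEquiv ⟨i, j⟩))).symm.trans
        ((Equiv.piCongrLeft (fun p => Fin (m p)) finSigmaFinEquiv).trans (lexEquiv m))))))
        (BasedFunctor.arr (ψ _) (Smash.tup fun i => BasedFunctor.arr (φ i _)
          (Smash.tup fun j => BasedFunctor.arr (eqToHom (congrArg (fun L : Levels.{u} => L.obj _)
            (concat_apply F ⟨i, j⟩))) (a (finSigmaFinEquiv ⟨i, j⟩))))) := by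
  unfold compFamily
  rw [BasedFunctor.arr_comp, BasedFunctor.arr_comp, BasedFunctor.arr_comp, Smash.arr_nest_tup,
    Smash.arr_map_tup]

theorem arr_permFamily {k n : ℕ} (σ : Fin k ≃ Fin n) {F : Fin n → Levels.{u}} {G : Levels.{u}}
    (φ : Family (fun j => (F j).obj) G.obj) (m : Fin k → ℕ)
    (a : ∀ i, Arr ((F (σ i)).obj (m i))) :
    BasedFunctor.arr (permFamily σ φ m) (Smash.tup a) =
      BasedFunctor.arr (G.act ((lexEquiv _).symm.trans
        ((Equiv.piCongrLeft (fun i => Fin (m i)) σ.symm).trans (lexEquiv m))))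
        (BasedFunctor.arr (φ _) (Smash.tup fun j => BasedFunctor.arr (eqToHom
          (congrArg (fun j' => (F j').obj _) (Equiv.apply_symm_apply σ j))) (a (σ.symm j)))) :=
  congrArg (BasedFunctor.arr (G.act _)) (congrArg (BasedFunctor.arr (φ _))
    (Smash.arr_mapAlong_tup _ σ.symm.surjective _ _))

/-- Components are values at the universal map. By `lexMap_concat` and `lexMap_perm` this map
factors as the formulas prescribe, up to a bijection of lexicographic codes, and `GMor.post` turns
that bijection into an action on the target. -/
theorem gammaMulticategory_levelwise :
    Levelwise gammaMulticategory.{u}.toMultiOps GammaCat.levels gammaFam where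
  id x := by
    funext m
    refine Smash.arr_ext fun a => ?_
    refine (arr_gammaFam_tup (GMor.idU x) m a).trans ?_
    refine (GMor.ev_idU _ _).trans ?_
    have h : (lexMap fun i => ⟨m i⟩).toHom = GammaOp.ofEquiv
        ((Equiv.piUnique fun i : Fin 1 => Fin (m i)).symm.trans (lexEquiv m)) := by
      refine GammaOp.hom_ext fun s => ?_
      refine Eq.trans ?_ (lexMap_some _ _)
      change (lexMap _).toFun _ = _
      congr 1
      funext i
      obtain rfl : i = 0 := Subsingleton.elim _ _
      rfl
    rw [h]
    exact (arr_idFamily x.levels m a).symm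
  comp {s t w x y} f g := by
    funext m
    refine Smash.arr_ext fun a => ?_
    refine (arr_gammaFam_tup (GMor.permU finSigmaFinEquiv.symm
      (GMor.compU (GMor.ofHom f) fun i => GMor.ofHom (g i))) m a).trans ?_
    -- The arrows are transported exactly as in `compFamily`, so that the two sides agree literally
    -- at the end.
    let a' : ∀ q : Σ i, Fin (t i), El (w q.1 q.2).functor ⟨m (finSigmaFinEquiv q)⟩ := fun q =>
      BasedFunctor.arr (eqToHom (congrArg (fun L : Levels.{u} => L.obj _)
        (concat_apply (fun i j => (w i j).levels) q))) (a (finSigmaFinEquiv q))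
    let e := (lexEquiv _).symm.trans ((Equiv.piCongrRight fun _ => (lexEquiv _).symm).trans
        ((Equiv.piCurry fun i j => Fin (m (finSigmaFinEquiv ⟨i, j⟩))).symm.trans
        ((Equiv.piCongrLeft (fun p => Fin (m p)) finSigmaFinEquiv).trans (lexEquiv m))))
    -- With `φ`, this factors the universal map of the flat list over the universal maps of the
    -- nested ones.
    let ψ := (lexMap fun i => ⟨∏ j, m (finSigmaFinEquiv ⟨i, j⟩)⟩).post (GammaOp.ofEquiv e)
    let φ := fun i => lexMap fun j => ⟨m (finSigmaFinEquiv ⟨i, j⟩)⟩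
    refine (GMor.ev_permU_of_heq finSigmaFinEquiv.symm _
      (m := fun q => ⟨m (finSigmaFinEquiv q)⟩) (a := a')
      (θ := PMap.sub (n := fun q => ⟨m (finSigmaFinEquiv q)⟩) ψ φ)
      (fun p => by rw [Equiv.apply_symm_apply]) (fun p => ?_) fun t' t h => ?_).trans ?_
    · refine HEq.symm ((BasedFunctor.arr_eqToHom_heq _ _).trans ?_)
      exact congr_arg_heq a (Equiv.apply_symm_apply _ p)
    · obtain rfl : t = fun q => t' (finSigmaFinEquiv q) := funext fun q => eq_of_heq
        ((congr_arg_heq t (Equiv.symm_apply_apply _ q)).symm.trans (h (finSigmaFinEquiv q)).symm)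
      exact lexMap_concat m t'
    · refine (GMor.ev_compU (GMor.ofHom f) (fun i => GMor.ofHom (g i)) _ a' ψ φ
        fun t => rfl).trans ?_
      refine (GMor.post (GMor.ofHom f) (lexMap _) (GammaOp.ofEquiv e) _).trans ?_
      refine Eq.trans (congrArg (act (X := y.functor) (GammaOp.ofEquiv e))
        (GMor.ev_ofHom_lexMap f _ _)) ?_
      refine Eq.trans ?_ (arr_compFamily (F := fun i j => (w i j).levels)
        (G := fun i => (x i).levels) (H := y.levels) (gammaFam f) (fun i => gammaFam (g i)) m a).symm
      exact congrArg (fun z => act (X := y.functor) (GammaOp.ofEquiv e)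
        (BasedFunctor.arr (f.app _) (Smash.tup z))) (funext fun i => GMor.ev_ofHom_lexMap (g i) _ _)
  perm {k n} σ x y f := by
    funext m
    refine Smash.arr_ext fun a => ?_
    refine (arr_gammaFam_tup (X := fun i => x (σ i)) (GMor.permU σ (GMor.ofHom f)) m a).trans ?_
    let a' : ∀ j, El (x j).functor ⟨m (σ.symm j)⟩ := fun j =>
      BasedFunctor.arr (eqToHom (congrArg (fun j' => (x j').levels.obj _)
        (Equiv.apply_symm_apply σ j))) (a (σ.symm j))
    let e := (lexEquiv _).symm.trans
      ((Equiv.piCongrLeft (fun i => Fin (m i)) σ.symm).trans (lexEquiv m))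
    refine (GMor.ev_permU_of_heq σ _ (m := fun j => ⟨m (σ.symm j)⟩) (a := a')
      (θ := (lexMap fun j => ⟨m (σ.symm j)⟩).post (GammaOp.ofEquiv e))
      (fun p => by rw [Equiv.symm_apply_apply]) (fun p => ?_) fun t' t h => ?_).trans ?_
    · refine HEq.symm ((BasedFunctor.arr_eqToHom_heq _ _).trans ?_)
      exact congr_arg_heq a (Equiv.symm_apply_apply _ p)
    · obtain rfl : t = fun j => t' (σ.symm j) := funext fun j => eq_of_heq
        ((congr_arg_heq t (Equiv.apply_symm_apply σ j)).symm.trans (h (σ.symm j)).symm)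
      exact lexMap_perm σ m t'
    · refine (GMor.post (GMor.ofHom f) (lexMap _) (GammaOp.ofEquiv e) _).trans ?_
      refine Eq.trans (congrArg (act (X := y.functor) (GammaOp.ofEquiv e))
        (GMor.ev_ofHom_lexMap f _ _)) ?_
      exact (arr_permFamily σ (F := fun i => (x i).levels) (G := y.levels) (gammaFam f) m a).symm

end GammaHom

/-! ### Based multifunctors are determined by their values on based maps -/

section Multifunctors

/-- A based map `[m]₊ → [n]₊` as a `2`-morphism `([n], [m]) → [m]` of `ℕ`. -/
def hat {a b : GammaOp} (g : a ⟶ b) : NHom ![b.card, a.card] a.card := fun t =>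
  match g.1 (some t) with
  | some j => ⟨0, j⟩
  | none => ⟨1, t⟩

theorem hat_of_some {a b : GammaOp} (g : a ⟶ b) {t : Fin a.card} {j : Fin b.card}
    (h : g.1 (some t) = some j) : hat g t = ⟨0, j⟩ := by
  unfold hat
  rw [h]

theorem hat_of_none {a b : GammaOp} (g : a ⟶ b) {t : Fin a.card}
    (h : g.1 (some t) = none) : hat g t = ⟨1, t⟩ := by
  unfold hat
  rw [h]

/-- Every based map is a coordinate of a morphism of `ℕ`: points that are sent to the base point go
to the auxiliary second summand, which the collapse removes. -/
theorem gammaCoord_hat {a b : GammaOp} (g : a ⟶ b) : gammaCoord (hat g) 0 = g := by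
  refine GammaOp.hom_ext fun t => ?_
  change collapse 0 (hat g t) = _
  cases h : g.1 (some t) with
  | some j => rw [hat_of_some g h]; exact collapse_self _ _
  | none => rw [hat_of_none g h]; exact collapse_ne _ _ (one_ne_zero : (1 : Fin 2) ≠ 0)

theorem gammaCoord_ofEquiv {m n : ℕ} (e : Fin m ≃ Fin n) :
    gammaCoord (x := fun _ : Fin 1 => n) (fun t => ⟨0, e t⟩) 0 = GammaOp.ofEquiv e :=
  GammaOp.hom_ext fun t => collapse_self (x := fun _ : Fin 1 => n) 0 (e t)

theorem gammaCoord_comp_heq {s : ℕ} {t : Fin s → ℕ} {w : ∀ i, Fin (t i) → ℕ} {x : Fin s → ℕ}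
    {y : ℕ} (f : NHom x y) (g : ∀ i, NHom (w i) (x i)) (q : Σ i, Fin (t i)) :
    gammaCoord (nOps.comp f g) (finSigmaFinEquiv q) ≍
      gammaCoord f q.1 ≫ gammaCoord (g q.1) q.2 := by
  rw [gammaCoord_comp]
  exact congr_arg_heq (fun q : Σ i, Fin (t i) => gammaCoord f q.1 ≫ gammaCoord (g q.1) q.2)
    (Equiv.symm_apply_apply finSigmaFinEquiv q)

/-- A tuple lies in the summand `q` exactly if each entry lies in the summand that `q` prescribes
for it. Otherwise some collapsed entry is the base point, and so is the combined tuple. -/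
theorem collapse_lexEquiv {r : ℕ} {s : Fin r → ℕ} {p : ∀ i, Fin (s i) → ℕ}
    (z : ∀ i, Σ a, Fin (p i a)) (q : Fin (∏ i, s i))
    (h : ∏ i, p i (z i).1 = ∏ i, p i ((lexEquiv s).symm (lexEquiv s fun i => (z i).1) i)) :
    collapse (x := fun q => ∏ i, p i ((lexEquiv s).symm q i)) q ⟨lexEquiv s fun i => (z i).1,
        Fin.cast h (lexEquiv (fun i => p i (z i).1) fun i => (z i).2)⟩ =
      (GammaOp.combine fun i => collapse ((lexEquiv s).symm q i) (z i)).map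
        (lexEquiv fun i => p i ((lexEquiv s).symm q i)) := by
  by_cases hq : ∀ i, (z i).1 = (lexEquiv s).symm q i
  · have hb : ∀ i, ∃ b, z i = ⟨(lexEquiv s).symm q i, b⟩ := fun i => by
      rcases hi : z i with ⟨k, b⟩
      obtain rfl : k = (lexEquiv s).symm q i := by rw [← hq i, hi]
      exact ⟨b, rfl⟩
    choose b hb using hb
    obtain rfl : z = fun i => ⟨(lexEquiv s).symm q i, b i⟩ := funext hb
    simp only [collapse_self, GammaOp.combine_some]
    refine collapse_eq_some (x := fun q => ∏ i, p i ((lexEquiv s).symm q i)) q _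
      (lexEquiv (fun i => p i ((lexEquiv s).symm q i)) b) ?_ ?_
    · exact Equiv.apply_symm_apply _ _
    · rfl
  · push Not at hq
    obtain ⟨i, hi⟩ := hq
    rw [GammaOp.combine_none (i := i) (collapse_ne _ _ hi)]
    refine collapse_ne _ _ fun hq => hi ?_
    rw [← hq, Equiv.symm_apply_apply]

/-- This turns multilinearity over `ℕ` into naturality over `Γᵒᵖ`. -/
theorem gammaCoord_nRing {r : ℕ} {s : Fin r → ℕ} {p : ∀ i, Fin (s i) → ℕ} {m : Fin r → ℕ}
    (f : ∀ i, NHom (p i) (m i)) (q : Fin (∏ i, s i)) :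
    gammaCoord (nRing f) q = (GammaOp.smash r).map (X := fun i => ⟨m i⟩)
      (Y := fun i => ⟨p i ((lexEquiv s).symm q i)⟩)
      fun i => gammaCoord (f i) ((lexEquiv s).symm q i) :=
  GammaOp.hom_ext fun t => collapse_lexEquiv (fun i => f i ((lexEquiv m).symm t i)) q _

namespace BasedMultifunctor

variable (F : BasedMultifunctor.{u})

theorem map_id (m : ℕ) : F.map (nOps.id m) 0 = 𝟙 (F.obj m) :=
  congrFun (F.toMultifunctor.map_id m) 0

theorem map_comp_heq {s : ℕ} {t : Fin s → ℕ} {w : ∀ i, Fin (t i) → ℕ} {x : Fin s → ℕ} {y : ℕ}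
    (f : NHom x y) (g : ∀ i, NHom (w i) (x i)) (q : Σ i, Fin (t i)) :
    F.map (nOps.comp f g) (finSigmaFinEquiv q) ≍ F.map f q.1 ≫ F.map (g q.1) q.2 := by
  have h := congrFun (F.toMultifunctor.map_comp f g) (finSigmaFinEquiv q)
  exact (heq_of_eq h).trans (congr_arg_heq (fun q : Σ i, Fin (t i) =>
    F.map f q.1 ≫ F.map (g q.1) q.2) (Equiv.symm_apply_apply finSigmaFinEquiv q))

/-- Equivariance of `F`, with the relation between `f` and `f'` stated pointwise, so that morphisms
with differently concatenated lists can be compared. -/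
theorem map_heq_of_perm {r r' : ℕ} {x : Fin r → ℕ} {x' : Fin r' → ℕ} {m : ℕ} (f : NHom x m)
    (f' : NHom x' m) (σ : Fin r' ≃ Fin r) (h : ∀ i, x' i = x (σ i))
    (h₁ : ∀ t, σ (f' t).1 = (f t).1) (h₂ : ∀ t, ((f' t).2 : ℕ) = (f t).2) {i : Fin r'} {j : Fin r}
    (hij : σ i = j) : F.map f' i ≍ F.map f j := by
  subst hij
  obtain rfl : x' = fun i => x (σ i) := funext h
  obtain rfl : f' = nOps.perm σ f :=
    funext fun t => NHom.sigma_ext ((Equiv.eq_symm_apply σ).mpr (h₁ t)) (h₂ t)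
  exact heq_of_eq (congrFun (F.toMultifunctor.map_perm σ f) i)

/-- The inclusion of a summand and the identity of `[x a]` both arise from the inclusion `ι` into a
list whose entries other than the `a`-th are empty. An empty entry can be enlarged to `[x b]`, or
deleted by composing with a `0`-morphism. Both operations do the same at `a`, so the coordinates
there agree. -/
theorem map_inclusion {r : ℕ} (x : Fin r → ℕ) (a : Fin r) :
    F.map (x := x) (fun t : Fin (x a) => ⟨a, t⟩) a = 𝟙 (F.obj (x a)) := by
  let z : Fin r → ℕ := fun b => if b = a then x b else 0
  -- The length of the list that replaces the entry `b`: zero means that the empty entry is deleted.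
  let n : Fin r → ℕ := fun b => if b = a then 1 else 0
  have hz : ∀ b, z b ≤ x b := fun b => by dsimp only [z]; split_ifs <;> simp
  have hza : z a = x a := if_pos rfl
  have hn : ∀ b, z b ≠ 0 → n b = 1 := fun b hb => if_pos (by
    by_contra h
    exact hb (if_neg h))
  have hna : n a = 1 := if_pos rfl
  let ι : NHom z (x a) := fun t => ⟨a, Fin.cast hza.symm t⟩
  let g : ∀ b, NHom (fun _ : Fin 1 => x b) (z b) := fun b t => ⟨0, Fin.castLE (hz b) t⟩
  let k : ∀ b, NHom (fun _ : Fin (n b) => x b) (z b) := fun b t =>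
    ⟨Fin.cast (hn b (Nat.ne_of_gt t.pos)).symm 0, Fin.castLE (hz b) t⟩
  have hsum : ∑ b, n b = 1 := by simp [n]
  let a' : Fin (n a) := Fin.cast hna.symm 0
  have h₁ : F.map (k a) a' ≍ F.map (g a) 0 :=
    F.map_heq_of_perm (g a) (k a) (finCongr hna) (fun _ => rfl) (fun _ => rfl) (fun _ => rfl) rfl
  have h₂ := F.map_comp_heq ι g ⟨a, 0⟩
  have h₃ := F.map_comp_heq ι k ⟨a, a'⟩
  -- After the deletions only the entry `a` is left, and the composite is an identity up to the name
  -- of a one-element list.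
  have h₄ : F.map (nOps.comp ι k) (finSigmaFinEquiv ⟨a, a'⟩) ≍ F.map (nOps.id (x a)) 0 := by
    refine F.map_heq_of_perm _ _ (finCongr hsum) (fun p => ?_)
      (fun t => Subsingleton.elim _ _) (fun t => rfl) (Subsingleton.elim _ _)
    obtain ⟨⟨b, j⟩, rfl⟩ := finSigmaFinEquiv.surjective p
    refine (concat_apply (fun b (_ : Fin (n b)) => x b) ⟨b, j⟩).trans ?_
    by_cases hb : b = a
    · exact congrArg x hb
    · exact absurd j.2 (by simp [n, hb])
  -- Enlarging the empty entries instead gives the inclusion itself.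
  have h₅ : F.map (nOps.comp ι g) (finSigmaFinEquiv ⟨a, 0⟩) ≍
      F.map (x := x) (fun t : Fin (x a) => ⟨a, t⟩) a := by
    refine F.map_heq_of_perm _ _ (finSigmaFinEquiv.symm.trans
      ((Equiv.sigmaEquivProd (Fin r) (Fin 1)).trans (Equiv.prodUnique (Fin r) (Fin 1))))
      (fun p => rfl) (fun t => ?_) (fun t => rfl) ?_
    · exact congrArg Sigma.fst (Equiv.symm_apply_apply finSigmaFinEquiv (⟨a, 0⟩ : Σ _, Fin 1))
    · exact congrArg Sigma.fst (Equiv.symm_apply_apply finSigmaFinEquiv (⟨a, 0⟩ : Σ _, Fin 1))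
  have h₆ : F.map ι a ≫ F.map (k a) a' = F.map ι a ≫ F.map (g a) 0 :=
    congrArg (F.map ι a ≫ ·) (eq_of_heq h₁)
  exact (eq_of_heq (h₅.symm.trans (h₂.trans ((heq_of_eq h₆.symm).trans (h₃.symm.trans h₄))))).trans
    (F.map_id _)

/-- The coordinates of the functor induced by a morphism of `ℕ` depend only on the corresponding
based maps. -/
theorem map_eq_hat {r : ℕ} {x : Fin r → ℕ} {m : ℕ} (f : NHom x m) (a : Fin r) :
    F.map f a = F.map (hat (gammaCoord f a)) 0 := by
  -- The same function from `[m]` to two copies of the disjoint union of `x` is written in two ways,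
  -- as `hat` followed by `g` and as `f` followed by `k`: points that `f` sends to the summand `a`
  -- go to the first copy, the others to the second. The coordinate at `[x a]` in the first copy
  -- gives the two sides of the claim, because `g 0` and `k a` are inclusions.
  let g : ∀ i : Fin 2, NHom x (![x a, m] i) := fun i => match i with
    | 0 => fun t => ⟨a, t⟩
    | 1 => f
  let k : ∀ b, NHom (fun _ : Fin 2 => x b) (x b) := fun b t => if b = a then ⟨0, t⟩ else ⟨1, t⟩
  have h₁ := F.map_comp_heq (hat (gammaCoord f a)) g ⟨0, a⟩
  have h₂ := F.map_comp_heq f k ⟨a, 0⟩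
  have hg : F.map (g 0) a = 𝟙 _ := F.map_inclusion x a
  have hk : F.map (k a) 0 = 𝟙 _ := by
    have : k a = fun t => ⟨0, t⟩ := funext fun t => if_pos rfl
    rw [this]
    exact F.map_inclusion (fun _ : Fin 2 => x a) 0
  have key : ∀ t, (∃ j, f t = ⟨a, j⟩ ∧ hat (gammaCoord f a) t = ⟨0, j⟩) ∨
      ((f t).1 ≠ a ∧ hat (gammaCoord f a) t = ⟨1, t⟩) := fun t => by
    by_cases h : (f t).1 = a
    · left
      rcases hb : f t with ⟨b, j⟩
      obtain rfl : b = a := by rw [← h, hb]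
      exact ⟨j, rfl, hat_of_some _ ((congrArg (collapse b) hb).trans (collapse_self b j))⟩
    · exact .inr ⟨h, hat_of_none _ (collapse_ne _ _ h)⟩
  have h₃ : F.map (nOps.comp f k) (finSigmaFinEquiv ⟨a, 0⟩) ≍
      F.map (nOps.comp (hat (gammaCoord f a)) g) (finSigmaFinEquiv ⟨0, a⟩) := by
    -- One composite lists the summands as `r` pairs and the other as two lists of length `r`, so
    -- the permutation exchanges the two indices.
    refine F.map_heq_of_perm _ _ (finSigmaFinEquiv.symm.trans
      ((Equiv.sigmaEquivProd (Fin r) (Fin 2)).trans ((Equiv.prodComm _ _).trans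
        ((Equiv.sigmaEquivProd (Fin 2) (Fin r)).symm.trans finSigmaFinEquiv))))
      (fun p => ?_) (fun t => ?_) (fun t => ?_) ?_
    · obtain ⟨q, rfl⟩ := finSigmaFinEquiv.surjective p
      refine (concat_apply _ q).trans ?_
      simp [concat]
    · rcases key t with ⟨j, hj, hj'⟩ | ⟨ht, ht'⟩
      · obtain ⟨e₁, -⟩ := nComp_snd_congr k hj
        obtain ⟨e₂, -⟩ := nComp_snd_congr g hj'
        refine Eq.trans ?_ (congrArg finSigmaFinEquiv e₂.symm)
        refine (congrArg _ (congrArg finSigmaFinEquiv e₁)).trans ?_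
        simp [k, g]
      · obtain ⟨e₂, -⟩ := nComp_snd_congr g ht'
        refine Eq.trans ?_ (congrArg finSigmaFinEquiv e₂.symm)
        have e₁ : (⟨(f t).1, (k (f t).1 (f t).2).1⟩ : Σ _ : Fin r, Fin 2) = ⟨(f t).1, 1⟩ := by
          simp [k, ht]
        refine (congrArg _ (congrArg finSigmaFinEquiv e₁)).trans ?_
        simp [g]
    · rcases key t with ⟨j, hj, hj'⟩ | ⟨ht, ht'⟩
      · obtain ⟨-, e₁⟩ := nComp_snd_congr k hj
        obtain ⟨-, e₂⟩ := nComp_snd_congr g hj'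
        refine e₁.trans (Eq.trans ?_ e₂.symm)
        simp [k, g]
      · obtain ⟨-, e₂⟩ := nComp_snd_congr g ht'
        refine Eq.trans ?_ e₂.symm
        change ((k (f t).1 (f t).2).2 : ℕ) = (f t).2
        simp [k, ht]
    · simp
  have h₁' := h₁.trans (heq_of_eq ((congrArg (F.map (hat (gammaCoord f a)) 0 ≫ ·) hg).trans
    (Category.comp_id _)))
  have h₂' := h₂.trans (heq_of_eq ((congrArg (F.map f a ≫ ·) hk).trans (Category.comp_id _)))
  exact eq_of_heq (h₂'.symm.trans (h₃.trans h₁'))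

theorem map_hat_heq {a b b' : GammaOp} {g : a ⟶ b} {g' : a ⟶ b'} (hb : b = b') (h : g ≍ g') :
    F.map (hat g) 0 ≍ F.map (hat g') 0 := by
  subst hb
  subst h
  rfl

/-- The `Γ`-category with the same levels as a based multifunctor. -/
def toGamma : GammaCat.{u} where
  functor :=
    { obj := fun a => F.obj a.card
      map := fun g => F.map (hat g) 0
      map_id := fun a => by
        -- The identity of `ℕ` is another morphism with the identity as coordinate, and the value of
        -- `F` on it is known.
        have h := F.map_eq_hat (nOps.id a.card) 0
        rw [gammaCoord_id, F.map_id] at h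
        exact h.symm
      map_comp := fun {a b c} g h => by
        let w : Fin 2 → Fin 2 → ℕ := fun i => match i with
          | 0 => ![c.card, b.card]
          | 1 => ![a.card, a.card]
        -- Only the coordinate `(0, 0)` of the composite is used; the second entry is a filler.
        let k : ∀ i, NHom (w i) (![b.card, a.card] i) := fun i => match i with
          | 0 => hat h
          | 1 => hat (𝟙 a)
        have h₁ := F.map_comp_heq (hat g) k ⟨0, 0⟩
        rw [F.map_eq_hat] at h₁
        have h₂ := gammaCoord_comp_heq (hat g) k ⟨0, 0⟩
        have h₃ : gammaCoord (hat g) 0 ≫ gammaCoord (k 0) 0 = g ≫ h := by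
          rw [gammaCoord_hat]
          exact congrArg (g ≫ ·) (gammaCoord_hat h)
        refine eq_of_heq (HEq.trans ?_ h₁)
        refine F.map_hat_heq ?_ ((heq_of_eq h₃.symm).trans h₂.symm)
        exact congrArg GammaOp.mk (concat_apply w ⟨0, 0⟩).symm }
  point := F.based

theorem toGamma_map_gammaCoord {r : ℕ} {x : Fin r → ℕ} {m : ℕ} (f : NHom x m) (a : Fin r) :
    F.toGamma.functor.map (gammaCoord f a) = F.map f a :=
  (F.map_eq_hat f a).symm

theorem toGamma_act {m n : ℕ} (e : Fin m ≃ Fin n) : F.toGamma.levels.act e = F.levels.act e := by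
  refine Eq.trans ?_ (F.toGamma_map_gammaCoord (x := fun _ : Fin 1 => n) (fun t => ⟨0, e t⟩) 0)
  rw [gammaCoord_ofEquiv]
  rfl

end BasedMultifunctor

/-! ### Multilinear transformations are natural transformations -/

namespace MultilinearTrans

variable {r : ℕ} {F : Fin r → BasedMultifunctor.{u}} {G : BasedMultifunctor.{u}}

/-- Both sides of multilinearity involve only the coordinates `gammaCoord (f i)`, by
`toGamma_map_gammaCoord` on the left and `gammaCoord_nRing` on the right. -/
theorem natural_iff (φ : Family (fun i => (F i).obj) G.obj) {s : Fin r → ℕ}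
    {p : ∀ i, Fin (s i) → ℕ} {m : Fin r → ℕ} (f : ∀ i, NHom (p i) (m i)) (q : Fin (∏ i, s i)) :
    catRing (fun i => (F i).map (f i)) q ≫ φ (fun i => p i ((lexEquiv s).symm q i)) =
      φ m ≫ G.map (nRing f) q ↔
    (externalSmash fun i => (F i).toGamma).map (X := fun i => ⟨m i⟩)
        (Y := fun i => ⟨p i ((lexEquiv s).symm q i)⟩)
        (fun i => gammaCoord (f i) ((lexEquiv s).symm q i)) ≫
        φ (fun i => p i ((lexEquiv s).symm q i)) =
      φ m ≫ G.toGamma.functor.map ((GammaOp.smash r).map (X := fun i => ⟨m i⟩)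
        (Y := fun i => ⟨p i ((lexEquiv s).symm q i)⟩)
        fun i => gammaCoord (f i) ((lexEquiv s).symm q i)) := by
  have h₁ : (externalSmash fun i => (F i).toGamma).map (X := fun i => ⟨m i⟩)
        (Y := fun i => ⟨p i ((lexEquiv s).symm q i)⟩)
        (fun i => gammaCoord (f i) ((lexEquiv s).symm q i)) =
      catRing (fun i => (F i).map (f i)) q :=
    congrArg Smash.map (funext fun i => (F i).toGamma_map_gammaCoord _ _)
  have h₂ : G.toGamma.functor.map ((GammaOp.smash r).map (X := fun i => ⟨m i⟩)
        (Y := fun i => ⟨p i ((lexEquiv s).symm q i)⟩)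
        fun i => gammaCoord (f i) ((lexEquiv s).symm q i)) = G.map (nRing f) q := by
    rw [← gammaCoord_nRing]
    exact G.toGamma_map_gammaCoord _ _
  exact iff_of_eq (congrArg₂ Eq (congrArg (· ≫ φ fun i => p i ((lexEquiv s).symm q i)) h₁.symm)
    (congrArg (φ m ≫ ·) h₂.symm))

/-- Multilinear transformations between based multifunctors are the same as natural transformations
between the corresponding `Γ`-categories. -/
def equivGammaHom (F : Fin r → BasedMultifunctor.{u}) (G : BasedMultifunctor.{u}) :
    MultilinearTrans F G ≃ GammaHom (fun i => (F i).toGamma) G.toGamma where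
  toFun φ :=
    { app := fun n => φ.fam fun i => (n i).card
      naturality := fun n n' f => by
        -- Multilinearity is applied to the morphisms `hat (f i)`, each with two target summands. At
        -- the tuple of first summands the coordinates are the given maps.
        have h := fun y : Fin r → Fin 2 => by
          have := (natural_iff φ.fam (fun i => hat (f i)) (lexEquiv (fun _ => 2) y)).mp
            (φ.natural _ _)
          rwa [Equiv.symm_apply_apply] at this
        have h₀ := h 0
        have hf : (fun i => gammaCoord (hat (f i)) 0 : n ⟶ n') = f :=
          funext fun i => gammaCoord_hat (f i)
        have := congrArg (fun f : n ⟶ n' => (externalSmash fun i => (F i).toGamma).map f ≫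
          φ.fam (fun i => (n' i).card) = φ.fam (fun i => (n i).card) ≫
            G.toGamma.functor.map ((GammaOp.smash r).map f)) hf
        exact this.mp h₀ }
  invFun f := ⟨gammaFam f, fun _ _ => (natural_iff (gammaFam f) _ _).mpr (f.naturality _)⟩
  left_inv _ := rfl
  right_inv _ := rfl

end MultilinearTrans

/-! ### The second multicategory and the multifunctor `A` -/

/-- The multicategory of based multifunctors. -/
noncomputable def multMulticategory : Multicategory MultilinearTrans.{u} :=
  gammaMulticategory.transport BasedMultifunctor.toGamma MultilinearTrans.equivGammaHom

theorem idFamily_congr {L : ℕ → BasedCat.{u}} {a a' : ∀ {m n : ℕ}, (Fin m ≃ Fin n) → (L m ⟶ L n)}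
    (h : ∀ {m n : ℕ} (e : Fin m ≃ Fin n), a e = a' e) :
    idFamily ⟨L, a⟩ = idFamily ⟨L, a'⟩ := by
  funext m
  exact congrArg (_ ≫ ·) (h _)

/-- Transport leaves the families unchanged, so only the actions of bijections remain to be
compared, which is `toGamma_act`. -/
theorem multMulticategory_levelwise :
    Levelwise multMulticategory.{u}.toMultiOps BasedMultifunctor.levels MultilinearTrans.fam where
  id x := (gammaMulticategory_levelwise.id x.toGamma).trans
    (idFamily_congr (a := x.toGamma.levels.act) (a' := x.levels.act) x.toGamma_act)
  comp {s t w x y} f g := by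
    refine (gammaMulticategory_levelwise.comp (MultilinearTrans.equivGammaHom _ _ f)
      fun i => MultilinearTrans.equivGammaHom _ _ (g i)).trans ?_
    funext m
    unfold compFamily
    exact congrArg (_ ≫ _ ≫ _ ≫ ·) (y.toGamma_act _)
  perm {k n} σ x y f := by
    refine (gammaMulticategory_levelwise.perm σ (MultilinearTrans.equivGammaHom _ _ f)).trans ?_
    funext m
    unfold permFamily
    exact congrArg (_ ≫ _ ≫ ·) (y.toGamma_act _)

/-- A bijection acts on `constructionA X` through a morphism with a one-element list, whose only
coordinate is the bijection with base points added. -/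
theorem constructionA_act (X : GammaCat.{u}) {m n : ℕ} (e : Fin m ≃ Fin n) :
    X.levels.act e = (constructionA X).levels.act e :=
  congrArg X.functor.map (gammaCoord_ofEquiv e).symm

/-- The construction `A` on morphisms. -/
def constructionAMap {r : ℕ} {X : Fin r → GammaCat.{u}} {Y : GammaCat.{u}} (f : GammaHom X Y) :
    MultilinearTrans (fun i => constructionA (X i)) (constructionA Y) where
  fam := gammaFam f
  natural g q := by
    have h : (constructionA Y).map (nRing g) q = Y.functor.map (gammaCoord (nRing g) q) := rfl
    rw [h, gammaCoord_nRing]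
    exact f.naturality _

/-- The construction `A` as a multifunctor. -/
noncomputable def constructionAMultifunctor :
    MultifunctorOn gammaMulticategory.{u}.toMultiOps multMulticategory.toMultiOps
      constructionA.{u} where
  map f := constructionAMap f
  map_id x := MultilinearTrans.ext ((gammaMulticategory_levelwise.id x).trans
    ((idFamily_congr (a := x.levels.act) (a' := (constructionA x).levels.act)
      (constructionA_act x)).trans (multMulticategory_levelwise.id (constructionA x)).symm))
  map_comp {s t w x y} f g := MultilinearTrans.ext (by
    refine (gammaMulticategory_levelwise.comp f g).trans (Eq.trans ?_
      (multMulticategory_levelwise.comp (constructionAMap f) fun i => constructionAMap (g i)).symm)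
    funext m
    unfold compFamily
    exact congrArg (_ ≫ _ ≫ _ ≫ ·) (constructionA_act y _))
  map_perm {m n} σ x y f := MultilinearTrans.ext (by
    refine (gammaMulticategory_levelwise.perm σ f).trans (Eq.trans ?_
      (multMulticategory_levelwise.perm σ (constructionAMap f)).symm)
    funext m
    unfold permFamily
    exact congrArg (_ ≫ _ ≫ ·) (constructionA_act y _))

end Multifunctors

/-! ### The binary smash product of based sets -/

namespace GammaOp

/-- The smash product of two finite based sets. -/
def sm (a b : GammaOp) : GammaOp := ⟨a.card * b.card⟩

/-- The universal map to the smash product. -/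
def pr {a b : GammaOp} (s : a.toSet) (t : b.toSet) : (sm a b).toSet :=
  s.bind fun i => t.map fun j => finProdFinEquiv (i, j)

@[simp] theorem pr_none_left {a b : GammaOp} (t : b.toSet) : pr (none : a.toSet) t = none := rfl

@[simp] theorem pr_none_right {a b : GammaOp} (s : a.toSet) : pr s (none : b.toSet) = none := by
  cases s <;> rfl

/-- Proper elements of a smash product are pairs. Maps out of iterated smash products can therefore
be compared on iterated pairs, as in the extensionality lemmas that follow. -/
theorem exists_pr {a b : GammaOp} (i : Fin (sm a b).card) : ∃ s t, some i = pr (a := a) (b := b) s t := by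
  obtain ⟨⟨s, t⟩, rfl⟩ := finProdFinEquiv.surjective i
  exact ⟨some s, some t, rfl⟩

theorem sm_ext {a b c : GammaOp} {f g : sm a b ⟶ c} (h : ∀ s t, f.1 (pr s t) = g.1 (pr s t)) :
    f = g := by
  apply hom_ext
  intro i
  obtain ⟨s, t, hi⟩ := exists_pr i
  rw [hi, h]

/-- The map of the smash product that corresponds to a map of two variables. -/
def lift₂ {a b c : GammaOp} (θ : a.toSet → b.toSet → c.toSet) : sm a b ⟶ c :=
  ⟨fun i => i.bind fun i => θ (some (finProdFinEquiv.symm i).1) (some (finProdFinEquiv.symm i).2), rfl⟩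

/-- The definition of `lift₂` reads only the values of `θ` on proper elements; the two hypotheses
account for pairs with a base point. -/
theorem lift₂_pr {a b c : GammaOp} {θ : a.toSet → b.toSet → c.toSet} (h₁ : ∀ t, θ none t = none)
    (h₂ : ∀ s, θ s none = none) (s : a.toSet) (t : b.toSet) : (lift₂ θ).1 (pr s t) = θ s t := by
  rcases s with _ | s
  · exact (h₁ t).symm
  · rcases t with _ | t
    · exact (h₂ _).symm
    · change θ (some (finProdFinEquiv.symm (finProdFinEquiv (s, t))).1)
        (some (finProdFinEquiv.symm (finProdFinEquiv (s, t))).2) = _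
      rw [Equiv.symm_apply_apply]

/-- The smash product of two based maps. -/
def tens {a b c d : GammaOp} (p : a ⟶ c) (q : b ⟶ d) : sm a b ⟶ sm c d :=
  lift₂ fun s t => pr (p.1 s) (q.1 t)

@[simp] theorem tens_pr {a b c d : GammaOp} (p : a ⟶ c) (q : b ⟶ d) (s : a.toSet) (t : b.toSet) :
    (tens p q).1 (pr s t) = pr (p.1 s) (q.1 t) :=
  lift₂_pr (fun _ => by rw [p.2, pr_none_left]) (fun _ => by rw [q.2, pr_none_right]) s t

@[simp] theorem tens_id (a b : GammaOp) : tens (𝟙 a) (𝟙 b) = 𝟙 (sm a b) :=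
  sm_ext fun s t => by simp

theorem tens_comp {a b c a' b' c' : GammaOp} (p : a ⟶ b) (q : b ⟶ c) (p' : a' ⟶ b')
    (q' : b' ⟶ c') : tens (p ≫ q) (p' ≫ q') = tens p p' ≫ tens q q' :=
  sm_ext fun s t => by simp

/-- The associativity of the smash product. -/
def asc (a b c : GammaOp) : sm (sm a b) c ⟶ sm a (sm b c) :=
  lift₂ fun st u => (lift₂ fun s t => pr s (pr t u)).1 st

@[simp] theorem asc_pr {a b c : GammaOp} (s : a.toSet) (t : b.toSet) (u : c.toSet) :
    (asc a b c).1 (pr (pr s t) u) = pr s (pr t u) := by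
  refine (lift₂_pr (fun _ => rfl) (fun st => ?_) _ u).trans (lift₂_pr (by simp) (by simp) s t)
  rcases st with _ | st
  · rfl
  · obtain ⟨s, t, h⟩ := exists_pr st
    rw [h, lift₂_pr] <;> simp

/-- The inverse of `GammaOp.asc`. -/
def cas (a b c : GammaOp) : sm a (sm b c) ⟶ sm (sm a b) c :=
  lift₂ fun s tu => (lift₂ fun t u => pr (pr s t) u).1 tu

@[simp] theorem cas_pr {a b c : GammaOp} (s : a.toSet) (t : b.toSet) (u : c.toSet) :
    (cas a b c).1 (pr s (pr t u)) = pr (pr s t) u := by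
  refine (lift₂_pr (fun tu => ?_) (fun _ => rfl) s _).trans (lift₂_pr (by simp) (by simp) t u)
  rcases tu with _ | tu
  · rfl
  · obtain ⟨t, u, h⟩ := exists_pr tu
    rw [h, lift₂_pr] <;> simp

theorem sm_ext_left {a b c d : GammaOp} {f g : sm (sm a b) c ⟶ d}
    (h : ∀ s t u, f.1 (pr (pr s t) u) = g.1 (pr (pr s t) u)) : f = g :=
  sm_ext fun st u => by
    rcases st with _ | st
    · rw [pr_none_left, f.2, g.2]
    · obtain ⟨s, t, e⟩ := exists_pr st
      rw [e, h]

theorem sm_ext_right {a b c d : GammaOp} {f g : sm a (sm b c) ⟶ d}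
    (h : ∀ s t u, f.1 (pr s (pr t u)) = g.1 (pr s (pr t u))) : f = g :=
  sm_ext fun s tu => by
    rcases tu with _ | tu
    · rw [pr_none_right, f.2, g.2]
    · obtain ⟨t, u, e⟩ := exists_pr tu
      rw [e, h]

theorem sm_ext_right_right {a b c d e : GammaOp} {f g : sm a (sm b (sm c d)) ⟶ e}
    (h : ∀ s t u v, f.1 (pr s (pr t (pr u v))) = g.1 (pr s (pr t (pr u v)))) : f = g :=
  sm_ext_right fun s t uv => by
    rcases uv with _ | uv
    · rw [pr_none_right, pr_none_right, f.2, g.2]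
    · obtain ⟨u, v, e⟩ := exists_pr uv
      rw [e, h]

/-- The symmetry of the smash product. -/
def swp (a b : GammaOp) : sm a b ⟶ sm b a := lift₂ fun s t => pr t s

@[simp] theorem swp_pr {a b : GammaOp} (s : a.toSet) (t : b.toSet) :
    (swp a b).1 (pr s t) = pr t s :=
  lift₂_pr (fun _ => pr_none_right _) (fun _ => rfl) s t

/-- The element `1` of the based set `{0, 1}`. -/
def star : toSet ⟨1⟩ := some 0

/-- The left unit isomorphism of the smash product. -/
def lun (a : GammaOp) : sm ⟨1⟩ a ⟶ a := lift₂ fun s t => s.bind fun _ => t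

@[simp] theorem lun_pr {a : GammaOp} (t : a.toSet) : (lun a).1 (pr star t) = t :=
  lift₂_pr (fun _ => rfl) (fun s => by cases s <;> rfl) star t

/-- The inclusion of the copy of `a` in `n ∧ a` that corresponds to an element of `n`. -/
def ins {n : GammaOp} (i : n.toSet) (a : GammaOp) : a ⟶ sm n a := ⟨fun t => pr i t, pr_none_right i⟩

@[simp] theorem ins_val {n : GammaOp} (i : n.toSet) (a : GammaOp) (t : a.toSet) :
    (ins i a).1 t = pr i t := rfl

/-- The map from the unit that corresponds to an element. -/
def pt {n : GammaOp} (i : n.toSet) : (⟨1⟩ : GammaOp) ⟶ n := ⟨fun s => s.bind fun _ => i, rfl⟩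

@[simp] theorem pt_star {n : GammaOp} (i : n.toSet) : (pt i).1 star = i := rfl

theorem lun_ext {a b : GammaOp} {f g : sm ⟨1⟩ a ⟶ b}
    (h : ∀ t, f.1 (pr star t) = g.1 (pr star t)) : f = g :=
  sm_ext fun s t => by
    rcases s with _ | s
    · rw [pr_none_left, f.2, g.2]
    · obtain rfl : s = 0 := Subsingleton.elim _ _
      exact h t

theorem lun_naturality {a b : GammaOp} (g : a ⟶ b) : tens (𝟙 _) g ≫ lun b = lun a ≫ g :=
  lun_ext fun t => by simp

/-- The constant map. -/
def zero (a b : GammaOp) : a ⟶ b := ⟨fun _ => none, rfl⟩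

theorem hom_zero_ext {a : GammaOp} (f g : a ⟶ ⟨0⟩) : f = g :=
  hom_ext fun t => by
    rcases f.1 (some t) with _ | i
    · rcases g.1 (some t) with _ | i
      · rfl
      · exact i.elim0
    · exact i.elim0

end GammaOp

/-! ### Zero maps and natural transformations, on arrows -/

open GammaOp

/-- The zero map factors through `⟨0⟩`, where the only arrow is the base arrow. -/
theorem act_zero {X : GammaCat.{u}} {m n : GammaOp} (x : El X.functor m) :
    act (zero m n) x = (X.functor.obj n).baseArr := by
  rw [show zero m n = zero m ⟨0⟩ ≫ zero ⟨0⟩ n from rfl, act_comp, X.point.eq_base (act _ x),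
    act_base]

theorem El.eq_base {X : GammaCat.{u}} {n : GammaOp} (h : n.card = 0) (x : El X.functor n) :
    x = (X.functor.obj n).baseArr := by
  obtain ⟨n⟩ := n
  obtain rfl : n = 0 := h
  exact X.point.eq_base x

/-- The action of a natural transformation on arrows. -/
def ap {X Y : GammaOp ⥤ BasedCat.{u}} (f : X ⟶ Y) {n : GammaOp} (x : El X n) : El Y n :=
  BasedFunctor.arr (f.app n) x

section ap

variable {X Y Z : GammaOp ⥤ BasedCat.{u}} (f : X ⟶ Y)

@[simp] theorem ap_id {n : GammaOp} (x : El X n) : ap (𝟙 X) x = x := rfl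

@[simp] theorem ap_comp (g : Y ⟶ Z) {n : GammaOp} (x : El X n) : ap (f ≫ g) x = ap g (ap f x) := rfl

theorem ap_act {m n : GammaOp} (g : m ⟶ n) (x : El X m) : ap f (act g x) = act g (ap f x) := by
  change BasedFunctor.arr (X.map g ≫ f.app n) x = BasedFunctor.arr (f.app m ≫ Y.map g) x
  rw [f.naturality]

theorem isId_ap {n : GammaOp} {x : El X n} (h : IsId x) : IsId (ap f x) :=
  BasedFunctor.isId_arr _ h

theorem isComp_ap {n : GammaOp} {x y z : El X n} (h : IsComp x y z) :
    IsComp (ap f x) (ap f y) (ap f z) := BasedFunctor.isComp_arr _ h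

@[simp] theorem ap_base {n : GammaOp} : ap f (X.obj n).baseArr = (Y.obj n).baseArr :=
  BasedFunctor.arr_base _

variable {f} in
theorem ap_ext {g : X ⟶ Y} (h : ∀ n (x : El X n), ap f x = ap g x) : f = g :=
  NatTrans.ext (funext fun n => BasedFunctor.arr_ext (h n))

end ap

/-- The action of a natural transformation on arrows. -/
structure ArrNat (X Y : GammaOp ⥤ BasedCat.{u}) where
  ev : ∀ {n : GammaOp}, El X n → El Y n
  isId : ∀ {n : GammaOp} (x : El X n), IsId x → IsId (ev x)
  isComp : ∀ {n : GammaOp} (x y z : El X n), IsComp x y z → IsComp (ev x) (ev y) (ev z)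
  base : ∀ n, ev (X.obj n).baseArr = (Y.obj n).baseArr
  act : ∀ {m n : GammaOp} (g : m ⟶ n) (x : El X m), ev (act g x) = act g (ev x)

/-- A natural transformation from its action on arrows. -/
def ArrNat.hom {X Y : GammaOp ⥤ BasedCat.{u}} (e : ArrNat X Y) : X ⟶ Y where
  app n := BasedFunctor.ofArr e.ev e.isId e.isComp (e.base n)
  naturality m n g := BasedFunctor.arr_ext fun x => by
    simp only [BasedFunctor.arr_comp, BasedFunctor.arr_ofArr]
    exact e.act g x

@[simp] theorem ArrNat.ap_hom {X Y : GammaOp ⥤ BasedCat.{u}} (e : ArrNat X Y) {n : GammaOp}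
    (x : El X n) : ap e.hom x = e.ev x :=
  BasedFunctor.arr_ofArr e.ev e.isId e.isComp (e.base n) x

/-! ### Bilinear maps -/

/-- A natural family of functors `X(m) × Y(n) ⥤ Z(m ∧ n)` that collapse the coordinate hyperplanes,
in terms of its action on arrows. -/
structure BiMor (X Y : GammaCat.{u}) (Z : GammaOp ⥤ BasedCat.{u}) where
  ev : ∀ {m n : GammaOp}, El X.functor m → El Y.functor n → El Z (sm m n)
  isId : ∀ {m n : GammaOp} {x : El X.functor m} {y : El Y.functor n}, IsId x → IsId y →
    IsId (ev x y)
  isComp : ∀ {m n : GammaOp} {x x' x'' : El X.functor m} {y y' y'' : El Y.functor n},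
    IsComp x x' x'' → IsComp y y' y'' → IsComp (ev x y) (ev x' y') (ev x'' y'')
  base_left : ∀ {m n : GammaOp} (y : El Y.functor n),
    ev (X.functor.obj m).baseArr y = (Z.obj (sm m n)).baseArr
  base_right : ∀ {m n : GammaOp} (x : El X.functor m),
    ev x (Y.functor.obj n).baseArr = (Z.obj (sm m n)).baseArr
  act_act : ∀ {m n m' n' : GammaOp} (p : m ⟶ m') (q : n ⟶ n') (x : El X.functor m)
    (y : El Y.functor n), ev (act p x) (act q y) = act (tens p q) (ev x y)

namespace BiMor

variable {X Y : GammaCat.{u}} {Z : GammaOp ⥤ BasedCat.{u}} (B : BiMor X Y Z)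

theorem act_left {m n m' : GammaOp} (p : m ⟶ m') (x : El X.functor m) (y : El Y.functor n) :
    B.ev (act p x) y = act (tens p (𝟙 n)) (B.ev x y) := by
  simpa using B.act_act p (𝟙 n) x y

theorem act_right {m n n' : GammaOp} (q : n ⟶ n') (x : El X.functor m) (y : El Y.functor n) :
    B.ev x (act q y) = act (tens (𝟙 m) q) (B.ev x y) := by
  simpa using B.act_act (𝟙 m) q x y

end BiMor

open GammaOp

/-! ### Internal hom objects -/

/-- A natural family of based functors `Z(n) ⥤ W(m ∧ n)`, in terms of its action on arrows. -/
structure HomObj (Z W : GammaCat.{u}) (m : GammaOp) where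
  ev : ∀ {n : GammaOp}, El Z.functor n → El W.functor (sm m n)
  isId : ∀ {n : GammaOp} {z : El Z.functor n}, IsId z → IsId (ev z)
  isComp : ∀ {n : GammaOp} {x y z : El Z.functor n}, IsComp x y z → IsComp (ev x) (ev y) (ev z)
  base : ∀ n, ev (Z.functor.obj n).baseArr = (W.functor.obj (sm m n)).baseArr
  act : ∀ {n n' : GammaOp} (q : n ⟶ n') (z : El Z.functor n),
    ev (act q z) = act (tens (𝟙 m) q) (ev z)

/-- A natural family of natural transformations between functors `Z(n) ⥤ W(m ∧ n)`, in terms of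
the diagonals of its naturality squares. -/
structure HomMor {Z W : GammaCat.{u}} {m : GammaOp} (s t : HomObj Z W m) where
  ev : ∀ {n : GammaOp}, El Z.functor n → El W.functor (sm m n)
  left : ∀ {n : GammaOp} {x y z : El Z.functor n}, IsComp x y z → IsComp (s.ev x) (ev y) (ev z)
  right : ∀ {n : GammaOp} {x y z : El Z.functor n}, IsComp x y z → IsComp (ev x) (t.ev y) (ev z)
  base : ∀ n, ev (Z.functor.obj n).baseArr = (W.functor.obj (sm m n)).baseArr
  act : ∀ {n n' : GammaOp} (q : n ⟶ n') (z : El Z.functor n),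
    ev (act q z) = Mandell.act (tens (𝟙 m) q) (ev z)

section

variable {Z W : GammaCat.{u}} {m : GammaOp}

theorem HomObj.ext {s t : HomObj Z W m}
    (h : ∀ {n : GammaOp} (z : El Z.functor n), s.ev z = t.ev z) : s = t := by
  have : @s.ev = @t.ev := by
    funext n z
    exact h z
  cases s
  cases t
  cases this
  rfl

theorem HomMor.ext {s t : HomObj Z W m} {α β : HomMor s t}
    (h : ∀ {n : GammaOp} (z : El Z.functor n), α.ev z = β.ev z) : α = β := by
  have : @α.ev = @β.ev := by
    funext n z
    exact h z
  cases α
  cases β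
  cases this
  rfl

/-- The identity. -/
def HomMor.id (s : HomObj Z W m) : HomMor s s := ⟨s.ev, s.isComp, s.isComp, s.base, s.act⟩

/-- The middle objects of the diagonals agree. -/
theorem HomMor.tgt_eq {s t r : HomObj Z W m} (α : HomMor s t) (β : HomMor t r) {n : GammaOp}
    (z : El Z.functor n) : (α.ev z).tgt = (β.ev z.tgtId).src :=
  (α.right (isComp_tgtId z)).mid_eq.trans
    (β.left ((isId_tgtId z).isComp)).src_eq.symm

/-- The composite of the diagonals. -/
def HomMor.compEv {s t r : HomObj Z W m} (α : HomMor s t) (β : HomMor t r) {n : GammaOp}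
    (z : El Z.functor n) : El W.functor (sm m n) :=
  Arr.comp (α.ev z) (β.ev z.tgtId) (α.tgt_eq β z)

/-- The composite diagonal may be split along any factorization of `z`, not only `z` followed by an
identity: the value of `t` on `y` is absorbed by `α` on one side and by `β` on the other. -/
theorem HomMor.isComp_compEv {s t r : HomObj Z W m} (α : HomMor s t) (β : HomMor t r)
    {n : GammaOp} {x y z : El Z.functor n} (h : IsComp x y z) :
    IsComp (α.ev x) (β.ev y) (α.compEv β z) := by
  have h₁ : IsComp (α.ev z) (β.ev z.tgtId) (α.compEv β z) := isComp_comp _ _ _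
  have h₂ := α.right h
  have h₃ := β.left (isComp_tgtId y)
  rw [h.tgtId_eq] at h₁
  exact h₂.assoc h₁ h₃

/-- Composition. -/
def HomMor.comp {s t r : HomObj Z W m} (α : HomMor s t) (β : HomMor t r) : HomMor s r where
  ev z := α.compEv β z
  left {n x y z} h :=
    (α.left h).assoc (by
      rw [← h.tgtId_eq]
      exact α.isComp_compEv β (isComp_tgtId z)) (α.isComp_compEv β (isComp_tgtId y))
  right {n x y z} h := by
    have h₂ := β.right (isComp_srcId y)
    rw [← h.midId_eq] at h₂
    refine IsComp.assoc' h₂ ?_ (α.isComp_compEv β (isComp_tgtId x))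
    exact α.isComp_compEv β h
  base n := by
    have h := α.isComp_compEv β (BasedCat.isId_baseArr (Z.functor.obj n)).isComp
    rw [α.base, β.base] at h
    exact h.unique (BasedCat.isId_baseArr _).isComp
  act {n n'} q z := by
    have h := Mandell.isComp_act (tens (𝟙 m) q) (α.isComp_compEv β (isComp_tgtId z))
    rw [← α.act, ← β.act] at h
    exact (α.isComp_compEv β (Mandell.isComp_act q (isComp_tgtId z))).unique h

instance : SmallCategory (HomObj Z W m) where
  Hom := HomMor
  id := HomMor.id
  comp := HomMor.comp
  id_comp {s t} α := HomMor.ext fun z =>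
    ((HomMor.id s).isComp_compEv α (isComp_srcId z)).unique (α.left (isComp_srcId z))
  comp_id {s t} α := HomMor.ext fun z =>
    (α.isComp_compEv (HomMor.id t) (isComp_tgtId z)).unique (α.right (isComp_tgtId z))
  assoc α β γ := HomMor.ext fun z => by
    have h₁ := α.isComp_compEv β (isComp_tgtId z)
    have h₂ := (α.comp β).isComp_compEv γ (isComp_tgtId z)
    have h₃ := β.isComp_compEv γ (isId_tgtId z).isComp
    exact (h₁.assoc h₂ h₃).unique (α.isComp_compEv (β.comp γ) (isComp_tgtId z))

/-- The constant family. -/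
def HomObj.const : HomObj Z W m where
  ev _ := (W.functor.obj _).baseArr
  isId _ := BasedCat.isId_baseArr _
  isComp _ := (BasedCat.isId_baseArr _).isComp
  base _ := rfl
  act _ _ := (act_base _).symm

variable (Z W m) in
/-- The based category of natural families of functors `Z(n) ⥤ W(m ∧ n)`. -/
def homCat : BasedCat.{u} where
  carrier := HomObj Z W m
  base := HomObj.const

/-- The diagonals of an arrow of `homCat`. -/
def hev (a : Arr (homCat Z W m)) {n : GammaOp} (z : El Z.functor n) : El W.functor (sm m n) :=
  HomMor.ev a.hom z

/-- Diagonals see only the transformation, so the families of functors at its two ends have to be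
compared separately. -/
theorem hev_ext {a b : Arr (homCat Z W m)}
    (h₁ : ∀ {n : GammaOp} (z : El Z.functor n), HomObj.ev a.src z = HomObj.ev b.src z)
    (h₂ : ∀ {n : GammaOp} (z : El Z.functor n), HomObj.ev a.tgt z = HomObj.ev b.tgt z)
    (h : ∀ {n : GammaOp} (z : El Z.functor n), hev a z = hev b z) : a = b := by
  obtain ⟨s, t, α⟩ := a
  obtain ⟨s', t', β⟩ := b
  obtain rfl : s = s' := HomObj.ext h₁
  obtain rfl : t = t' := HomObj.ext h₂
  obtain rfl : α = β := HomMor.ext h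
  rfl

theorem isComp_hev {a b c : Arr (homCat Z W m)} (h : IsComp a b c) {n : GammaOp}
    {x y z : El Z.functor n} (h' : IsComp x y z) : IsComp (hev a x) (hev b y) (hev c z) := by
  cases h with
  | mk α β => exact HomMor.isComp_compEv α β h'

theorem isId_hev {a : Arr (homCat Z W m)} (h : IsId a) {n : GammaOp} {z : El Z.functor n}
    (h' : IsId z) : IsId (hev a z) := by
  cases h with
  | mk s => exact HomObj.isId s h'

/-- The diagonals of an identity transformation are the values of the functors themselves; the
second hypothesis makes the source and the target coincide. -/
theorem isId_of_hev {a : Arr (homCat Z W m)}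
    (h₁ : ∀ {n : GammaOp} (z : El Z.functor n), hev a z = HomObj.ev a.src z)
    (h₂ : ∀ {n : GammaOp} (z : El Z.functor n), hev a z = HomObj.ev a.tgt z) : IsId a := by
  have : a = a.srcId := hev_ext (fun _ => rfl) (fun z => (h₂ z).symm.trans (h₁ z)) h₁
  rw [this]
  exact a.isId_srcId

/-- Testing `z` followed by the identity of its target is enough, because composites of diagonals
are defined this way. -/
theorem isComp_of_hev {a b c : Arr (homCat Z W m)} (h₁ : a.tgt = b.src) (h₂ : c.src = a.src)
    (h₃ : c.tgt = b.tgt) (h : ∀ {n : GammaOp} (z : El Z.functor n),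
      IsComp (hev a z) (hev b z.tgtId) (hev c z)) : IsComp a b c := by
  have key := isComp_comp a b h₁
  have : c = Arr.comp a b h₁ := hev_ext (fun z => by rw [h₂]; rfl) (fun z => by rw [h₃]; rfl)
    fun z => (h z).unique (isComp_hev key (isComp_tgtId z))
  rw [this]
  exact key

theorem hev_base (a : Arr (homCat Z W m)) (n : GammaOp) :
    hev a (Z.functor.obj n).baseArr = (W.functor.obj (sm m n)).baseArr := HomMor.base a.hom n

theorem hev_act (a : Arr (homCat Z W m)) {n n' : GammaOp} (q : n ⟶ n') (z : El Z.functor n) :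
    hev a (act q z) = act (tens (𝟙 m) q) (hev a z) := HomMor.act a.hom q z

/-- An arrow of `homCat` from its source, its diagonals, and its target. -/
def homArr (s α t : ∀ {n : GammaOp}, El Z.functor n → El W.functor (sm m n))
    (hs : ∀ {n : GammaOp} {z : El Z.functor n}, IsId z → IsId (s z))
    (ht : ∀ {n : GammaOp} {z : El Z.functor n}, IsId z → IsId (t z))
    (hss : ∀ {n : GammaOp} {x y z : El Z.functor n}, IsComp x y z → IsComp (s x) (s y) (s z))
    (hsα : ∀ {n : GammaOp} {x y z : El Z.functor n}, IsComp x y z → IsComp (s x) (α y) (α z))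
    (hαt : ∀ {n : GammaOp} {x y z : El Z.functor n}, IsComp x y z → IsComp (α x) (t y) (α z))
    (htt : ∀ {n : GammaOp} {x y z : El Z.functor n}, IsComp x y z → IsComp (t x) (t y) (t z))
    (bs : ∀ n, s (Z.functor.obj n).baseArr = (W.functor.obj (sm m n)).baseArr)
    (bα : ∀ n, α (Z.functor.obj n).baseArr = (W.functor.obj (sm m n)).baseArr)
    (bt : ∀ n, t (Z.functor.obj n).baseArr = (W.functor.obj (sm m n)).baseArr)
    (as : ∀ {n n' : GammaOp} (q : n ⟶ n') (z : El Z.functor n),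
      s (act q z) = act (tens (𝟙 m) q) (s z))
    (aα : ∀ {n n' : GammaOp} (q : n ⟶ n') (z : El Z.functor n),
      α (act q z) = act (tens (𝟙 m) q) (α z))
    (at' : ∀ {n n' : GammaOp} (q : n ⟶ n') (z : El Z.functor n),
      t (act q z) = act (tens (𝟙 m) q) (t z)) : Arr (homCat Z W m) :=
  @Arr.mk (homCat Z W m) _ (HomObj.mk s hs hss bs as) (HomObj.mk t ht htt bt at')
    (HomMor.mk α hsα hαt bα aα)

/-- The action of a map of based sets on objects. -/
def HomObj.push {m' : GammaOp} (g : m ⟶ m') (s : HomObj Z W m) : HomObj Z W m' where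
  ev {n} z := Mandell.act (tens g (𝟙 n)) (s.ev z)
  isId h := isId_act _ (s.isId h)
  isComp h := isComp_act _ (s.isComp h)
  base n := by rw [s.base, act_base]
  act q z := by rw [s.act, ← act_comp, ← act_comp, ← tens_comp, ← tens_comp]; simp

/-- The action of a map of based sets on morphisms. -/
def HomMor.push {m' : GammaOp} (g : m ⟶ m') {s t : HomObj Z W m} (α : HomMor s t) :
    HomMor (s.push g) (t.push g) where
  ev {n} z := Mandell.act (tens g (𝟙 n)) (α.ev z)
  left h := isComp_act _ (α.left h)
  right h := isComp_act _ (α.right h)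
  base n := by rw [α.base, act_base]
  act q z := by rw [α.act, ← act_comp, ← act_comp, ← tens_comp, ← tens_comp]; simp

end

/-- The internal hom object of `Γ`-categories. -/
def ihom (Z W : GammaCat.{u}) : GammaCat.{u} where
  functor :=
    { obj := fun m => homCat Z W m
      map := fun g =>
        { functor :=
            { obj := HomObj.push g
              map := HomMor.push g
              map_id := fun _ => rfl
              map_comp := fun α β => HomMor.ext fun z =>
                (isComp_act _ (HomMor.isComp_compEv α β (isComp_tgtId z))).unique
                  (HomMor.isComp_compEv (HomMor.push g α) (HomMor.push g β) (isComp_tgtId z)) }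
          obj_base := HomObj.ext fun _ => act_base _ }
      map_id := fun m => BasedFunctor.arr_ext fun a => by
        refine hev_ext (fun {n} z => ?_) (fun {n} z => ?_) fun {n} z => ?_
        all_goals exact (congrArg (act · _) (tens_id m n)).trans (act_id _)
      map_comp := fun f g => BasedFunctor.arr_ext fun a => by
        refine hev_ext (fun {n} z => ?_) (fun {n} z => ?_) fun {n} z => ?_
        all_goals
          refine Eq.trans (congrArg (act · _) ?_) (act_comp (tens f (𝟙 n)) (tens g (𝟙 n)) _)
          rw [← tens_comp, Category.comp_id] }
  point := BasedCat.isPoint_of_arr fun a => by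
    refine hev_ext (fun {n} z => ?_) (fun {n} z => ?_) fun {n} z => ?_
    -- Since `sm ⟨0⟩ n` has cardinality `0`, all values are base arrows.
    all_goals exact El.eq_base (Nat.zero_mul _) _

theorem hev_act_left {Z W : GammaCat.{u}} {m m' : GammaOp} (g : m ⟶ m')
    (a : El (ihom Z W).functor m) {n : GammaOp} (z : El Z.functor n) :
    hev (act g a) z = act (tens g (𝟙 n)) (hev a z) := rfl

/-- The bilinear map that corresponds to a map to an internal hom object. -/
def uncurry {T Z W : GammaCat.{u}} (f : T.functor ⟶ (ihom Z W).functor) :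
    BiMor T Z W.functor where
  ev t z := hev (ap f t) z
  isId h h' := isId_hev (isId_ap f h) h'
  isComp h h' := isComp_hev (isComp_ap f h) h'
  base_left z := by rw [ap_base]; rfl
  base_right x := hev_base _ _
  act_act p q x z := by
    rw [ap_act, hev_act_left]
    refine (congrArg (act _) (hev_act (ap f x) q z)).trans ?_
    rw [← act_comp, ← tens_comp]
    simp

theorem ihom_ext {Z W : GammaCat.{u}} {m : GammaOp} {a b : El (ihom Z W).functor m}
    (h₁ : ∀ {n : GammaOp} (z : El Z.functor n), hev a.srcId z = hev b.srcId z)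
    (h₂ : ∀ {n : GammaOp} (z : El Z.functor n), hev a.tgtId z = hev b.tgtId z)
    (h : ∀ {n : GammaOp} (z : El Z.functor n), hev a z = hev b z) : a = b :=
  hev_ext h₁ h₂ h

/-! ### Day convolution -/

/-- The generators of the Day convolution of two functors to sets. -/
structure DayGen (F G : GammaOp ⥤ Type u) (k : GammaOp) : Type u where
  m : GammaOp
  n : GammaOp
  g : sm m n ⟶ k
  x : F.obj m
  y : G.obj n

/-- The relations between the generators. -/
inductive DayRel (F G : GammaOp ⥤ Type u) (k : GammaOp) : DayGen F G k → DayGen F G k → Prop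
  | mk {m n m' n' : GammaOp} (p : m ⟶ m') (q : n ⟶ n') (g : sm m' n' ⟶ k) (x : F.obj m)
      (y : G.obj n) : DayRel F G k ⟨m, n, tens p q ≫ g, x, y⟩ ⟨m', n', g, F.map p x, G.map q y⟩

/-- The Day convolution of two functors to sets. -/
def Day (F G : GammaOp ⥤ Type u) (k : GammaOp) : Type u := Quot (DayRel F G k)

namespace Day

variable {F G F' G' : GammaOp ⥤ Type u} {k l : GammaOp}

/-- The class of a generator. -/
def mk {m n : GammaOp} (g : sm m n ⟶ k) (x : F.obj m) (y : G.obj n) : Day F G k :=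
  Quot.mk _ ⟨m, n, g, x, y⟩

theorem mk_map {m n m' n' : GammaOp} (p : m ⟶ m') (q : n ⟶ n') (g : sm m' n' ⟶ k) (x : F.obj m)
    (y : G.obj n) : mk g (F.map p x) (G.map q y) = mk (tens p q ≫ g) x y :=
  (Quot.sound (DayRel.mk p q g x y)).symm

theorem ind {p : Day F G k → Prop} (h : ∀ {m n : GammaOp} (g : sm m n ⟶ k) (x : F.obj m)
    (y : G.obj n), p (mk g x y)) (a : Day F G k) : p a := by
  obtain ⟨_, _, g, x, y⟩ := a
  exact h g x y

/-- The function given by a natural family of functions of two variables. -/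
def lift {α : Type*} (e : ∀ {m n : GammaOp}, (sm m n ⟶ k) → F.obj m → G.obj n → α)
    (he : ∀ {m n m' n' : GammaOp} (p : m ⟶ m') (q : n ⟶ n') (g : sm m' n' ⟶ k) (x : F.obj m)
      (y : G.obj n), e (tens p q ≫ g) x y = e g (F.map p x) (G.map q y)) : Day F G k → α :=
  Quot.lift (fun d => e d.g d.x d.y) (by
    rintro _ _ ⟨p, q, g, x, y⟩
    exact he p q g x y)

/-- The functoriality of the Day convolution. -/
def map (φ : F ⟶ F') (ψ : G ⟶ G') (g : k ⟶ l) : Day F G k → Day F' G' l :=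
  lift (fun h x y => mk (h ≫ g) (φ.app _ x) (ψ.app _ y)) fun p q h x y => by
    rw [NatTrans.naturality_apply, NatTrans.naturality_apply, mk_map, Category.assoc]

end Day

/-! ### The categories of the Day convolution, by generators and relations -/

/-- The sets of objects. -/
def obFunctor (X : GammaOp ⥤ BasedCat.{u}) : GammaOp ⥤ Type u where
  obj n := X.obj n
  map g := TypeCat.ofHom fun x => (BasedFunctor.functor (X.map g)).obj x
  map_id n := by
    ext x
    exact congrArg (fun F => (BasedFunctor.functor F).obj x) (X.map_id n)
  map_comp f g := by
    ext x
    exact congrArg (fun F => (BasedFunctor.functor F).obj x) (X.map_comp f g)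

/-- The sets of arrows. -/
def arrFunctor (X : GammaOp ⥤ BasedCat.{u}) : GammaOp ⥤ Type u where
  obj n := El X n
  map g := TypeCat.ofHom fun x => act g x
  map_id n := by
    ext x
    exact act_id x
  map_comp f g := by
    ext x
    exact act_comp f g x

/-- The sources of arrows. -/
def srcNat (X : GammaOp ⥤ BasedCat.{u}) : arrFunctor X ⟶ obFunctor X where
  app n := TypeCat.ofHom (X := El X n) (Y := X.obj n) fun x => x.src
  naturality _ _ _ := rfl

/-- The targets of arrows. -/
def tgtNat (X : GammaOp ⥤ BasedCat.{u}) : arrFunctor X ⟶ obFunctor X where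
  app n := TypeCat.ofHom (X := El X n) (Y := X.obj n) fun x => x.tgt
  naturality _ _ _ := rfl

/-- The identities. -/
def oneNat (X : GammaOp ⥤ BasedCat.{u}) : obFunctor X ⟶ arrFunctor X where
  app n := TypeCat.ofHom (X := X.obj n) (Y := El X n) fun x => Arr.of (𝟙 x)
  naturality m n g := by
    ext x
    exact (isId_act (X := X) g (IsId.mk (C := X.obj m) x)).eq_of.symm

section

variable (X Y : GammaCat.{u})

/-- The composites of arrows of the Day convolution. -/
inductive DayComp (k : GammaOp) : Day (arrFunctor X.functor) (arrFunctor Y.functor) k →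
    Day (arrFunctor X.functor) (arrFunctor Y.functor) k →
    Day (arrFunctor X.functor) (arrFunctor Y.functor) k → Prop
  | mk {m n : GammaOp} (g : sm m n ⟶ k) {x x' x'' : El X.functor m} {y y' y'' : El Y.functor n}
      (h : IsComp x x' x'') (h' : IsComp y y' y'') :
      DayComp k (Day.mk g x y) (Day.mk g x' y') (Day.mk g x'' y'')

/-- The presentation of the categories of the Day convolution. -/
def dayPre (k : GammaOp) : PreCat.{u} where
  O := Day (obFunctor X.functor) (obFunctor Y.functor) k
  A := Day (arrFunctor X.functor) (arrFunctor Y.functor) k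
  src := Day.map (srcNat _) (srcNat _) (𝟙 k)
  tgt := Day.map (tgtNat _) (tgtNat _) (𝟙 k)
  one := Day.map (oneNat _) (oneNat _) (𝟙 k)
  comp := DayComp X Y k
  src_one := Day.ind fun g x y => by
    change Day.mk ((g ≫ 𝟙 k) ≫ 𝟙 k) x y = _
    rw [Category.comp_id, Category.comp_id]
  tgt_one := Day.ind fun g x y => by
    change Day.mk ((g ≫ 𝟙 k) ≫ 𝟙 k) x y = _
    rw [Category.comp_id, Category.comp_id]
  one_comp := Day.ind fun {m n} g (x : El X.functor m) (y : El Y.functor n) => by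
    change DayComp X Y k (Day.mk ((g ≫ 𝟙 k) ≫ 𝟙 k) x.srcId y.srcId) _ _
    rw [Category.comp_id, Category.comp_id]
    exact .mk g (isComp_srcId x) (isComp_srcId y)
  comp_one := Day.ind fun {m n} g (x : El X.functor m) (y : El Y.functor n) => by
    change DayComp X Y k _ (Day.mk ((g ≫ 𝟙 k) ≫ 𝟙 k) x.tgtId y.tgtId) _
    rw [Category.comp_id, Category.comp_id]
    exact .mk g (isComp_tgtId x) (isComp_tgtId y)

/-- The arrow of the Day convolution given by two arrows. -/
def dayArr {k m n : GammaOp} (g : sm m n ⟶ k) (x : El X.functor m) (y : El Y.functor n) :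
    Arr (dayPre X Y k).Cat :=
  PreCat.gen (P := dayPre X Y k) (Day.mk g x y)

variable {X Y}

theorem dayArr_act {k m n m' n' : GammaOp} (p : m ⟶ m') (q : n ⟶ n') (g : sm m' n' ⟶ k)
    (x : El X.functor m) (y : El Y.functor n) :
    dayArr X Y g (act p x) (act q y) = dayArr X Y (tens p q ≫ g) x y :=
  congrArg (PreCat.gen (P := dayPre X Y k))
    (Day.mk_map (F := arrFunctor X.functor) (G := arrFunctor Y.functor) p q g x y)

theorem isId_dayArr {k m n : GammaOp} (g : sm m n ⟶ k) {x : El X.functor m} {y : El Y.functor n}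
    (h : IsId x) (h' : IsId y) : IsId (dayArr X Y g x y) := by
  cases h with
  | mk x =>
    cases h' with
    | mk y =>
      have := PreCat.gen_one (P := dayPre X Y k) (Day.mk g x y)
      change dayArr X Y (g ≫ 𝟙 k) (of (𝟙 x)) (of (𝟙 y)) = _ at this
      rw [Category.comp_id] at this
      rw [this]
      exact .mk _

/-- Matching endpoints in both variables give matching endpoints in the convolution of the sets of
objects, as `PreCat.isComp_gen` requires. -/
theorem isComp_dayArr {k m n : GammaOp} (g : sm m n ⟶ k) {x x' x'' : El X.functor m}
    {y y' y'' : El Y.functor n} (h : IsComp x x' x'') (h' : IsComp y y' y'') :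
    IsComp (dayArr X Y g x y) (dayArr X Y g x' y') (dayArr X Y g x'' y'') := by
  let mk := Day.mk (F := obFunctor X.functor) (G := obFunctor Y.functor) (g ≫ 𝟙 k)
  exact PreCat.isComp_gen (DayComp.mk g h h') (congrArg₂ mk h.mid_eq h'.mid_eq)
    (congrArg₂ mk h.src_eq h'.src_eq) (congrArg₂ mk h.tgt_eq h'.tgt_eq)

theorem dayArr_induction {k : GammaOp} {p : Arr (dayPre X Y k).Cat → Prop}
    (h : ∀ {m n : GammaOp} (g : sm m n ⟶ k) (x : El X.functor m) (y : El Y.functor n),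
      p (dayArr X Y g x y))
    (hcomp : ∀ a b c, IsComp a b c → p a → p b → p c) (a : Arr (dayPre X Y k).Cat) : p a :=
  PreCat.induction (P := dayPre X Y k) (Day.ind h) hcomp a

section desc

variable (X Y) in
/-- The data of a functor out of the Day convolution. -/
structure DayCone (k : GammaOp) (D : Type u) [SmallCategory D] where
  ev : ∀ {m n : GammaOp}, (sm m n ⟶ k) → El X.functor m → El Y.functor n → Arr D
  ev_act : ∀ {m n m' n' : GammaOp} (p : m ⟶ m') (q : n ⟶ n') (g : sm m' n' ⟶ k)
    (x : El X.functor m) (y : El Y.functor n), ev (tens p q ≫ g) x y = ev g (act p x) (act q y)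
  isId : ∀ {m n : GammaOp} (g : sm m n ⟶ k) {x : El X.functor m} {y : El Y.functor n},
    IsId x → IsId y → IsId (ev g x y)
  isComp : ∀ {m n : GammaOp} (g : sm m n ⟶ k) {x x' x'' : El X.functor m}
    {y y' y'' : El Y.functor n}, IsComp x x' x'' → IsComp y y' y'' →
    IsComp (ev g x y) (ev g x' y') (ev g x'' y'')

variable {k : GammaOp} {D : Type u} [SmallCategory D] (e : DayCone X Y k D)

/-- The functor out of the Day convolution given by the images of the generators. -/
def dayDesc : (dayPre X Y k).Cat ⥤ D :=
  PreCat.desc (P := dayPre X Y k)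
    (Day.lift (F := arrFunctor X.functor) (G := arrFunctor Y.functor) e.ev e.ev_act)
    (Day.ind fun g _ _ => e.isId (g ≫ 𝟙 k) (.mk _) (.mk _))
    (by
      rintro _ _ _ ⟨g, h, h'⟩
      exact e.isComp g h h')

theorem map_dayDesc {m n : GammaOp} (g : sm m n ⟶ k) (x : El X.functor m) (y : El Y.functor n) :
    Arr.map (dayDesc e) (dayArr X Y g x y) = e.ev g x y :=
  PreCat.map_desc_gen (P := dayPre X Y k) _ _ _ _

end desc

variable (X Y)

/-- The based categories of the Day convolution. -/
def dayCat (k : GammaOp) : BasedCat.{u} where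
  carrier := (dayPre X Y k).Cat
  base := (dayArr X Y (zero (sm ⟨0⟩ ⟨0⟩) k) (X.functor.obj ⟨0⟩).baseArr
    (Y.functor.obj ⟨0⟩).baseArr).src

variable {X Y}

theorem baseArr_dayCat (k : GammaOp) :
    (dayCat X Y k).baseArr = dayArr X Y (zero (sm ⟨0⟩ ⟨0⟩) k) (X.functor.obj ⟨0⟩).baseArr
      (Y.functor.obj ⟨0⟩).baseArr :=
  (isId_dayArr _ (BasedCat.isId_baseArr _) (BasedCat.isId_baseArr _)).eq_of.symm

theorem dayArr_ext {k : GammaOp} {D : Type u} [SmallCategory D] {F G : (dayPre X Y k).Cat ⥤ D}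
    (h : ∀ {m n : GammaOp} (g : sm m n ⟶ k) (x : El X.functor m) (y : El Y.functor n),
      Arr.map F (dayArr X Y g x y) = Arr.map G (dayArr X Y g x y)) : F = G := by
  refine Arr.functor_ext (dayArr_induction h fun a b c h ha hb => (isComp_map F h).unique ?_)
  rw [ha, hb]
  exact isComp_map G h

theorem dayDesc_base {k : GammaOp} {D : BasedCat.{u}} (e : DayCone X Y k D)
    (h : e.ev (zero (sm ⟨0⟩ ⟨0⟩) k) (X.functor.obj ⟨0⟩).baseArr (Y.functor.obj ⟨0⟩).baseArr =
      D.baseArr) : (dayDesc e).obj (dayCat X Y k).base = D.base := by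
  have h' := (map_dayDesc e _ _ _).trans h
  rw [← baseArr_dayCat] at h'
  exact congrArg Arr.src h'

variable (X Y) in
/-- The images of the generators under `dayMap`. -/
def dayMapCone {k l : GammaOp} (f : k ⟶ l) : DayCone X Y k (dayCat X Y l) where
  ev g x y := dayArr X Y (g ≫ f) x y
  ev_act p q g x y := by rw [dayArr_act, Category.assoc]
  isId g := isId_dayArr (g ≫ f)
  isComp g := isComp_dayArr (g ≫ f)

/-- The action of a map of based sets on the Day convolution. -/
def dayMap {k l : GammaOp} (f : k ⟶ l) : dayCat X Y k ⟶ dayCat X Y l where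
  functor := dayDesc (dayMapCone X Y f)
  obj_base := dayDesc_base (dayMapCone X Y f)
    ((congrArg (dayArr X Y · _ _) (GammaOp.hom_ext fun _ => f.2)).trans (baseArr_dayCat l).symm)

theorem arr_dayMap {k l m n : GammaOp} (f : k ⟶ l) (g : sm m n ⟶ k) (x : El X.functor m)
    (y : El Y.functor n) :
    BasedFunctor.arr (dayMap f) (dayArr X Y g x y) = dayArr X Y (g ≫ f) x y :=
  map_dayDesc (dayMapCone X Y f) g x y

variable (X Y)

/-- The Day convolution of two `Γ`-categories. -/
def day : GammaCat.{u} where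
  functor :=
    { obj := dayCat X Y
      map := dayMap
      map_id := fun k => BasedCat.hom_ext (dayArr_ext fun g x y => by
        refine (arr_dayMap _ _ _ _).trans ?_
        rw [Category.comp_id]
        rfl)
      map_comp := fun f f' => BasedCat.hom_ext (dayArr_ext fun g x y => by
        refine (arr_dayMap _ _ _ _).trans ?_
        refine Eq.trans ?_ (congrArg (BasedFunctor.arr (dayMap f')) (arr_dayMap f g x y)).symm
        rw [arr_dayMap, Category.assoc]) }
  point := by
    have base : ∀ a : Arr (dayCat X Y ⟨0⟩), a = (dayCat X Y ⟨0⟩).baseArr := by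
      refine dayArr_induction (fun {m n} g x y => ?_) fun a b c h ha hb => ?_
      -- A map to `⟨0⟩` factors through the zero maps of both variables, which replace `x` and `y`
      -- by the base arrows of `X(0)` and `Y(0)`.
      · rw [baseArr_dayCat, ← X.point.eq_base (act (zero m ⟨0⟩) x),
          ← Y.point.eq_base (act (zero n ⟨0⟩) y), dayArr_act]
        exact congrArg (dayArr X Y · x y) (hom_zero_ext _ _)
      · subst ha hb
        exact h.unique (BasedCat.isId_baseArr (dayCat X Y ⟨0⟩)).isComp
    exact BasedCat.isPoint_of_arr base

variable {X Y}

/-! ### The universal property of the Day convolution -/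

/-- The universal bilinear map. -/
def box {m n : GammaOp} (x : El X.functor m) (y : El Y.functor n) :
    El (day X Y).functor (sm m n) := dayArr X Y (𝟙 _) x y

theorem act_box {k m n : GammaOp} (g : sm m n ⟶ k) (x : El X.functor m) (y : El Y.functor n) :
    act g (box x y) = dayArr X Y g x y :=
  (arr_dayMap g (𝟙 _) x y).trans (by rw [Category.id_comp])

theorem box_act_act {m n m' n' : GammaOp} (p : m ⟶ m') (q : n ⟶ n') (x : El X.functor m)
    (y : El Y.functor n) : box (act p x) (act q y) = act (tens p q) (box x y) := by
  rw [act_box]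
  exact (dayArr_act _ _ _ _ _).trans (by rw [Category.comp_id])

theorem isId_box {m n : GammaOp} {x : El X.functor m} {y : El Y.functor n} (h : IsId x)
    (h' : IsId y) : IsId (box x y) := isId_dayArr _ h h'

theorem isComp_box {m n : GammaOp} {x x' x'' : El X.functor m} {y y' y'' : El Y.functor n}
    (h : IsComp x x' x'') (h' : IsComp y y' y'') : IsComp (box x y) (box x' y') (box x'' y'') :=
  isComp_dayArr _ h h'

/-- The base arrow comes from `X(0)`, so the box comes from the level `sm ⟨0⟩ n`, which is a point.
The hyperplanes collapse without any relation being imposed. -/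
theorem box_base_left {m n : GammaOp} (y : El Y.functor n) :
    box (X.functor.obj m).baseArr y = ((day X Y).functor.obj (sm m n)).baseArr := by
  rw [← act_base (X := X.functor) (zero ⟨0⟩ m), ← act_id y, box_act_act]
  exact (congrArg (act _) (El.eq_base (Nat.zero_mul _) _)).trans (act_base _)

theorem box_base_right {m n : GammaOp} (x : El X.functor m) :
    box x (Y.functor.obj n).baseArr = ((day X Y).functor.obj (sm m n)).baseArr := by
  rw [← act_base (X := Y.functor) (zero ⟨0⟩ n), ← act_id x, box_act_act]
  exact (congrArg (act _) (El.eq_base (Nat.mul_zero _) _)).trans (act_base _)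

variable (X Y) in
/-- The universal bilinear map. -/
def boxBi : BiMor X Y (day X Y).functor where
  ev := box
  isId := isId_box
  isComp := isComp_box
  base_left := box_base_left
  base_right := box_base_right
  act_act := box_act_act

/-- Closure under composition is part of the hypotheses because a composite of generators need not
be a generator. -/
theorem day_induction {p : ∀ {k : GammaOp}, El (day X Y).functor k → Prop}
    (hbox : ∀ {m n : GammaOp} (x : El X.functor m) (y : El Y.functor n), p (box x y))
    (hact : ∀ {k l : GammaOp} (g : k ⟶ l) (a : El (day X Y).functor k), p a → p (act g a))
    (hcomp : ∀ {k : GammaOp} (a b c : El (day X Y).functor k), IsComp a b c → p a → p b → p c)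
    {k : GammaOp} (a : El (day X Y).functor k) : p a :=
  dayArr_induction (fun g x y => act_box g x y ▸ hact g _ (hbox x y)) hcomp a

/-- The data of the components of `BiMor.desc`. -/
def BiMor.cone {Z : GammaOp ⥤ BasedCat.{u}} (B : BiMor X Y Z) (k : GammaOp) :
    DayCone X Y k (Z.obj k) where
  ev g x y := act g (B.ev x y)
  ev_act p q g x y := by rw [B.act_act, act_comp]
  isId g _ _ h h' := isId_act g (B.isId h h')
  isComp g _ _ _ _ _ _ h h' := isComp_act g (B.isComp h h')

/-- The natural transformation that corresponds to a bilinear map. -/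
def BiMor.desc {Z : GammaOp ⥤ BasedCat.{u}} (B : BiMor X Y Z) : (day X Y).functor ⟶ Z where
  app k :=
    { functor := dayDesc (B.cone k)
      obj_base := dayDesc_base _ ((congrArg (act _) (B.base_left _)).trans (act_base _)) }
  naturality k l f := BasedCat.hom_ext (dayArr_ext fun g x y => by
    refine (congrArg (Arr.map _) (arr_dayMap f g x y)).trans ((map_dayDesc (B.cone l) _ _ _).trans ?_)
    exact (act_comp g f _).trans (congrArg (act f) (map_dayDesc (B.cone k) _ _ _).symm))

@[simp] theorem BiMor.ap_desc_box {Z : GammaOp ⥤ BasedCat.{u}} (B : BiMor X Y Z) {m n : GammaOp}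
    (x : El X.functor m) (y : El Y.functor n) : ap B.desc (box x y) = B.ev x y :=
  (map_dayDesc (B.cone _) _ _ _).trans (act_id _)

theorem day_ext {Z : GammaOp ⥤ BasedCat.{u}} {f g : (day X Y).functor ⟶ Z}
    (h : ∀ {m n : GammaOp} (x : El X.functor m) (y : El Y.functor n),
      ap f (box x y) = ap g (box x y)) : f = g :=
  ap_ext fun _ => day_induction h (fun p a ha => by rw [ap_act, ap_act, ha])
    fun a b c h ha hb => (isComp_ap f h).unique (by rw [ha, hb]; exact isComp_ap g h)

end

/-! ### The symmetric monoidal structure -/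

section Monoidal

variable {X Y Z W X' Y' Z' : GammaCat.{u}}

/-- The action of a map of `Γ`-categories on arrows. -/
def gap (f : X ⟶ Y) {n : GammaOp} (x : El X.functor n) : El Y.functor n :=
  ap (X := X.functor) (Y := Y.functor) f x

@[simp] theorem gap_id {n : GammaOp} (x : El X.functor n) : gap (𝟙 X) x = x := (rfl)

@[simp] theorem gap_comp (f : X ⟶ Y) (g : Y ⟶ Z) {n : GammaOp} (x : El X.functor n) :
    gap (f ≫ g) x = gap g (gap f x) := (rfl)

@[simp] theorem gap_act (f : X ⟶ Y) {m n : GammaOp} (g : m ⟶ n) (x : El X.functor m) :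
    gap f (act g x) = act g (gap f x) := ap_act (X := X.functor) (Y := Y.functor) f g x

theorem isId_gap (f : X ⟶ Y) {n : GammaOp} {x : El X.functor n} (h : IsId x) : IsId (gap f x) :=
  BasedFunctor.isId_arr _ h

theorem isComp_gap (f : X ⟶ Y) {n : GammaOp} {x y z : El X.functor n} (h : IsComp x y z) :
    IsComp (gap f x) (gap f y) (gap f z) := BasedFunctor.isComp_arr _ h

@[simp] theorem gap_base (f : X ⟶ Y) (n : GammaOp) :
    gap f (X.functor.obj n).baseArr = (Y.functor.obj n).baseArr :=
  BasedFunctor.arr_base _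

theorem gap_ext {f g : X ⟶ Y} (h : ∀ n (x : El X.functor n), gap f x = gap g x) : f = g :=
  ap_ext h

/-- The map of `Γ`-categories that corresponds to a bilinear map. -/
def BiMor.hom (B : BiMor X Y Z.functor) : day X Y ⟶ Z := B.desc

@[simp] theorem BiMor.gap_hom_box (B : BiMor X Y Z.functor) {m n : GammaOp} (x : El X.functor m)
    (y : El Y.functor n) : gap B.hom (box x y) = B.ev x y := B.ap_desc_box x y

theorem hom_ext_box {f g : day X Y ⟶ Z}
    (h : ∀ {m n : GammaOp} (x : El X.functor m) (y : El Y.functor n),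
      gap f (box x y) = gap g (box x y)) : f = g :=
  day_ext (X := X) (Y := Y) (Z := Z.functor) h

/-- An arrow of `day X Y` is in general a composite, so the first factor is treated by
`day_induction`, uniformly in `z`. If `c` is the composite of `a` and `b`, then `box c z` is the
composite of `box a z` with the box of `b` and an identity. -/
theorem hom_ext_box_box {f g : day (day X Y) Z ⟶ W}
    (h : ∀ {l m n : GammaOp} (x : El X.functor l) (y : El Y.functor m) (z : El Z.functor n),
      gap f (box (box x y) z) = gap g (box (box x y) z)) : f = g := by
  refine hom_ext_box fun {k n} t z => ?_
  revert n
  refine day_induction (p := fun {k} t => ∀ {n} (z : El Z.functor n),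
    gap f (box t z) = gap g (box t z)) (fun {_ _} x y {_} z => h x y z)
    (fun {_ _} p a ha {_} z => ?_) (fun {_} a b c hc ha hb {_} z => ?_) t
  · rw [← act_id z, box_act_act, gap_act, gap_act, ha]
  · refine (isComp_gap f (isComp_box hc (isComp_tgtId z))).unique ?_
    rw [ha, hb]
    exact isComp_gap g (isComp_box hc (isComp_tgtId z))

theorem hom_ext_box_box_right {f g : day X (day Y Z) ⟶ W}
    (h : ∀ {l m n : GammaOp} (x : El X.functor l) (y : El Y.functor m) (z : El Z.functor n),
      gap f (box x (box y z)) = gap g (box x (box y z))) : f = g := by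
  refine hom_ext_box fun {m k} x t => ?_
  revert m
  refine day_induction (p := fun {k} t => ∀ {m} (x : El X.functor m),
    gap f (box x t) = gap g (box x t)) (fun {_ _} y z {_} x => h x y z)
    (fun {_ _} p a ha {_} x => ?_) (fun {_} a b c hc ha hb {_} x => ?_) t
  · rw [← act_id x, box_act_act, gap_act, gap_act, ha]
  · refine (isComp_gap f (isComp_box (isComp_tgtId x) hc)).unique ?_
    rw [ha, hb]
    exact isComp_gap g (isComp_box (isComp_tgtId x) hc)

theorem hom_ext_box_box_box {V : GammaCat.{u}} {f g : day (day (day X Y) Z) W ⟶ V}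
    (h : ∀ {k l m n : GammaOp} (x : El X.functor k) (y : El Y.functor l) (z : El Z.functor m)
      (w : El W.functor n),
      gap f (box (box (box x y) z) w) = gap g (box (box (box x y) z) w)) : f = g := by
  refine hom_ext_box_box fun {k m n} t z w => ?_
  revert m n
  refine day_induction (p := fun {k} t => ∀ {m n} (z : El Z.functor m) (w : El W.functor n),
    gap f (box (box t z) w) = gap g (box (box t z) w))
    (fun {_ _} x y {_ _} z w => h x y z w) (fun {_ _} p a ha {_ _} z w => ?_)
    (fun {_} a b c hc ha hb {_ _} z w => ?_) t
  · rw [← act_id z, ← act_id w, box_act_act, box_act_act, gap_act, gap_act, ha]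
  · refine (isComp_gap f (isComp_box (isComp_box hc (isComp_tgtId z)) (isComp_tgtId w))).unique ?_
    rw [ha, hb]
    exact isComp_gap g (isComp_box (isComp_box hc (isComp_tgtId z)) (isComp_tgtId w))

theorem box_act_left {l m n : GammaOp} (p : l ⟶ m) (x : El X.functor l) (y : El Y.functor n) :
    box (act p x) y = act (tens p (𝟙 n)) (box x y) := (boxBi X Y).act_left p x y

theorem box_act_right {l m n : GammaOp} (p : m ⟶ n) (x : El X.functor l) (y : El Y.functor m) :
    box x (act p y) = act (tens (𝟙 l) p) (box x y) := (boxBi X Y).act_right p x y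

theorem act_act {k l m : GammaOp} (f : k ⟶ l) (g : l ⟶ m) (x : El X.functor k) :
    act g (act f x) = act (f ≫ g) x := (act_comp f g x).symm

/-- The functoriality of the tensor product. -/
def dayHom (f : X ⟶ X') (g : Y ⟶ Y') : day X Y ⟶ day X' Y' :=
  BiMor.hom
    { ev := fun x y => box (gap f x) (gap g y)
      isId := fun h h' => isId_box (isId_gap f h) (isId_gap g h')
      isComp := fun h h' => isComp_box (isComp_gap f h) (isComp_gap g h')
      base_left := fun y => by rw [gap_base, box_base_left]
      base_right := fun x => by rw [gap_base, box_base_right]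
      act_act := fun p q x y => by rw [gap_act, gap_act, box_act_act] }

@[simp] theorem gap_dayHom (f : X ⟶ X') (g : Y ⟶ Y') {m n : GammaOp} (x : El X.functor m)
    (y : El Y.functor n) : gap (dayHom f g) (box x y) = box (gap f x) (gap g y) :=
  BiMor.gap_hom_box _ _ _

variable (X Y Z)

/-- The symmetry. -/
def swapHom : day X Y ⟶ day Y X :=
  BiMor.hom
    { ev := fun {m n} x y => act (swp n m) (box y x)
      isId := fun h h' => isId_act _ (isId_box h' h)
      isComp := fun h h' => isComp_act _ (isComp_box h' h)
      base_left := fun y => by rw [box_base_right, act_base]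
      base_right := fun x => by rw [box_base_left, act_base]
      act_act := fun p q x y => by
        rw [box_act_act, act_act, act_act]
        exact congrArg (act · _) (sm_ext fun s t => by simp) }

@[simp] theorem gap_swapHom {m n : GammaOp} (x : El X.functor m) (y : El Y.functor n) :
    gap (swapHom X Y) (box x y) = act (swp n m) (box y x) := BiMor.gap_hom_box _ _ _

variable {X Y Z}

/-- The arrow of the tensor product of three factors given by three arrows. -/
def box₃ {l m n : GammaOp} (x : El X.functor l) (y : El Y.functor m) (z : El Z.functor n) :
    El (day X (day Y Z)).functor (sm (sm l m) n) := act (cas l m n) (box x (box y z))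

theorem isId_box₃ {l m n : GammaOp} {x : El X.functor l} {y : El Y.functor m} {z : El Z.functor n}
    (h : IsId x) (h' : IsId y) (h'' : IsId z) : IsId (box₃ x y z) :=
  isId_act _ (isId_box h (isId_box h' h''))

theorem isComp_box₃ {l m n : GammaOp} {x₁ x₂ x₃ : El X.functor l} {y₁ y₂ y₃ : El Y.functor m}
    {z₁ z₂ z₃ : El Z.functor n} (h : IsComp x₁ x₂ x₃) (h' : IsComp y₁ y₂ y₃)
    (h'' : IsComp z₁ z₂ z₃) : IsComp (box₃ x₁ y₁ z₁) (box₃ x₂ y₂ z₂) (box₃ x₃ y₃ z₃) :=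
  isComp_act _ (isComp_box h (isComp_box h' h''))

theorem box₃_act {l m n l' m' n' : GammaOp} (p : l ⟶ l') (q : m ⟶ m') (r : n ⟶ n')
    (x : El X.functor l) (y : El Y.functor m) (z : El Z.functor n) :
    box₃ (act p x) (act q y) (act r z) = act (tens (tens p q) r) (box₃ x y z) := by
  unfold box₃
  rw [box_act_act, box_act_act, act_act, act_act]
  exact congrArg (act · _) (sm_ext_right fun s t u => by simp)

theorem box₃_base₁ {l m n : GammaOp} (y : El Y.functor m) (z : El Z.functor n) :
    box₃ (X.functor.obj l).baseArr y z = ((day X (day Y Z)).functor.obj _).baseArr := by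
  rw [box₃, box_base_left, act_base]

theorem box₃_base₂ {l m n : GammaOp} (x : El X.functor l) (z : El Z.functor n) :
    box₃ x (Y.functor.obj m).baseArr z = ((day X (day Y Z)).functor.obj _).baseArr := by
  rw [box₃, box_base_left, box_base_right, act_base]

theorem box₃_base₃ {l m n : GammaOp} (x : El X.functor l) (y : El Y.functor m) :
    box₃ x y (Z.functor.obj n).baseArr = ((day X (day Y Z)).functor.obj _).baseArr := by
  rw [box₃, box_base_right, box_base_right, act_base]

theorem box₃_act_last {l m n n' : GammaOp} (r : n ⟶ n') (x : El X.functor l) (y : El Y.functor m)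
    (z : El Z.functor n) : box₃ x y (act r z) = act (tens (𝟙 _) r) (box₃ x y z) := by
  have := box₃_act (𝟙 l) (𝟙 m) r x y z
  rwa [act_id, act_id, tens_id] at this

variable (X Y Z)

/-- The trilinear map `box₃`, as a bilinear map to an internal hom object. -/
def curryBox₃ : BiMor X Y (ihom Z (day X (day Y Z))).functor where
  -- An arrow of the internal hom is a transformation. The functors at its ends are given by the
  -- identities at the sources and at the targets of `x` and `y`.
  ev x y := homArr (fun z => box₃ x.srcId y.srcId z) (fun z => box₃ x y z)
    (fun z => box₃ x.tgtId y.tgtId z)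
    (fun h => isId_box₃ (isId_srcId x) (isId_srcId y) h)
    (fun h => isId_box₃ (isId_tgtId x) (isId_tgtId y) h)
    (fun h => isComp_box₃ (isId_srcId x).isComp (isId_srcId y).isComp h)
    (fun h => isComp_box₃ (isComp_srcId x) (isComp_srcId y) h)
    (fun h => isComp_box₃ (isComp_tgtId x) (isComp_tgtId y) h)
    (fun h => isComp_box₃ (isId_tgtId x).isComp (isId_tgtId y).isComp h)
    (fun _ => box₃_base₃ _ _) (fun _ => box₃_base₃ _ _) (fun _ => box₃_base₃ _ _)
    (fun r z => box₃_act_last r _ _ z) (fun r z => box₃_act_last r _ _ z)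
    (fun r z => box₃_act_last r _ _ z)
  isId {_ _ x y} h h' := isId_of_hev
    (fun z => congrArg₂ (box₃ · · z) h.srcId_eq.symm h'.srcId_eq.symm)
    (fun z => congrArg₂ (box₃ · · z) h.tgtId_eq.symm h'.tgtId_eq.symm)
  isComp h h' := isComp_of_hev
    (HomObj.ext fun z => congrArg₂ (box₃ · · z) h.midId_eq h'.midId_eq)
    (HomObj.ext fun z => congrArg₂ (box₃ · · z) h.srcId_eq h'.srcId_eq)
    (HomObj.ext fun z => congrArg₂ (box₃ · · z) h.tgtId_eq h'.tgtId_eq)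
    fun z => isComp_box₃ h h' (isComp_tgtId z)
  base_left y := ihom_ext (fun z => box₃_base₁ _ z) (fun z => box₃_base₁ _ z)
    fun z => box₃_base₁ _ z
  base_right x := ihom_ext (fun z => box₃_base₂ _ z) (fun z => box₃_base₂ _ z)
    fun z => box₃_base₂ _ z
  act_act p q x y := by
    have key : ∀ (x : El X.functor _) (y : El Y.functor _) {n : GammaOp} (z : El Z.functor n),
        box₃ (act p x) (act q y) z = act (tens (tens p q) (𝟙 n)) (box₃ x y z) := fun x y n z => by
      rw [← box₃_act, act_id]
    refine ihom_ext (fun z => ?_) (fun z => ?_) fun z => key x y z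
    · exact (congrArg₂ (box₃ · · z) (isId_act p (isId_srcId x)).eq_of.symm
        (isId_act q (isId_srcId y)).eq_of.symm).trans (key _ _ z)
    · exact (congrArg₂ (box₃ · · z) (isId_act p (isId_tgtId x)).tgtId_eq
        (isId_act q (isId_tgtId y)).tgtId_eq).trans (key _ _ z)

/-- The associativity of the tensor product. -/
def assocHom : day (day X Y) Z ⟶ day X (day Y Z) := (uncurry (curryBox₃ X Y Z).desc).hom

@[simp] theorem gap_assocHom {l m n : GammaOp} (x : El X.functor l) (y : El Y.functor m)
    (z : El Z.functor n) :
    gap (assocHom X Y Z) (box (box x y) z) = act (cas l m n) (box x (box y z)) := by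
  refine (BiMor.gap_hom_box _ _ _).trans ?_
  exact congrArg (hev · z) ((curryBox₃ X Y Z).ap_desc_box x y)

/-- The inverse of `assocHom`. -/
def assocInv : day X (day Y Z) ⟶ day (day X Y) Z :=
  swapHom X (day Y Z) ≫ dayHom (swapHom Y Z) (𝟙 X) ≫ assocHom Z Y X ≫
    dayHom (𝟙 Z) (swapHom Y X) ≫ swapHom Z (day X Y)

-- The symmetries reverse the order of the three factors, so the associativity of the reversed
-- product provides the inverse and no second currying is needed.
@[simp] theorem gap_assocInv {l m n : GammaOp} (x : El X.functor l) (y : El Y.functor m)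
    (z : El Z.functor n) :
    gap (assocInv X Y Z) (box x (box y z)) = act (asc l m n) (box (box x y) z) := by
  simp only [assocInv, gap_comp, gap_swapHom, gap_act, gap_dayHom, box_act_left, box_act_right,
    gap_assocHom, gap_id, act_act]
  exact congrArg (act · _) (sm_ext_left fun s t u => by simp)

/-! #### The unit -/

/-- The unit: the discrete categories of the based sets `{0, …, n}`. -/
def unitGamma : GammaCat.{u} where
  functor :=
    { obj := fun n => { carrier := Discrete (ULift.{u} n.toSet), base := ⟨⟨none⟩⟩ }
      map := fun g =>
        { functor := Discrete.functor fun i => ⟨⟨g.1 i.down⟩⟩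
          obj_base := congrArg (fun i => (⟨⟨i⟩⟩ : Discrete (ULift.{u} _))) g.2 }
      map_id := fun n => BasedCat.hom_ext (CategoryTheory.Functor.hext (fun _ => rfl)
        fun _ _ _ => heq_of_eq (Subsingleton.elim _ _))
      map_comp := fun f g => BasedCat.hom_ext (CategoryTheory.Functor.hext (fun _ => rfl)
        fun _ _ _ => heq_of_eq (Subsingleton.elim _ _)) }
  point := by
    refine ⟨?_, fun _ => Subsingleton.elim _ _⟩
    rintro ⟨⟨_ | i⟩⟩
    · rfl
    · exact i.elim0

/-- The arrow of the unit given by an element. -/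
def el {n : GammaOp} (i : n.toSet) : El unitGamma.{u}.functor n :=
  Arr.of (C := Discrete (ULift.{u} n.toSet)) (𝟙 ⟨⟨i⟩⟩)

/-- The element given by an arrow of the unit. -/
def un {n : GammaOp} (a : El unitGamma.{u}.functor n) : n.toSet := a.src.as.down

@[simp] theorem el_un {n : GammaOp} (a : El unitGamma.{u}.functor n) : el (un a) = a := by
  obtain ⟨⟨⟨i⟩⟩, ⟨⟨j⟩⟩, f⟩ := a
  obtain rfl : i = j := congrArg ULift.down (Discrete.eq_of_hom f)
  rfl

theorem exists_el {n : GammaOp} (a : El unitGamma.{u}.functor n) : ∃ i, a = el i :=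
  ⟨un a, (el_un a).symm⟩

theorem un_act {m n : GammaOp} (g : m ⟶ n) (a : El unitGamma.{u}.functor m) :
    un (act g a) = g.1 (un a) := rfl

@[simp] theorem act_el {m n : GammaOp} (g : m ⟶ n) (i : m.toSet) :
    act g (el.{u} i) = el (g.1 i) := (el_un _).symm

theorem isId_el {n : GammaOp} (i : n.toSet) : IsId (el.{u} i) := .mk _

/-- The categories of the unit are discrete, so all three arrows are one identity. -/
theorem IsComp.un_eq {n : GammaOp} {a b c : El unitGamma.{u}.functor n} (h : IsComp a b c) :
    a = c ∧ b = c := by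
  have h₁ : un c = un a := congrArg (fun x : Discrete (ULift.{u} n.toSet) => x.as.down) h.src_eq
  have hc : c = a := by rw [← el_un c, h₁, el_un]
  refine ⟨hc.symm, ?_⟩
  have ha : IsId a := el_un a ▸ isId_el _
  subst hc
  exact (h.unique (by have := isComp_srcId b; rwa [← h.midId_eq, ha.tgtId_eq] at this)).symm

/-- The left unit isomorphism. -/
def lunitHom : day unitGamma.{u} X ⟶ X :=
  BiMor.hom
    { ev := fun {_ n} a x => act (ins (un a) n) x
      isId := fun _ h => isId_act _ h
      isComp := fun h h' => by
        rw [(IsComp.un_eq h).1, (IsComp.un_eq h).2]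
        exact isComp_act _ h'
      -- At the base point `ins` is the zero map.
      base_left := fun {m n} x => act_zero x
      base_right := fun a => act_base _
      act_act := fun p q a x => by
        rw [un_act, act_act, act_act]
        exact congrArg (act · _) (Subtype.ext (funext fun t => by simp)) }

@[simp] theorem gap_lunitHom {m n : GammaOp} (i : m.toSet) (x : El X.functor n) :
    gap (lunitHom X) (box (el i) x) = act (ins i n) x := BiMor.gap_hom_box _ _ _

/-- The inverse of `lunitHom`. -/
def lunitInv : X ⟶ day unitGamma.{u} X :=
  ArrNat.hom (X := X.functor)
    { ev := fun {n} x => act (lun n) (box (el star) x)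
      isId := fun x h => isId_act _ (isId_box (isId_el _) h)
      isComp := fun x y z h => isComp_act _ (isComp_box (isId_el _).isComp h)
      base := fun n => by rw [box_base_right, act_base]
      act := fun g x => by
        rw [box_act_right, act_act, act_act]
        exact congrArg (act · _) (lun_naturality g) }

@[simp] theorem gap_lunitInv {n : GammaOp} (x : El X.functor n) :
    gap (lunitInv X) x = act (lun n) (box (el star) x) := ArrNat.ap_hom (X := X.functor) _ _

variable {X Y} in
theorem hom_ext_unit_box {f g : day unitGamma.{u} X ⟶ Y}
    (h : ∀ {m n : GammaOp} (i : m.toSet) (x : El X.functor n),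
      gap f (box (el i) x) = gap g (box (el i) x)) : f = g :=
  hom_ext_box fun a x => by
    rw [← el_un a]
    exact h _ x

theorem lunitHom_lunitInv : lunitHom X ≫ lunitInv X = 𝟙 _ :=
  hom_ext_unit_box fun {m n} i x => by
    -- Every element `i` is the image of `star` under `pt i`, so one arrow generates the unit.
    have h : box (el i) x = act (tens (pt i) (𝟙 n)) (box (el star) x) := by
      rw [← box_act_left, act_el, pt_star]
    rw [gap_comp, gap_lunitHom, gap_act, gap_lunitInv, gap_id, h, act_act]
    exact congrArg (act · _) (lun_ext fun t => by simp)

theorem lunitInv_lunitHom : lunitInv X ≫ lunitHom X = 𝟙 _ :=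
  gap_ext fun n x => by
    rw [gap_comp, gap_lunitInv, gap_act, gap_lunitHom, act_act]
    refine Eq.trans (congrArg (act · _) ?_) (act_id x)
    exact Subtype.ext (funext fun t => by simp)

theorem swapHom_swapHom : swapHom X Y ≫ swapHom Y X = 𝟙 _ :=
  hom_ext_box fun {m n} x y => by
    rw [gap_comp, gap_swapHom, gap_act, gap_swapHom, act_act]
    exact (congrArg (act · _) (sm_ext fun s t => by simp)).trans (act_id _)

theorem assocHom_assocInv : assocHom X Y Z ≫ assocInv X Y Z = 𝟙 _ :=
  hom_ext_box_box fun x y z => by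
    rw [gap_comp, gap_assocHom, gap_act, gap_assocInv, act_act]
    exact (congrArg (act · _) (sm_ext_left fun s t u => by simp)).trans (act_id _)

theorem assocInv_assocHom : assocInv X Y Z ≫ assocHom X Y Z = 𝟙 _ :=
  hom_ext_box_box_right fun x y z => by
    rw [gap_comp, gap_assocInv, gap_act, gap_assocHom, act_act]
    exact (congrArg (act · _) (sm_ext_right fun s t u => by simp)).trans (act_id _)

/-- The symmetry. -/
def swapIso : day X Y ≅ day Y X where
  hom := swapHom X Y
  inv := swapHom Y X
  hom_inv_id := swapHom_swapHom X Y
  inv_hom_id := swapHom_swapHom Y X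

/-- The left unit isomorphism. -/
def lunitIso : day unitGamma.{u} X ≅ X where
  hom := lunitHom X
  inv := lunitInv X
  hom_inv_id := lunitHom_lunitInv X
  inv_hom_id := lunitInv_lunitHom X

/-- The data of the monoidal structure given by Day convolution. -/
abbrev dayMonoidalStruct : MonoidalCategoryStruct GammaCat.{u} where
  tensorObj := day
  whiskerLeft X _ _ f := dayHom (𝟙 X) f
  whiskerRight f Y := dayHom f (𝟙 Y)
  tensorHom := dayHom
  tensorUnit := unitGamma
  associator X Y Z := ⟨assocHom X Y Z, assocInv X Y Z, assocHom_assocInv X Y Z, assocInv_assocHom X Y Z⟩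
  leftUnitor := lunitIso
  rightUnitor X := swapIso X unitGamma ≪≫ lunitIso X

theorem dayHom_id : dayHom (𝟙 X) (𝟙 Y) = 𝟙 (day X Y) :=
  hom_ext_box fun x y => gap_dayHom (𝟙 X) (𝟙 Y) x y

variable {X Y Z} in
theorem dayHom_comp {X'' Y'' : GammaCat.{u}} (f₁ : X ⟶ X') (f₂ : Y ⟶ Y') (g₁ : X' ⟶ X'')
    (g₂ : Y' ⟶ Y'') : dayHom f₁ f₂ ≫ dayHom g₁ g₂ = dayHom (f₁ ≫ g₁) (f₂ ≫ g₂) :=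
  hom_ext_box fun x y => by simp

variable {X Y Z} in
theorem assocHom_naturality (f : X ⟶ X') (g : Y ⟶ Y') (h : Z ⟶ Z') :
    dayHom (dayHom f g) h ≫ assocHom X' Y' Z' = assocHom X Y Z ≫ dayHom f (dayHom g h) :=
  hom_ext_box_box fun x y z => by simp

variable {X Y} in
theorem lunitHom_naturality (f : X ⟶ Y) :
    dayHom (𝟙 unitGamma) f ≫ lunitHom Y = lunitHom X ≫ f :=
  hom_ext_unit_box fun i x => by simp

variable {X Y Z} in
theorem swapHom_naturality (f : X ⟶ X') (g : Y ⟶ Y') :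
    dayHom f g ≫ swapHom X' Y' = swapHom X Y ≫ dayHom g f :=
  hom_ext_box fun x y => by simp

/-- Both composites send a fourfold box to the rebracketed box, moved by a map of based sets; the
two maps agree on iterated pairs. The triangle and the hexagons reduce to based sets in the same
way. -/
theorem assocHom_pentagon : dayHom (assocHom W X Y) (𝟙 Z) ≫ assocHom W (day X Y) Z ≫
    dayHom (𝟙 W) (assocHom X Y Z) = assocHom (day W X) Y Z ≫ assocHom W X (day Y Z) := by
  refine hom_ext_box_box_box fun w x y z => ?_
  simp only [gap_comp, gap_dayHom, gap_assocHom, box_act_left, gap_act, box_act_right, gap_id,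
    act_act]
  exact congrArg (act · _) (sm_ext_right_right fun s t u v => by simp)

theorem assocHom_triangle : assocHom X unitGamma Y ≫ dayHom (𝟙 X) (lunitHom Y) =
    dayHom (swapHom X unitGamma ≫ lunitHom X) (𝟙 Y) := by
  refine hom_ext_box_box fun x a y => ?_
  obtain ⟨i, rfl⟩ := exists_el a
  simp only [gap_comp, gap_dayHom, gap_assocHom, gap_act, gap_lunitHom, gap_swapHom, gap_id,
    box_act_left, box_act_right, act_act]
  exact congrArg (act · _) (sm_ext fun s t => by simp)

theorem swapHom_hexagon : assocHom X Y Z ≫ swapHom X (day Y Z) ≫ assocHom Y Z X =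
    dayHom (swapHom X Y) (𝟙 Z) ≫ assocHom Y X Z ≫ dayHom (𝟙 Y) (swapHom X Z) := by
  refine hom_ext_box_box fun x y z => ?_
  simp only [gap_comp, gap_dayHom, gap_assocHom, gap_act, gap_swapHom, gap_id, box_act_left,
    box_act_right, act_act]
  exact congrArg (act · _) (sm_ext_right fun s t u => by simp)

theorem swapHom_hexagon_inv : assocInv X Y Z ≫ swapHom (day X Y) Z ≫ assocInv Z X Y =
    dayHom (𝟙 X) (swapHom Y Z) ≫ assocInv X Z Y ≫ dayHom (swapHom X Z) (𝟙 Y) := by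
  refine hom_ext_box_box_right fun x y z => ?_
  simp only [gap_comp, gap_dayHom, gap_assocInv, gap_act, gap_swapHom, gap_id, box_act_left,
    box_act_right, act_act]
  exact congrArg (act · _) (sm_ext_left fun s t u => by simp)

attribute [local instance] dayMonoidalStruct in
/-- The monoidal structure given by Day convolution. -/
abbrev dayMonoidal : MonoidalCategory GammaCat.{u} := MonoidalCategory.ofTensorHom
  (id_tensorHom_id := dayHom_id)
  (id_tensorHom := fun _ _ _ _ => rfl)
  (tensorHom_id := fun _ _ => rfl)
  (tensorHom_comp_tensorHom := dayHom_comp)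
  (associator_naturality := assocHom_naturality)
  (leftUnitor_naturality := lunitHom_naturality)
  -- The right unit isomorphism is the symmetry followed by the left one, so its naturality is
  -- pasted from theirs.
  (rightUnitor_naturality := fun {X Y} f =>
    (Category.assoc _ _ _).symm.trans ((congrArg (· ≫ lunitHom Y) (swapHom_naturality f (𝟙 _))).trans
      ((Category.assoc _ _ _).trans ((congrArg (swapHom X _ ≫ ·) (lunitHom_naturality f)).trans
        (Category.assoc _ _ _).symm))))
  (pentagon := fun _ X Y Z => assocHom_pentagon X Y Z)
  (triangle := assocHom_triangle)

attribute [local instance] dayMonoidal in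
/-- The symmetric structure given by Day convolution. -/
abbrev daySymmetric : SymmetricCategory GammaCat.{u} where
  braiding := swapIso
  braiding_naturality_right X _ _ f := swapHom_naturality (𝟙 X) f
  braiding_naturality_left f Z := swapHom_naturality f (𝟙 Z)
  hexagon_forward := swapHom_hexagon
  hexagon_reverse := swapHom_hexagon_inv
  symmetry X Y := swapHom_swapHom X Y

end Monoidal

/-! ### The value of the operations on arrows -/

section Values

/-- The value of a reindexed morphism. -/
theorem ev_reindex {m n : ℕ} (σ : Fin m ≃ Fin n) {x' : Fin m → GammaCat.{u}}
    {x : Fin n → GammaCat.{u}} {y : GammaCat.{u}} (h : ∀ i, x' i = x (σ i)) (f : GMor x y.functor)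
    {l' : Fin m → GammaOp} {l : Fin n → GammaOp} {k : GammaOp} {θ' : PMap l' k} {θ : PMap l k}
    {a' : ∀ i, El (x' i).functor (l' i)} {a : ∀ i, El (x i).functor (l i)}
    (hl : ∀ i, l' i = l (σ i)) (ha : ∀ i, HEq (a' i) (a (σ i)))
    (hθ : ∀ t' t, (∀ i, HEq (t' i) (t (σ i))) → θ'.toFun t' = θ.toFun t) :
    (gOps.reindex σ h f).ev θ' a' = f.ev θ a := by
  obtain rfl : x' = fun i => x (σ i) := funext h
  exact GMor.ev_permU_of_heq σ f hl ha hθ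

/-- The value of a reindexed composite. -/
theorem ev_reindex_comp {n s : ℕ} {t : Fin s → ℕ} (σ : Fin n ≃ Fin (∑ i, t i))
    {x' : Fin n → GammaCat.{u}} {w : ∀ i, Fin (t i) → GammaCat.{u}} {x : Fin s → GammaCat.{u}}
    {y : GammaCat.{u}} (h : ∀ i, x' i = concat w (σ i)) (f : GMor x y.functor)
    (g : ∀ i, GMor (w i) (x i).functor) {l' : Fin n → GammaOp} {l : (Σ i, Fin (t i)) → GammaOp}
    {p : Fin s → GammaOp} {k : GammaOp} {θ' : PMap l' k} {a' : ∀ i, El (x' i).functor (l' i)}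
    {a : ∀ q : Σ i, Fin (t i), El (w q.1 q.2).functor (l q)} (ψ : PMap p k)
    (φ : ∀ i, PMap (fun j => l ⟨i, j⟩) (p i)) (hl : ∀ i, l' i = l (finSigmaFinEquiv.symm (σ i)))
    (ha : ∀ i, HEq (a' i) (a (finSigmaFinEquiv.symm (σ i))))
    (hθ : ∀ t' t, (∀ i, HEq (t' i) (t (finSigmaFinEquiv.symm (σ i)))) →
      θ'.toFun t' = (ψ.sub φ).toFun t) :
    (gOps.reindex σ h (gOps.comp f g)).ev θ' a' =
      f.ev ψ fun i => (g i).ev (φ i) fun j => a ⟨i, j⟩ := by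
  obtain rfl : x' = fun i => concat w (σ i) := funext h
  refine (congrArg (fun F => GMor.ev F θ' a')
    (GMor.permU_permU σ finSigmaFinEquiv.symm (GMor.compU f g))).trans ?_
  exact (GMor.ev_permU_of_heq (X := fun q : Σ i, Fin (t i) => w q.1 q.2)
    (σ.trans finSigmaFinEquiv.symm) (GMor.compU f g) hl ha hθ).trans
      (GMor.ev_compU f g _ a ψ φ fun _ => rfl)

/-- `post` composes with a one-element list, whose double indices are the pairs `(0, i)`. The outer
map of the factorization is an identity. -/
theorem ev_post {r : ℕ} {x : Fin r → GammaCat.{u}} {y z : GammaCat.{u}} (f : GMor x y.functor)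
    (g : y ⟶ z) {l : Fin r → GammaOp} {k : GammaOp} (θ : PMap l k)
    (a : ∀ i, El (x i).functor (l i)) :
    (gOps.post f (GMor.ofNat (X := y) g)).ev θ a = gap g (f.ev θ a) := by
  have key : ∀ i : Fin r, finSigmaFinEquiv.symm ((finSigmaFinEquiv.symm.trans
      ((Equiv.sigmaEquivProd (Fin 1) (Fin r)).trans (Equiv.uniqueProd (Fin r) (Fin 1)))).symm i) =
        ⟨0, i⟩ := fun i => by
    simp
  refine (ev_reindex_comp _ _ (GMor.ofNat (X := y) g) (fun _ => f) (l := fun q => l q.2)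
    (a := fun q => a q.2) (PMap.ofHom (𝟙 k)) (fun _ => θ) (fun i => ?_) (fun i => ?_)
    fun t' t h => ?_).trans (act_id _)
  · rw [key]
  · rw [key]
  · refine congrArg θ.toFun (funext fun i => ?_)
    have := h i
    rw [key] at this
    exact eq_of_heq this

/-- The element of a product of two factors. -/
def two {α : Fin 2 → Sort*} (u : α 0) (v : α 1) : ∀ i, α i
  | 0 => u
  | 1 => v

/-- The map of two variables given by a map of a smash product. -/
def PMap.of₂ {m n k : GammaOp} (g : sm m n ⟶ k) : PMap (two (α := fun _ => GammaOp) m n) k where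
  toFun t := g.1 (pr (a := m) (b := n) (t 0) (t 1))
  map_none t i h := by
    fin_cases i
    · exact (congrArg (fun s => g.1 (pr (a := m) (b := n) s (t 1))) h).trans g.2
    · exact (congrArg (fun s => g.1 (pr (a := m) (b := n) (t 0) s)) h).trans
        ((congrArg g.1 (pr_none_right _)).trans g.2)

/-- The map of a smash product given by a map of two variables. -/
def PMap.hom₂ {m : Fin 2 → GammaOp} {k : GammaOp} (θ : PMap m k) : sm (m 0) (m 1) ⟶ k :=
  lift₂ fun s t => θ.toFun (two s t)

@[simp] theorem PMap.hom₂_pr {m : Fin 2 → GammaOp} {k : GammaOp} (θ : PMap m k) (s : (m 0).toSet)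
    (t : (m 1).toSet) : θ.hom₂.1 (pr s t) = θ.toFun (two s t) :=
  lift₂_pr (θ := fun s t => θ.toFun (two s t)) (fun _ => θ.map_none _ 0 rfl)
    (fun _ => θ.map_none _ 1 rfl) s t

/-- The decomposition of the set of indices of the concatenation of two lists. -/
def appendEquiv (r s : ℕ) : Fin (r + s) ≃ Fin (∑ i, ![r, s] i) :=
  finSumFinEquiv.symm.trans
    ((Equiv.mk
      (fun q : Fin r ⊕ Fin s => (match q with
        | .inl i => ⟨0, i⟩
        | .inr j => ⟨1, j⟩ : Σ i, Fin (![r, s] i)))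
      (fun q => match q with
        | ⟨0, i⟩ => .inl i
        | ⟨1, j⟩ => .inr j)
      (by rintro (_ | _) <;> rfl)
      (by rintro ⟨i, j⟩; fin_cases i <;> rfl)).trans finSigmaFinEquiv)

theorem appendEquiv_castAdd {r s : ℕ} (i : Fin r) :
    finSigmaFinEquiv.symm (appendEquiv r s (Fin.castAdd s i)) = ⟨0, i⟩ :=
  (Equiv.symm_apply_apply _ _).trans (by rw [finSumFinEquiv_symm_apply_castAdd]; rfl)

theorem appendEquiv_natAdd {r s : ℕ} (i : Fin s) :
    finSigmaFinEquiv.symm (appendEquiv r s (Fin.natAdd r i)) = ⟨1, i⟩ :=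
  (Equiv.symm_apply_apply _ _).trans (by rw [finSumFinEquiv_symm_apply_natAdd]; rfl)

/-- The element of a product over the set of double indices of two lists. -/
def double {r s : ℕ} {α : (Σ i, Fin (![r, s] i)) → Sort*} (a : ∀ i : Fin r, α ⟨0, i⟩)
    (b : ∀ i : Fin s, α ⟨1, i⟩) : ∀ q, α q
  | ⟨0, i⟩ => a i
  | ⟨1, i⟩ => b i

/-- The map `θ` is factored into one map for each of the two lists and a map `ψ` of their binary
smash product. All data over `Fin (r + s)` are compared on its two halves only. -/
theorem ev_comp₂ {r s : ℕ} {x : Fin r → GammaCat.{u}} {x' : Fin s → GammaCat.{u}}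
    {b c y : GammaCat.{u}}
    (f : GMor ![b, c] y.functor)
    (g : GMor x b.functor) (h : GMor x' c.functor) {l : Fin (r + s) → GammaOp}
    {l₁ : Fin r → GammaOp} {l₂ : Fin s → GammaOp} {p q k : GammaOp} {θ : PMap l k}
    {a : ∀ i, El (Fin.append x x' i).functor (l i)} {a₁ : ∀ i, El (x i).functor (l₁ i)}
    {a₂ : ∀ i, El (x' i).functor (l₂ i)} (ψ : sm p q ⟶ k) (φ₁ : PMap l₁ p) (φ₂ : PMap l₂ q)
    (hl₁ : ∀ i, l (Fin.castAdd s i) = l₁ i) (hl₂ : ∀ i, l (Fin.natAdd r i) = l₂ i)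
    (ha₁ : ∀ i, HEq (a (Fin.castAdd s i)) (a₁ i)) (ha₂ : ∀ i, HEq (a (Fin.natAdd r i)) (a₂ i))
    (hθ : ∀ t t₁ t₂, (∀ i, HEq (t (Fin.castAdd s i)) (t₁ i)) →
      (∀ i, HEq (t (Fin.natAdd r i)) (t₂ i)) →
        θ.toFun t = ψ.1 (pr (φ₁.toFun t₁) (φ₂.toFun t₂))) :
    (gOps.comp₂ f g h).ev θ a =
      f.ev (PMap.of₂ ψ) (two (g.ev φ₁ a₁) (h.ev φ₂ a₂)) := by
  refine (ev_reindex_comp (t := ![r, s]) (appendEquiv r s) ?_ f _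
    (l := double (α := fun _ => GammaOp) l₁ l₂) (a := double a₁ a₂) (PMap.of₂ ψ)
    (fun i => match i with
      | 0 => φ₁
      | 1 => φ₂) (fun i => ?_) (fun i => ?_) fun t' t ht => ?_).trans ?_
  · intro i
    refine Fin.addCases (fun i => ?_) (fun i => ?_) i
    · rw [Fin.append_left, concat, appendEquiv_castAdd]
    · rw [Fin.append_right, concat, appendEquiv_natAdd]
  · refine Fin.addCases (fun i => ?_) (fun i => ?_) i
    · rw [appendEquiv_castAdd]
      exact hl₁ i
    · rw [appendEquiv_natAdd]
      exact hl₂ i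
  · refine Fin.addCases (fun i => ?_) (fun i => ?_) i
    · rw [appendEquiv_castAdd]
      exact ha₁ i
    · rw [appendEquiv_natAdd]
      exact ha₂ i
  · refine hθ t' (fun i => t ⟨0, i⟩) (fun i => t ⟨1, i⟩) (fun i => (ht _).trans ?_)
      fun i => (ht _).trans ?_
    · exact congr_arg_heq t (appendEquiv_castAdd i)
    · exact congr_arg_heq t (appendEquiv_natAdd i)
  · congr 1
    funext i
    fin_cases i <;> rfl

theorem ev_reindex_comp₂ {r s : ℕ} {x : Fin r → GammaCat.{u}} {x' : Fin s → GammaCat.{u}}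
    {x'' : Fin (r + s) → GammaCat.{u}} {b c y : GammaCat.{u}}
    (e : ∀ i, x'' i = Fin.append x x' (Equiv.refl _ i)) (f : GMor ![b, c] y.functor)
    (g : GMor x b.functor) (h : GMor x' c.functor) {l : Fin (r + s) → GammaOp}
    {l₁ : Fin r → GammaOp} {l₂ : Fin s → GammaOp} {p q k : GammaOp} {θ : PMap l k}
    {a : ∀ i, El (x'' i).functor (l i)} {a₁ : ∀ i, El (x i).functor (l₁ i)}
    {a₂ : ∀ i, El (x' i).functor (l₂ i)} (ψ : sm p q ⟶ k) (φ₁ : PMap l₁ p) (φ₂ : PMap l₂ q)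
    (hl₁ : ∀ i, l (Fin.castAdd s i) = l₁ i) (hl₂ : ∀ i, l (Fin.natAdd r i) = l₂ i)
    (ha₁ : ∀ i, HEq (a (Fin.castAdd s i)) (a₁ i)) (ha₂ : ∀ i, HEq (a (Fin.natAdd r i)) (a₂ i))
    (hθ : ∀ t t₁ t₂, (∀ i, HEq (t (Fin.castAdd s i)) (t₁ i)) →
      (∀ i, HEq (t (Fin.natAdd r i)) (t₂ i)) →
        θ.toFun t = ψ.1 (pr (φ₁.toFun t₁) (φ₂.toFun t₂))) :
    (gOps.reindex (Equiv.refl _) e (gOps.comp₂ f g h)).ev θ a =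
      f.ev (PMap.of₂ ψ) (two (g.ev φ₁ a₁) (h.ev φ₂ a₂)) := by
  obtain rfl : x'' = Fin.append x x' := funext e
  refine (congrArg (fun F => GMor.ev F θ a) (GMor.permU_refl (gOps.comp₂ f g h))).trans ?_
  exact ev_comp₂ f g h ψ φ₁ φ₂ hl₁ hl₂ ha₁ ha₂ hθ

end Values

attribute [local instance] dayMonoidal daySymmetric

/-! ### Morphisms of at most two variables -/

section FewVariables

namespace GMor

theorem ev_ofNat {X : GammaCat.{u}} {Y : GammaOp ⥤ BasedCat.{u}} (f : X.functor ⟶ Y)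
    {m : Fin 1 → GammaOp} {k : GammaOp} (θ : PMap m k) (a : ∀ i, El X.functor (m i)) :
    (ofNat f).ev θ a = act θ.toHom (ap f (a 0)) := rfl

/-- The action on arrows of the natural transformation given by a morphism of one variable. -/
def arrNat {X : GammaCat.{u}} {Y : GammaOp ⥤ BasedCat.{u}} (Φ : GMor (fun _ : Fin 1 => X) Y) :
    ArrNat X.functor Y where
  ev {n} a := Φ.ev (m := fun _ => n) (PMap.ofHom (𝟙 n)) fun _ => a
  isId _ h := Φ.isId _ fun _ => h
  isComp _ _ _ h := Φ.isComp _ fun _ => h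
  base _ := Φ.base _ 0 rfl
  act g a := (Φ.pre (PMap.ofHom (𝟙 _)) (fun _ => g) fun _ => a).symm.trans
    (Φ.post (PMap.ofHom (𝟙 _)) g fun _ => a)

/-- Morphisms of one variable are natural transformations. -/
def ofNatEquiv (X : GammaCat.{u}) (Y : GammaOp ⥤ BasedCat.{u}) :
    (X.functor ⟶ Y) ≃ GMor (fun _ : Fin 1 => X) Y where
  toFun := ofNat
  invFun Φ := Φ.arrNat.hom
  left_inv f := ap_ext fun _ a => (ArrNat.ap_hom _ a).trans (act_id _)
  right_inv Φ := by
    ext m k θ a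
    rw [ev_ofNat, ArrNat.ap_hom]
    refine (Φ.post (m := fun _ => m 0) (PMap.ofHom (𝟙 _)) θ.toHom fun _ => a 0).symm.trans ?_
    have h0 : ∀ i : Fin 1, 0 = i := fun i => Subsingleton.elim _ _
    refine Φ.ev_congr (fun i => congrArg m (h0 i)) (fun i => congr_arg_heq a (h0 i))
      fun t t' h => congrArg θ.toFun (funext fun i => ?_)
    obtain rfl := h0 i
    exact eq_of_heq (h 0)

variable {X Y : GammaCat.{u}} {Z : GammaOp ⥤ BasedCat.{u}}

/-- The bilinear map given by a morphism of two variables. -/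
def bi (Φ : GMor ![X, Y] Z) : BiMor X Y Z where
  ev x y := Φ.ev (PMap.of₂ (𝟙 _)) (two x y)
  isId h h' := Φ.isId _ (two h h')
  isComp h h' := Φ.isComp _ (two h h')
  base_left _ := Φ.base _ 0 rfl
  base_right _ := Φ.base _ 1 rfl
  act_act {m n m' n'} p q x y := by
    refine Eq.trans ?_ (Φ.post (PMap.of₂ (𝟙 _)) (tens p q) (two x y))
    refine Eq.trans ?_ ((Φ.pre (n := two (α := fun _ => GammaOp) m n)
      (PMap.of₂ (𝟙 (sm m' n'))) (two p q) (two x y)).symm.trans ?_)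
    · congr 1
      funext i
      fin_cases i <;> rfl
    · congr 1
      exact PMap.ext (funext fun t => (tens_pr p q _ _).symm)

end GMor

/-- The morphism of two variables given by a bilinear map. -/
def BiMor.mor {X Y : GammaCat.{u}} {Z : GammaOp ⥤ BasedCat.{u}} (B : BiMor X Y Z) :
    GMor ![X, Y] Z where
  ev θ a := act θ.hom₂ (B.ev (a 0) (a 1))
  isId θ _ h := isId_act _ (B.isId (h 0) (h 1))
  isComp θ _ _ _ h := isComp_act _ (B.isComp (h 0) (h 1))
  base {m k} θ a i h := by
    fin_cases i
    · exact (congrArg (fun x => act θ.hom₂ (B.ev x (a 1))) h).trans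
        ((congrArg (act _) (B.base_left _)).trans (act_base _))
    · exact (congrArg (fun x => act θ.hom₂ (B.ev (a 0) x)) h).trans
        ((congrArg (act _) (B.base_right _)).trans (act_base _))
  post θ g a := by
    rw [← act_comp]
    exact congrArg (act · _) (sm_ext fun s t => by
      rw [PMap.hom₂_pr, comp_val, Function.comp_apply, PMap.hom₂_pr]
      rfl)
  pre {m n k} θ f a := by
    refine Eq.trans ?_ (congrArg (act _) (B.act_act (f 0) (f 1) (a 0) (a 1))).symm
    rw [← act_comp]
    refine congrArg (act · _) (sm_ext fun s t => ?_)
    rw [PMap.hom₂_pr, comp_val, Function.comp_apply, tens_pr, PMap.hom₂_pr]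
    refine congrArg θ.toFun (funext fun i => ?_)
    fin_cases i <;> rfl

theorem BiMor.ev_mor {X Y : GammaCat.{u}} {Z : GammaOp ⥤ BasedCat.{u}} (B : BiMor X Y Z)
    {m : Fin 2 → GammaOp} {k : GammaOp} (θ : PMap m k) (a : ∀ i, El (![X, Y] i).functor (m i)) :
    B.mor.ev θ a = act θ.hom₂ (B.ev (a 0) (a 1)) := rfl

theorem BiMor.ev_mor_of₂ {X Y : GammaCat.{u}} {Z : GammaOp ⥤ BasedCat.{u}} (B : BiMor X Y Z)
    {m n k : GammaOp} (g : sm m n ⟶ k) (x : El X.functor m) (y : El Y.functor n) :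
    B.mor.ev (PMap.of₂ g) (two x y) = act g (B.ev x y) := by
  rw [B.ev_mor]
  refine congrArg (act · _) (sm_ext fun s t => ?_)
  rw [PMap.hom₂_pr]
  rfl

/-- Every map of two variables is the universal one followed by `θ.hom₂`, so `post` recovers all
values from those at the universal map. -/
theorem GMor.mor_bi {X Y : GammaCat.{u}} {Z : GammaOp ⥤ BasedCat.{u}} (Φ : GMor ![X, Y] Z) :
    Φ.bi.mor = Φ := by
  ext m k θ a
  rw [BiMor.ev_mor]
  refine (Φ.post (PMap.of₂ (𝟙 _)) θ.hom₂ (two (a 0) (a 1))).symm.trans ?_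
  refine Φ.ev_congr (fun i => ?_) (fun i => ?_) fun t t' h => ?_
  · fin_cases i <;> rfl
  · fin_cases i <;> rfl
  · refine (PMap.hom₂_pr θ _ _).trans (congrArg θ.toFun (funext fun i => ?_))
    fin_cases i
    · exact eq_of_heq (h 0)
    · exact eq_of_heq (h 1)

/-- The universal morphism of two variables. -/
def boxMor (X Y : GammaCat.{u}) : GMor ![X, Y] (X ⊗ Y).functor := (boxBi X Y).mor

theorem ev_boxMor_of₂ {X Y : GammaCat.{u}} {m n k : GammaOp} (g : sm m n ⟶ k)
    (x : El X.functor m) (y : El Y.functor n) :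
    (boxMor X Y).ev (PMap.of₂ g) (two x y) = act g (box x y) := (boxBi X Y).ev_mor_of₂ g x y

/-- The universal morphism without variables. -/
def unitMor (X : Fin 0 → GammaCat.{u}) : GMor X unitGamma.{u}.functor where
  ev θ _ := el (θ.toFun fun i => i.elim0)
  isId _ _ _ := isId_el _
  isComp _ _ _ _ _ := (isId_el _).isComp
  base _ _ i := i.elim0
  post _ g _ := (act_el g _).symm
  pre θ _ _ := congrArg (fun t => el (θ.toFun t)) (funext fun i => i.elim0)

end FewVariables

/-! ### Currying -/

section Curry

/-- The element of a product indexed by `Option ι`. -/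
def opt {ι : Type} {α : Option ι → Sort*} (a : ∀ i, α (some i)) (b : α none) : ∀ o, α o
  | some i => a i
  | none => b

theorem opt_eta {ι : Type} {α : Option ι → Sort*} (a : ∀ o, α o) :
    opt (fun i => a (some i)) (a none) = a := by
  funext o
  cases o <;> rfl

variable {ι : Type}

/-- The smash product of a map of several variables with an identity. -/
def PMap.smashId {m : ι → GammaOp} {k : GammaOp} (θ : PMap m k) (n : GammaOp) :
    PMap (opt (α := fun _ => GammaOp) m n) (sm k n) where
  toFun t := pr (θ.toFun fun i => t (some i)) (t none)
  map_none t o h := by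
    rcases o with _ | i
    · rw [h]
      exact pr_none_right _
    · exact congrArg (fun s => pr (a := k) (b := n) s (t none))
        (θ.map_none (fun i => t (some i)) i h)

namespace GMor

variable {X : Option ι → GammaCat.{u}} {W : GammaCat.{u}} (Φ : GMor X W.functor)
  {m m' : ι → GammaOp} {n n' k k' : GammaOp}

/-- The value on a tuple and a further arrow. -/
def evLast (θ : PMap m k) (a : ∀ i, El (X (some i)).functor (m i)) (z : El (X none).functor n) :
    El W.functor (sm k n) := Φ.ev (θ.smashId n) (opt a z)

theorem isId_evLast (θ : PMap m k) {a : ∀ i, El (X (some i)).functor (m i)}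
    {z : El (X none).functor n} (h : ∀ i, IsId (a i)) (h' : IsId z) : IsId (Φ.evLast θ a z) :=
  Φ.isId _ (opt h h')

theorem isComp_evLast (θ : PMap m k) {a b c : ∀ i, El (X (some i)).functor (m i)}
    {x y z : El (X none).functor n} (h : ∀ i, IsComp (a i) (b i) (c i)) (h' : IsComp x y z) :
    IsComp (Φ.evLast θ a x) (Φ.evLast θ b y) (Φ.evLast θ c z) :=
  Φ.isComp _ (opt h h')

theorem evLast_act (θ : PMap m k) (a : ∀ i, El (X (some i)).functor (m i)) (q : n ⟶ n')
    (z : El (X none).functor n) :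
    Φ.evLast θ a (act q z) = act (tens (𝟙 k) q) (Φ.evLast θ a z) := by
  refine Eq.trans ?_ (Φ.post (θ.smashId n) (tens (𝟙 k) q) (opt a z))
  refine Eq.trans ?_ ((Φ.pre (n := opt (α := fun _ => GammaOp) m n) (θ.smashId n')
    (opt (fun i => 𝟙 (m i)) q) (opt a z)).symm.trans ?_)
  · refine congrArg (Φ.ev _) (funext fun o => ?_)
    rcases o with _ | i
    · rfl
    · exact (act_id _).symm
  · congr 1
    exact PMap.ext_iff.mpr (funext fun t => (tens_pr (𝟙 k) q _ _).symm)

theorem evLast_post (θ : PMap m k) (g : k ⟶ k') (a : ∀ i, El (X (some i)).functor (m i))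
    (z : El (X none).functor n) :
    Φ.evLast (θ.post g) a z = act (tens g (𝟙 n)) (Φ.evLast θ a z) := by
  refine Eq.trans ?_ (Φ.post (θ.smashId n) (tens g (𝟙 n)) (opt a z))
  refine congrArg (Φ.ev · _) (PMap.ext_iff.mpr (funext fun t => (tens_pr g (𝟙 n) _ _).symm))

theorem evLast_pre (θ : PMap m k) (f : ∀ i, m' i ⟶ m i)
    (a : ∀ i, El (X (some i)).functor (m' i)) (z : El (X none).functor n) :
    Φ.evLast (θ.pre f) a z = Φ.evLast θ (fun i => act (f i) (a i)) z := by
  refine Eq.trans ?_ ((Φ.pre (n := opt (α := fun _ => GammaOp) m' n) (θ.smashId n)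
    (opt f (𝟙 n)) (opt a z)).trans ?_)
  · rfl
  · refine congrArg (Φ.ev _) (funext fun o => ?_)
    rcases o with _ | i
    · exact act_id _
    · rfl

/-- The morphism to an internal hom object that corresponds to a morphism of several variables. -/
def curry : GMor (fun i => X (some i)) (ihom (X none) W).functor where
  ev θ a := homArr (fun z => Φ.evLast θ (fun i => (a i).srcId) z) (fun z => Φ.evLast θ a z)
    (fun z => Φ.evLast θ (fun i => (a i).tgtId) z)
    (fun h => Φ.isId_evLast θ (fun _ => isId_srcId _) h)
    (fun h => Φ.isId_evLast θ (fun _ => isId_tgtId _) h)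
    (fun h => Φ.isComp_evLast θ (fun _ => (isId_srcId _).isComp) h)
    (fun h => Φ.isComp_evLast θ (fun _ => isComp_srcId _) h)
    (fun h => Φ.isComp_evLast θ (fun _ => isComp_tgtId _) h)
    (fun h => Φ.isComp_evLast θ (fun _ => (isId_tgtId _).isComp) h)
    (fun _ => Φ.base _ none rfl) (fun _ => Φ.base _ none rfl) (fun _ => Φ.base _ none rfl)
    (fun q z => Φ.evLast_act θ _ q z) (fun q z => Φ.evLast_act θ _ q z)
    (fun q z => Φ.evLast_act θ _ q z)
  isId θ a h := isId_of_hev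
    (fun z => congrArg (Φ.evLast θ · z) (funext fun i => (h i).srcId_eq.symm))
    (fun z => congrArg (Φ.evLast θ · z) (funext fun i => (h i).tgtId_eq.symm))
  isComp θ a b c h := isComp_of_hev
    (HomObj.ext fun z => congrArg (Φ.evLast θ · z) (funext fun i => (h i).midId_eq))
    (HomObj.ext fun z => congrArg (Φ.evLast θ · z) (funext fun i => (h i).srcId_eq))
    (HomObj.ext fun z => congrArg (Φ.evLast θ · z) (funext fun i => (h i).tgtId_eq))
    fun z => Φ.isComp_evLast θ h (isComp_tgtId z)
  base {m k} θ a i h := by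
    -- For all tuples `b`, because the ends of the transformation use the identities at the ends of
    -- each `a i`, and these are base arrows too where `a i` is one.
    have key : ∀ b : ∀ i, El (X (some i)).functor (m i), b i = BasedCat.baseArr _ →
        ∀ {n : GammaOp} (z : El (X none).functor n), Φ.evLast θ b z = BasedCat.baseArr _ :=
      fun b hb n z => Φ.base _ (some i) hb
    exact ihom_ext (fun z => key _ (by rw [h]; rfl) z) (fun z => key _ (by rw [h]; rfl) z)
      fun z => key _ h z
  post θ g a := ihom_ext (fun z => Φ.evLast_post θ g _ z) (fun z => Φ.evLast_post θ g _ z)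
    fun z => Φ.evLast_post θ g _ z
  pre θ f a := ihom_ext
    (fun z => (Φ.evLast_pre θ f _ z).trans (congrArg (Φ.evLast θ · z)
      (funext fun i => (isId_act (f i) (isId_srcId (a i))).srcId_eq.symm)))
    (fun z => (Φ.evLast_pre θ f _ z).trans (congrArg (Φ.evLast θ · z)
      (funext fun i => (isId_act (f i) (isId_tgtId (a i))).tgtId_eq.symm)))
    fun z => Φ.evLast_pre θ f _ z

end GMor

end Curry

/-! ### The underlying multicategory of the symmetric monoidal structure -/

section Underlying

/-- The iterated universal morphism. -/
noncomputable def tensorU {r : ℕ} (x : Fin r → GammaCat.{u}) : GMor x (tensorList x).functor :=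
  gOps.tensorMor boxMor (unitMor ![]) x

theorem ev_tensorU_zero (x : Fin 0 → GammaCat.{u}) {m : Fin 0 → GammaOp} {k : GammaOp}
    (θ : PMap m k) (a : ∀ i, El (x i).functor (m i)) :
    (tensorU x).ev θ a = el (θ.toFun fun i => i.elim0) :=
  ev_reindex (Equiv.refl _) (fun i => i.elim0) (unitMor ![]) (l := m) (a := fun i => i.elim0)
    (θ := θ) (fun i => i.elim0) (fun i => i.elim0) fun _ _ _ =>
      congrArg θ.toFun (funext fun i => i.elim0)

/-- The list of indices with a further element, which comes last. -/
def snocEquiv (r : ℕ) : Option (Fin r) ≃ Fin (r + 1) where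
  toFun
    | some i => i.castSucc
    | none => Fin.last r
  invFun i := Fin.lastCases none some i
  left_inv o := by cases o <;> simp
  right_inv i := by
    refine Fin.lastCases ?_ (fun i => ?_) i <;> simp

theorem eq_append_last {O : Type*} {r : ℕ} (x : Fin (r + 1) → O) (i : Fin (r + 1)) :
    x i = Fin.append (fun i : Fin r => x i.castSucc) (fun _ : Fin 1 => x (Fin.last r))
      (Equiv.refl (Fin (r + 1)) i) := by
  refine Fin.lastCases ?_ (fun i => ?_) i
  · exact (Fin.append_right (fun i : Fin r => x i.castSucc) (fun _ : Fin 1 => x (Fin.last r)) 0).symm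
  · exact (Fin.append_left (fun i : Fin r => x i.castSucc) (fun _ : Fin 1 => x (Fin.last r)) i).symm

/-- The recursion for the iterated universal morphism, valid for any factorization of `θ` that
separates the last variable. Indexing by `Option (Fin r)` makes that variable `none`. -/
theorem ev_tensorU_succ {r : ℕ} (x : Fin (r + 1) → GammaCat.{u}) {l : Fin (r + 1) → GammaOp}
    {k p : GammaOp} {θ : PMap l k} {A : ∀ i, El (x i).functor (l i)}
    {m : Option (Fin r) → GammaOp} {a : ∀ o, El (x (snocEquiv r o)).functor (m o)}
    (φ : PMap (fun i => m (some i)) p) (ψ : sm p (m none) ⟶ k) (hl : ∀ o, l (snocEquiv r o) = m o)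
    (ha : ∀ o, HEq (A (snocEquiv r o)) (a o))
    (hθ : ∀ (t : ∀ i, (l i).toSet) (t' : ∀ o, (m o).toSet),
      (∀ o, HEq (t (snocEquiv r o)) (t' o)) →
      θ.toFun t = ψ.1 (pr (φ.toFun fun i => t' (some i)) (t' none))) :
    (tensorU x).ev θ A = act ψ (box (X := tensorList fun i => x i.castSucc)
      ((tensorU fun i => x i.castSucc).ev φ fun i => a (some i)) (a none)) := by
  refine (ev_reindex_comp₂ (eq_append_last x) (boxMor _ _) (tensorU fun i => x i.castSucc)
    (gOps.id (x (Fin.last r))) (l₂ := fun _ => m none) (a₁ := fun i => a (some i))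
    (a₂ := fun _ => a none) ψ φ (PMap.ofHom (𝟙 _)) (fun i => hl (some i)) (fun i => ?_)
    (fun i => ha (some i)) (fun i => ?_) fun t t₁ t₂ h₁ h₂ => ?_).trans ?_
  · obtain rfl : i = 0 := Subsingleton.elim _ _
    exact hl none
  · obtain rfl : i = 0 := Subsingleton.elim _ _
    exact ha none
  · refine (hθ t (opt t₁ (t₂ 0)) fun o => ?_).trans rfl
    rcases o with _ | i
    · exact h₂ 0
    · exact h₁ i
  · refine (ev_boxMor_of₂ ψ _ _).trans ?_
    exact congrArg (fun z => act ψ (box _ z)) (act_id (a none))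

/-- The data on a set of indices that correspond to data on an equivalent set. -/
theorem exists_data {ι ι' : Type} (e : ι' ≃ ι) {x : ι → GammaCat.{u}} {m : ι' → GammaOp}
    {k : GammaOp} (φ : PMap m k) (a : ∀ i, El (x (e i)).functor (m i)) :
    ∃ (l : ι → GammaOp) (θ : PMap l k) (A : ∀ i, El (x i).functor (l i)),
      (∀ i, l (e i) = m i) ∧ (∀ i, HEq (A (e i)) (a i)) ∧
      ∀ t t', (∀ i, HEq (t (e i)) (t' i)) → θ.toFun t = φ.toFun t' := by
  obtain ⟨l, rfl⟩ := GMor.exists_levels e m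
  obtain ⟨A, rfl⟩ := GMor.exists_tuple e (α := fun j => El (x j).functor (l j)) a
  exact ⟨l, φ.unperm e, A, fun _ => rfl, fun _ => HEq.rfl, fun t t' h =>
    congrArg φ.toFun (funext fun i => eq_of_heq (h i))⟩

/-- The iterated tensor product is generated by tuples of arrows. -/
theorem tensorList_induction {r : ℕ} (x : Fin r → GammaCat.{u})
    {p : ∀ {k : GammaOp}, El (tensorList x).functor k → Prop}
    (htup : ∀ {m : Fin r → GammaOp} {k : GammaOp} (θ : PMap m k)
      (a : ∀ i, El (x i).functor (m i)), p ((tensorU x).ev θ a))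
    (hact : ∀ {k l : GammaOp} (g : k ⟶ l) (a : El (tensorList x).functor k), p a → p (act g a))
    (hcomp : ∀ {k : GammaOp} (a b c : El (tensorList x).functor k), IsComp a b c → p a → p b → p c) :
    ∀ {k : GammaOp} (a : El (tensorList x).functor k), p a := by
  induction r with
  | zero =>
    intro k a
    obtain ⟨i, rfl⟩ := exists_el a
    have := htup (m := fun i => i.elim0) ⟨fun _ => i, fun _ i => i.elim0⟩ fun i => i.elim0
    rwa [ev_tensorU_zero] at this
  | succ r ih =>
    intro k a
    refine day_induction (p := p) (fun {m n} t z => ?_) hact hcomp a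
    revert n
    -- The predicate quantifies over all `z`, since decomposing a composite in the first factor
    -- replaces `z` by an identity in one of the two pieces.
    refine ih (fun i => x i.castSucc) (p := fun {m} t => ∀ {n} (z : El (x (Fin.last r)).functor n),
      p (box (X := tensorList fun i => x i.castSucc) t z)) (fun {m k} φ a {n} z => ?_)
      (fun {_ _} g t ht {_} z => ?_) (fun {_} a b c hc ha hb {_} z => ?_) t
    · obtain ⟨l, θ, A, hl, hA, hθ⟩ := exists_data (snocEquiv r) (x := x) (φ.smashId n)
        (opt (α := fun o => El (x (snocEquiv r o)).functor (opt (α := fun _ => GammaOp) m n o)) a z)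
      exact (congrArg p ((ev_tensorU_succ x (A := A) (m := opt (α := fun _ => GammaOp) m n)
        (a := opt (α := fun o =>
          El (x (snocEquiv r o)).functor (opt (α := fun _ => GammaOp) m n o)) a z) φ (𝟙 _) hl hA
        hθ).trans (act_id _))).mp (htup θ A)
    · rw [box_act_left]
      exact hact _ _ (ht z)
    · exact hcomp _ _ _ (isComp_box hc (isComp_tgtId z)) (ha z) (hb _)

theorem tensorU_injective {r : ℕ} {x : Fin r → GammaCat.{u}} {y : GammaCat.{u}}
    {f g : tensorList x ⟶ y}
    (h : ∀ {m : Fin r → GammaOp} {k : GammaOp} (θ : PMap m k) (a : ∀ i, El (x i).functor (m i)),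
      gap f ((tensorU x).ev θ a) = gap g ((tensorU x).ev θ a)) : f = g :=
  gap_ext fun _ t => tensorList_induction x (p := fun t => gap f t = gap g t) h
    (fun p a ha => by rw [gap_act, gap_act, ha])
    (fun a b c hc ha hb => (isComp_gap f hc).unique (by
      rw [ha, hb]
      exact isComp_gap g hc)) t

/-- A factorization of a map of several variables over a smash product of the last factor with a
smash product of the other ones. -/
theorem PMap.exists_factor {ι : Type} [Finite ι] {m : Option ι → GammaOp} {k : GammaOp}
    (θ : PMap m k) : ∃ (p : GammaOp) (φ : PMap (fun i => m (some i)) p) (ψ : sm p (m none) ⟶ k),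
      ∀ t, θ.toFun t = ψ.1 (pr (φ.toFun fun i => t (some i)) (t none)) := by
  let e := GMor.prodEnum fun i => m (some i)
  let θ' : (m none).toSet → PMap (fun i => m (some i)) k := fun s =>
    ⟨fun t => θ.toFun (opt t s), fun t i h => θ.map_none _ (some i) h⟩
  refine ⟨_, PMap.ofEquiv e, lift₂ fun i s => (PMap.lift e (θ' s)).1 i, fun t => ?_⟩
  rw [lift₂_pr (fun _ => rfl) fun i => ?_, PMap.lift_ofEquiv]
  · exact congrArg θ.toFun (opt_eta t).symm
  · rcases i with _ | i
    · rfl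
    · exact θ.map_none _ none rfl

/-- The precomposition of a map of several variables with a bijection. -/
def PMap.perm {ι ι' : Type} (e : ι' ≃ ι) {m : ι → GammaOp} {k : GammaOp} (θ : PMap m k) :
    PMap (fun i => m (e i)) k where
  toFun t := θ.toFun (Equiv.piCongrLeft (fun i => (m i).toSet) e t)
  map_none t i h := θ.map_none _ (e i) ((Equiv.piCongrLeft_apply_apply (fun i => (m i).toSet) e t i).trans h)

theorem PMap.perm_apply {ι ι' : Type} (e : ι' ≃ ι) {m : ι → GammaOp} {k : GammaOp} (θ : PMap m k)
    (t : ∀ i, (m i).toSet) : (θ.perm e).toFun (fun i => t (e i)) = θ.toFun t :=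
  congrArg θ.toFun ((Equiv.piCongrLeft (fun i => (m i).toSet) e).apply_symm_apply t)

/-- A morphism of `r + 1` variables is curried in the last one, factored by induction as a morphism
of `r` variables to the internal hom, and uncurried by the universal property of `day`; the target
`y` must therefore vary in the induction. A morphism without variables is a map out of the unit,
whose arrows are elements of based sets. -/
theorem tensorU_surjective {r : ℕ} (x : Fin r → GammaCat.{u}) (y : GammaCat.{u})
    (Φ : GMor x y.functor) : ∃ f : tensorList x ⟶ y, ∀ {m : Fin r → GammaOp} {k : GammaOp}
      (θ : PMap m k) (a : ∀ i, El (x i).functor (m i)), gap f ((tensorU x).ev θ a) = Φ.ev θ a := by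
  induction r generalizing y with
  | zero =>
    -- The constant map to the base point factors through `⟨0⟩`, where `y` has a single arrow.
    have base : ∀ n, Φ.ev (m := fun i => i.elim0) (k := n) ⟨fun _ => none, fun _ i => i.elim0⟩
        (fun i => i.elim0) = (y.functor.obj n).baseArr := fun n =>
      (Φ.post (m := fun i => i.elim0) (k := ⟨0⟩) ⟨fun _ => none, fun _ i => i.elim0⟩
        (zero ⟨0⟩ n) fun i => i.elim0).trans (act_zero _)
    let e : ArrNat unitGamma.{u}.functor y.functor :=
      { ev := fun a => Φ.ev (m := fun i => i.elim0) ⟨fun _ => un a, fun _ i => i.elim0⟩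
          fun i => i.elim0
        isId := fun _ _ => Φ.isId _ fun i => i.elim0
        isComp := fun a b c h => by
          rw [(IsComp.un_eq h).1, (IsComp.un_eq h).2]
          exact Φ.isComp _ fun i => i.elim0
        base := base
        act := fun g a => Φ.post (m := fun i => i.elim0) ⟨fun _ => un a, fun _ i => i.elim0⟩ g
          fun i => i.elim0 }
    refine ⟨e.hom, fun {m k} θ a => ?_⟩
    rw [ev_tensorU_zero]
    refine (e.ap_hom _).trans (Φ.ev_congr (fun i => i.elim0) (fun i => i.elim0) fun t t' _ => ?_)
    exact congrArg θ.toFun (funext fun i => i.elim0)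
  | succ r ih =>
    -- The last variable is renamed to `none`, the one that `curry` splits off.
    let Φ' := GMor.permU (snocEquiv r) Φ
    obtain ⟨f, hf⟩ := ih (fun i => x i.castSucc) (ihom (x (Fin.last r)) y) Φ'.curry
    refine ⟨(uncurry (T := tensorList fun i => x i.castSucc) f).hom, fun {l k} θ A => ?_⟩
    obtain ⟨p, φ, ψ, h⟩ := PMap.exists_factor (θ.perm (snocEquiv r))
    have hθ : ∀ t : ∀ i, (l i).toSet, θ.toFun t =
        ψ.1 (pr (φ.toFun fun i => t (snocEquiv r (some i))) (t (snocEquiv r none))) := fun t =>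
      (θ.perm_apply _ t).symm.trans (h _)
    rw [ev_tensorU_succ x (m := fun o => l (snocEquiv r o)) (a := fun o => A (snocEquiv r o)) φ ψ
      (fun _ => rfl) (fun _ => HEq.rfl) fun t t' ht => by
        obtain rfl := funext fun o => eq_of_heq (ht o)
        exact hθ t]
    refine (gap_act (X := day (tensorList fun i => x i.castSucc) (x (Fin.last r))) _ _ _).trans
      ((congrArg (act ψ) (BiMor.gap_hom_box (uncurry _) _ _)).trans ?_)
    refine (congrArg (fun b => act ψ (hev b (A (Fin.last r)))) (hf φ _)).trans ?_
    refine (Φ'.post (φ.smashId _) ψ (opt (fun i => A i.castSucc) (A (Fin.last r)))).symm.trans ?_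
    refine GMor.ev_permU_of_heq (snocEquiv r) Φ (fun o => ?_) (fun o => ?_) fun t' t ht => ?_
    · cases o <;> rfl
    · cases o <;> rfl
    · refine Eq.trans ?_ (hθ t).symm
      have h₁ : ∀ i, t' (some i) = t (snocEquiv r (some i)) := fun i => eq_of_heq (ht (some i))
      have h₂ : t' none = t (snocEquiv r none) := eq_of_heq (ht none)
      exact congrArg ψ.1 (congrArg₂ pr (congrArg φ.toFun (funext h₁)) h₂)

end Underlying

/-! ### Comparison with the symmetric monoidal structure -/

section Comparison

theorem ofNat_id (x : GammaCat.{u}) : GMor.ofNatEquiv x x.functor (𝟙 x) = gOps.id x := by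
  ext m k θ a
  exact (GMor.ev_ofNat _ θ a).trans (congrArg (act θ.toHom) (ap_id _))

theorem ofNat_comp {x y z : GammaCat.{u}} (f : x ⟶ y) (g : y ⟶ z) :
    GMor.ofNatEquiv x z.functor (f ≫ g) =
      gOps.post (GMor.ofNatEquiv x y.functor f) (GMor.ofNatEquiv y z.functor g) := by
  ext m k θ a
  refine Eq.trans ?_ (ev_post (GMor.ofNat f) g θ a).symm
  refine (congrArg (act θ.toHom) (ap_comp f g (a 0))).trans ?_
  exact (ap_act g θ.toHom (ap f (a 0))).symm

theorem ev_post_ofNatEquiv {r : ℕ} {x : Fin r → GammaCat.{u}} {y z : GammaCat.{u}}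
    (f : GMor x y.functor) (g : y ⟶ z) {l : Fin r → GammaOp} {k : GammaOp} (θ : PMap l k)
    (a : ∀ i, El (x i).functor (l i)) :
    (gOps.post f (GMor.ofNatEquiv y z.functor g)).ev θ a = gap g (f.ev θ a) := ev_post _ _ _ _

theorem tensorU_bijective {r : ℕ} (x : Fin r → GammaCat.{u}) (y : GammaCat.{u}) :
    Function.Bijective fun f : tensorList x ⟶ y =>
      gOps.post (tensorU x) (GMor.ofNatEquiv (tensorList x) y.functor f) := by
  refine ⟨fun f g h => tensorU_injective fun θ a => ?_, fun Φ => ?_⟩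
  · have h' : gOps.post (tensorU x) (GMor.ofNatEquiv (tensorList x) y.functor f) =
        gOps.post (tensorU x) (GMor.ofNatEquiv (tensorList x) y.functor g) := h
    rw [← ev_post_ofNatEquiv, h', ev_post_ofNatEquiv]
  · obtain ⟨f, hf⟩ := tensorU_surjective x y Φ
    refine ⟨f, ?_⟩
    change gOps.post (tensorU x) (GMor.ofNatEquiv (tensorList x) y.functor f) = Φ
    ext m k θ a
    rw [ev_post_ofNatEquiv, hf]

/-- The value of a morphism on the only arrow. -/
theorem ev_ofNat_one {X : GammaCat.{u}} {Y : GammaCat.{u}} (f : X ⟶ Y) {m : GammaOp}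
    (a : El X.functor m) :
    (GMor.ofNatEquiv X Y.functor f).ev (PMap.ofHom (𝟙 m)) (fun _ => a) = gap f a :=
  act_id _

theorem ev_id_one (X : GammaCat.{u}) {m : GammaOp} (a : El X.functor m) :
    (gOps.id X).ev (PMap.ofHom (𝟙 m)) (fun _ => a) = a :=
  act_id _

variable {X Y Z : GammaCat.{u}}

theorem ev_post_boxMor (f : X ⊗ Y ⟶ Z) {m : Fin 2 → GammaOp} {k : GammaOp} (θ : PMap m k)
    (a : ∀ i, El (![X, Y] i).functor (m i)) :
    (gOps.post (boxMor X Y) (GMor.ofNatEquiv (X ⊗ Y) Z.functor f)).ev θ a =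
      act θ.hom₂ (gap f (box (X := X) (Y := Y) (a 0) (a 1))) :=
  (ev_post_ofNatEquiv _ _ _ _).trans (gap_act _ _ _)

/-- Both values are obtained by letting `θ.hom₂` act on the box of `gap f (a 0)` and `gap g (a 1)`.
-/
theorem post_boxMor {x x' y y' : GammaCat.{u}} (f : x ⟶ x') (g : y ⟶ y')
    (h : ∀ i, ![x, y] i = Fin.append (fun _ : Fin 1 => x) (fun _ : Fin 1 => y) (Equiv.refl _ i)) :
    gOps.post (boxMor x y) (GMor.ofNatEquiv (x ⊗ y) (x' ⊗ y').functor (f ⊗ₘ g)) =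
      gOps.reindex (Equiv.refl (Fin 2)) h (gOps.comp₂ (boxMor x' y')
        (GMor.ofNatEquiv x x'.functor f) (GMor.ofNatEquiv y y'.functor g)) := by
  ext m k θ a
  refine (ev_post_boxMor _ _ _).trans ?_
  refine (congrArg (act θ.hom₂) (gap_dayHom f g _ _)).trans (Eq.trans ?_
    (ev_reindex_comp₂ _ _ _ _
    (l₁ := fun _ => m 0) (l₂ := fun _ => m 1)
    (a₁ := fun _ => a 0) (a₂ := fun _ => a 1) θ.hom₂
    (PMap.ofHom (𝟙 (m 0))) (PMap.ofHom (𝟙 (m 1))) (fun i => ?_) (fun i => ?_) (fun i => ?_)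
    (fun i => ?_) fun t t₁ t₂ h₁ h₂ => ?_).symm)
  · refine Eq.trans ?_ (ev_boxMor_of₂ θ.hom₂ _ _).symm
    exact congrArg₂ (fun a b => act θ.hom₂ (box a b)) (ev_ofNat_one f _).symm
      (ev_ofNat_one g _).symm
  · obtain rfl : i = 0 := Subsingleton.elim _ _
    rfl
  · obtain rfl : i = 0 := Subsingleton.elim _ _
    rfl
  · obtain rfl : i = 0 := Subsingleton.elim _ _
    rfl
  · obtain rfl : i = 0 := Subsingleton.elim _ _
    rfl
  · refine Eq.trans ?_ (θ.hom₂_pr _ _).symm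
    refine congrArg θ.toFun (funext fun i => ?_)
    fin_cases i
    · exact eq_of_heq (h₁ 0)
    · exact eq_of_heq (h₂ 0)

/-- The symmetry acts on boxes through `swp`, and `swp` followed by `θ.hom₂` is `θ` with its two
arguments exchanged. -/
theorem post_boxMor_braiding (x y : GammaCat.{u}) (h : ∀ i, ![x, y] i = ![y, x] (Equiv.swap 0 1 i)) :
    gOps.post (boxMor x y) (GMor.ofNatEquiv (x ⊗ y) (y ⊗ x).functor (β_ x y).hom) =
      gOps.reindex (Equiv.swap (0 : Fin 2) 1) h (boxMor y x) := by
  ext m k θ a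
  refine (ev_post_boxMor _ _ _).trans ?_
  refine Eq.trans ?_ (ev_reindex _ _ _
    (l := two (α := fun _ => GammaOp) (m 1) (m 0)) (a := two (a 1) (a 0))
    (θ := PMap.of₂ (swp (m 1) (m 0) ≫ θ.hom₂)) (fun i => ?_) (fun i => ?_) fun t' t ht => ?_).symm
  · refine Eq.trans ?_ (ev_boxMor_of₂ _ _ _).symm
    refine (congrArg (act θ.hom₂) (gap_swapHom _ _ _ _)).trans ?_
    exact (act_comp _ _ _).symm
  · fin_cases i <;> rfl
  · fin_cases i <;> rfl
  · refine Eq.trans ?_ (congrArg θ.hom₂.1 (swp_pr _ _)).symm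
    refine Eq.trans ?_ (θ.hom₂_pr _ _).symm
    refine congrArg θ.toFun (funext fun i => ?_)
    fin_cases i
    · exact eq_of_heq (ht 0)
    · exact eq_of_heq (ht 1)

theorem ev_boxMor_of₂_eq {m n k : GammaOp} (g : sm m n ⟶ k) {a a' : El X.functor m}
    {b b' : El Y.functor n} (ha : a = a') (hb : b = b') :
    (boxMor X Y).ev (PMap.of₂ g) (two a b) = act g (box a' b') := by
  rw [ev_boxMor_of₂, ha, hb]

/-- The element of a product of three factors. -/
def three {α : Fin 3 → Sort*} (u : α 0) (v : α 1) (w : α 2) : ∀ i, α i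
  | 0 => u
  | 1 => v
  | 2 => w

/-- The map of a smash product given by a map of three variables. -/
def PMap.hom₃ {m : Fin 3 → GammaOp} {k : GammaOp} (θ : PMap m k) :
    sm (sm (m 0) (m 1)) (m 2) ⟶ k :=
  lift₂ fun st u => (lift₂ fun s t => θ.toFun (three s t u)).1 st

@[simp] theorem PMap.hom₃_pr {m : Fin 3 → GammaOp} {k : GammaOp} (θ : PMap m k) (s : (m 0).toSet)
    (t : (m 1).toSet) (u : (m 2).toSet) : θ.hom₃.1 (pr (pr s t) u) = θ.toFun (three s t u) := by
  have h : ∀ u s t, (lift₂ fun s t => θ.toFun (three s t u)).1 (pr s t) =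
      θ.toFun (three s t u) := fun u s t =>
    lift₂_pr (fun _ => θ.map_none _ 0 rfl) (fun _ => θ.map_none _ 1 rfl) s t
  refine (lift₂_pr (fun _ => rfl) (fun st => ?_) _ u).trans (h u s t)
  rcases st with _ | st
  · rfl
  · obtain ⟨s, t, hst⟩ := exists_pr st
    rw [hst]
    exact (h none _ _).trans (θ.map_none _ 2 rfl)

/-- Both values are obtained by letting `cas` followed by `θ.hom₃` act on the box bracketed to the
right: on one side by `gap_assocHom`, on the other by evaluating through this factorization. -/
theorem post_comp₂_associator (x y z : GammaCat.{u})
    (h : ∀ i, Fin.append ![x, y] (fun _ : Fin 1 => z) i =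
      Fin.append (fun _ : Fin 1 => x) ![y, z] (Equiv.refl (Fin 3) i)) :
    gOps.post (gOps.comp₂ (boxMor (x ⊗ y) z) (boxMor x y) (gOps.id z))
        (GMor.ofNatEquiv ((x ⊗ y) ⊗ z) (x ⊗ (y ⊗ z)).functor (α_ x y z).hom) =
      gOps.reindex (Equiv.refl (Fin 3)) h
        (gOps.comp₂ (boxMor x (y ⊗ z)) (gOps.id x) (boxMor y z)) := by
  ext m k θ a
  let a₀ : El x.functor (m 0) := a 0
  let a₁ : El y.functor (m 1) := a 1
  let a₂ : El z.functor (m 2) := a 2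
  refine (ev_post_ofNatEquiv _ _ _ _).trans ?_
  refine (congrArg (gap _) (ev_comp₂ _ _ _ (l₁ := two (α := fun _ => GammaOp) (m 0) (m 1))
    (l₂ := fun _ => m 2) (a₁ := two a₀ a₁) (a₂ := fun _ => a₂)
    (PMap.hom₃ θ) (PMap.of₂ (𝟙 _)) (PMap.ofHom (𝟙 _)) (fun i => ?_) (fun i => ?_) (fun i => ?_)
    (fun i => ?_) fun t t₁ t₂ h₁ h₂ => ?_)).trans ?_
  · fin_cases i <;> rfl
  · fin_cases i
    rfl
  · fin_cases i <;> rfl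
  · fin_cases i
    rfl
  · refine Eq.trans ?_ (PMap.hom₃_pr (m := m) θ (t₁ 0) (t₁ 1) (t₂ 0)).symm
    refine congrArg θ.toFun (funext fun i => ?_)
    fin_cases i
    · exact eq_of_heq (h₁ 0)
    · exact eq_of_heq (h₁ 1)
    · exact eq_of_heq (h₂ 0)
  refine (congrArg (gap (assocHom x y z)) (ev_boxMor_of₂_eq _ ((ev_boxMor_of₂ _ _ _).trans
    (act_id _)) (ev_id_one _ _))).trans ((gap_act (X := day (day x y) z) _ _ _).trans
      ((congrArg (act _) (gap_assocHom x y z _ _ _)).trans ((act_comp _ _ _).symm.trans ?_)))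
  refine Eq.symm ((ev_reindex_comp₂ _ _ _ _ (l₁ := fun _ => m 0)
    (l₂ := two (α := fun _ => GammaOp) (m 1) (m 2))
    (a₁ := fun _ => a₀) (a₂ := two a₁ a₂) (cas (m 0) (m 1) (m 2) ≫ PMap.hom₃ θ)
    (PMap.ofHom (𝟙 _)) (PMap.of₂ (𝟙 _))
    (fun i => ?_) (fun i => ?_) (fun i => ?_) (fun i => ?_) fun t t₁ t₂ h₁ h₂ => ?_).trans ?_)
  · fin_cases i
    rfl
  · fin_cases i <;> rfl
  · fin_cases i
    rfl
  · fin_cases i <;> rfl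
  · refine Eq.trans ?_ (congrArg (PMap.hom₃ θ).1 (cas_pr (t₁ 0) (t₂ 0) (t₂ 1))).symm
    refine Eq.trans ?_ (PMap.hom₃_pr (m := m) θ (t₁ 0) (t₂ 0) (t₂ 1)).symm
    refine congrArg θ.toFun (funext fun i => ?_)
    fin_cases i
    · exact eq_of_heq (h₁ 0)
    · exact eq_of_heq (h₂ 0)
    · exact eq_of_heq (h₂ 1)
  · exact ev_boxMor_of₂_eq _ (ev_id_one _ _) ((ev_boxMor_of₂ _ _ _).trans (act_id _))

/-- The element `1` as a map without variables. -/
def PMap.star : PMap (fun i : Fin 0 => i.elim0) ⟨1⟩ := ⟨fun _ => GammaOp.star, fun _ i => i.elim0⟩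

/-- The unit contributes the arrow of `star`. Inserting `star` and then applying `lun` is the
identity, so only `θ` remains. -/
theorem post_comp₂_leftUnitor (x : GammaCat.{u})
    (h : ∀ i, Fin.append ![] (fun _ : Fin 1 => x) i = x) :
    gOps.post (gOps.comp₂ (boxMor (𝟙_ _) x) (unitMor ![]) (gOps.id x))
        (GMor.ofNatEquiv (𝟙_ _ ⊗ x) x.functor (λ_ x).hom) =
      gOps.reindex (finCongr (Nat.zero_add 1)) h (gOps.id x) := by
  ext m k θ a
  let a₀ : El x.functor (m 0) := a 0
  let g : m 0 ⟶ k := PMap.toHom (m := m) θ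
  refine (ev_post_ofNatEquiv _ _ _ _).trans ?_
  refine (congrArg (gap _) (ev_comp₂ _ _ _ (l₁ := fun i => i.elim0)
    (l₂ := fun _ => m 0) (a₁ := fun i => i.elim0) (a₂ := fun _ => a₀)
    (lun (m 0) ≫ g) PMap.star (PMap.ofHom (𝟙 _)) (fun i => i.elim0) (fun i => ?_)
    (fun i => i.elim0) (fun i => ?_) fun t t₁ t₂ h₁ h₂ => ?_)).trans ?_
  · fin_cases i
    rfl
  · fin_cases i
    rfl
  · refine Eq.trans ?_ (congrArg g.1 (lun_pr (t₂ 0))).symm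
    refine congrArg θ.toFun (funext fun i => ?_)
    fin_cases i
    exact eq_of_heq (h₂ 0)
  refine (congrArg (gap (lunitHom x)) (ev_boxMor_of₂_eq _ (a' := el GammaOp.star) rfl
    (ev_id_one _ _))).trans ((gap_act (X := day unitGamma x) _ _ _).trans
      ((congrArg (act _) (gap_lunitHom x _ _)).trans ((act_comp _ _ _).symm.trans ?_)))
  refine (congrArg (act · a₀) (Subtype.ext (funext fun t => congrArg g.1 (lun_pr t)) :
    ins GammaOp.star (m 0) ≫ lun (m 0) ≫ g = g)).trans ?_
  refine Eq.symm ((ev_reindex _ _ _ (l := fun _ => m 0) (a := fun _ => a₀)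
    (θ := PMap.ofHom g) (fun i => ?_) (fun i => ?_) fun t t' ht => ?_).trans ?_)
  · fin_cases i
    rfl
  · fin_cases i
    rfl
  · refine congrArg θ.toFun (funext fun i => ?_)
    fin_cases i
    exact eq_of_heq (ht 0)
  · rfl

/-- As for the left unit, with two occurrences of `swp` that cancel: one from the symmetry in the
right unit isomorphism, one from the factorization of `θ`. -/
theorem post_comp₂_rightUnitor (x : GammaCat.{u})
    (h : ∀ i, Fin.append (fun _ : Fin 1 => x) ![] i = x) :
    gOps.post (gOps.comp₂ (boxMor x (𝟙_ _)) (gOps.id x) (unitMor ![]))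
        (GMor.ofNatEquiv (x ⊗ 𝟙_ _) x.functor (ρ_ x).hom) =
      gOps.reindex (Equiv.refl (Fin 1)) h (gOps.id x) := by
  ext m k θ a
  let a₀ : El x.functor (m 0) := a 0
  let g : m 0 ⟶ k := PMap.toHom (m := m) θ
  refine (ev_post_ofNatEquiv _ _ _ _).trans ?_
  refine (congrArg (gap _) (ev_comp₂ _ _ _ (l₁ := fun _ => m 0)
    (l₂ := fun i => i.elim0) (a₁ := fun _ => a₀) (a₂ := fun i => i.elim0)
    (swp (m 0) ⟨1⟩ ≫ lun (m 0) ≫ g) (PMap.ofHom (𝟙 _)) PMap.star (fun i => ?_) (fun i => i.elim0)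
    (fun i => ?_) (fun i => i.elim0) fun t t₁ t₂ h₁ h₂ => ?_)).trans ?_
  · fin_cases i
    rfl
  · fin_cases i
    rfl
  · refine Eq.trans ?_ (congrArg (lun (m 0) ≫ g).1 (swp_pr (t₁ 0) GammaOp.star)).symm
    refine Eq.trans ?_ (congrArg g.1 (lun_pr (t₁ 0))).symm
    refine congrArg θ.toFun (funext fun i => ?_)
    fin_cases i
    exact eq_of_heq (h₁ 0)
  refine (congrArg (gap (swapHom x unitGamma ≫ lunitHom x)) (ev_boxMor_of₂_eq _ (ev_id_one _ _)
    (b' := el GammaOp.star) rfl)).trans ((gap_comp (X := day x unitGamma) _ _ _).trans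
      ((congrArg (gap (lunitHom x)) ((gap_act (X := day x unitGamma) _ _ _).trans
        ((congrArg (act _) (gap_swapHom x unitGamma _ _)).trans (act_comp _ _ _).symm))).trans
          ((gap_act (X := day unitGamma x) _ _ _).trans
            ((congrArg (act _) (gap_lunitHom x _ _)).trans ((act_comp _ _ _).symm.trans ?_)))))
  refine (congrArg (act · a₀) (Subtype.ext (funext fun t => ?_) : _ = g)).trans ?_
  · change g.1 ((lun _).1 ((swp _ _).1 ((swp _ _).1 (pr GammaOp.star t)))) = g.1 t
    rw [swp_pr, swp_pr, lun_pr]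
  refine Eq.symm ((ev_reindex _ _ _ (l := fun _ => m 0) (a := fun _ => a₀)
    (θ := PMap.ofHom g) (fun i => ?_) (fun i => ?_) fun t t' ht => ?_).trans ?_)
  · fin_cases i
    rfl
  · fin_cases i
    rfl
  · refine congrArg θ.toFun (funext fun i => ?_)
    fin_cases i
    exact eq_of_heq (ht 0)
  · rfl

/-- The multicategory of `Γ`-categories underlies the symmetric monoidal category. -/
noncomputable def gOpsUnderlying : Underlying gOps.{u} where
  one x y := GMor.ofNatEquiv x y.functor
  pair := boxMor
  unit := unitMor ![]
  one_id := ofNat_id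
  one_comp := ofNat_comp
  bijective := tensorU_bijective
  tensor f g := post_boxMor f g _
  associator x y z := post_comp₂_associator x y z _
  leftUnitor x := post_comp₂_leftUnitor x _
  rightUnitor x := post_comp₂_rightUnitor x _
  braiding x y := post_boxMor_braiding x y _

end Comparison

/-! ### Transport of `Underlying` along bijections between sets of morphisms -/

section TransportUnderlying

variable {O : Type v} {Hom : ∀ ⦃r : ℕ⦄, (Fin r → O) → O → Type w}
  {Hom' : ∀ ⦃r : ℕ⦄, (Fin r → O) → O → Type w} (M : MultiOps Hom)
  (e : ∀ {r : ℕ} (x : Fin r → O) (y : O), Hom' x y ≃ Hom x y)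

/-- The operations transported along bijections between the sets of morphisms. -/
abbrev MultiOps.along : MultiOps Hom' :=
  M.transport _root_.id e

theorem MultiOps.along_reindex {m n : ℕ} (σ : Fin m ≃ Fin n) {x' : Fin m → O} {x : Fin n → O}
    (h : ∀ i, x' i = x (σ i)) {y : O} (f : Hom' x y) :
    e _ _ ((M.along e).reindex σ h f) = M.reindex σ h (e _ _ f) :=
  M.transport_reindex _root_.id e σ h f

theorem MultiOps.along_comp {s : ℕ} {t : Fin s → ℕ} {w : ∀ i, Fin (t i) → O} {x : Fin s → O}
    {y : O} (f : Hom' x y) (g : ∀ i, Hom' (w i) (x i)) :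
    e _ _ ((M.along e).comp f g) = M.comp (e _ _ f) fun i => e _ _ (g i) :=
  (e _ _).apply_symm_apply _

theorem MultiOps.along_id (x : O) : e _ _ ((M.along e).id x) = M.id x :=
  (e _ _).apply_symm_apply _

theorem MultiOps.along_post {r : ℕ} {x : Fin r → O} {y z : O} (f : Hom' x y)
    (g : Hom' (fun _ : Fin 1 => y) z) :
    e _ _ ((M.along e).post f g) = M.post (e _ _ f) (e _ _ g) :=
  (M.along_reindex e _ _ _).trans (congrArg (M.reindex _ _) (M.along_comp e _ _))

theorem MultiOps.along_comp₂ {r s : ℕ} {x : Fin r → O} {x' : Fin s → O} {a b c : O}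
    (f : Hom' ![a, b] c) (g : Hom' x a) (h : Hom' x' b) :
    e _ _ ((M.along e).comp₂ f g h) = M.comp₂ (e _ _ f) (e _ _ g) (e _ _ h) := by
  unfold MultiOps.comp₂
  refine (M.along_reindex e _ _ _).trans ?_
  refine congrArg (M.reindex _ _) ((M.along_comp e _ _).trans
    (congrArg (M.comp _) (funext fun i => ?_)))
  fin_cases i <;> rfl

variable [Category.{w} O] [MonoidalCategory O]

theorem MultiOps.along_tensorMor (pair : ∀ x y : O, Hom ![x, y] (x ⊗ y))
    (unit : Hom ![] (𝟙_ O)) {r : ℕ} (x : Fin r → O) :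
    e _ _ ((M.along e).tensorMor (fun x y => (e _ _).symm (pair x y)) ((e _ _).symm unit) x) =
      M.tensorMor pair unit x := by
  induction r with
  | zero =>
    exact (M.along_reindex e _ _ _).trans
      (congrArg (M.reindex _ _) ((e _ _).apply_symm_apply _))
  | succ r ih =>
    refine (M.along_reindex e _ _ _).trans (congrArg (M.reindex _ _)
      ((M.along_comp₂ e _ _ _).trans ?_))
    rw [ih, M.along_id]
    exact congrArg (fun F => M.comp₂ F _ _) ((e _ _).apply_symm_apply _)

variable [SymmetricCategory O] {M}

/-- If the operations of a multicategory are transported along bijections between the sets of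
morphisms, then it still underlies the same symmetric monoidal category. -/
def Underlying.transport (U : Underlying M) : Underlying (M.along e) where
  one x y := (U.one x y).trans (e _ _).symm
  pair x y := (e _ _).symm (U.pair x y)
  unit := (e _ _).symm U.unit
  one_id x := congrArg (e _ _).symm (U.one_id x)
  one_comp f g := (e _ _).injective (by
    simp only [Equiv.trans_apply, Equiv.apply_symm_apply, M.along_post e, U.one_comp])
  bijective x y := by
    have h := (e x y).symm.bijective.comp (U.bijective x y)
    refine (congrArg Function.Bijective (funext fun f => (e _ _).injective ?_)).mp h
    simp only [Function.comp_apply, Equiv.trans_apply, Equiv.apply_symm_apply, M.along_post e,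
      M.along_tensorMor e]
  tensor f g := (e _ _).injective (by
    refine (M.along_post e _ _).trans (Eq.trans ?_ ((M.along_reindex e _ _ _).trans
      (congrArg (M.reindex _ _) (M.along_comp₂ e _ _ _))).symm)
    simp only [Equiv.trans_apply, Equiv.apply_symm_apply]
    exact U.tensor f g)
  associator x y z := (e _ _).injective (by
    refine (M.along_post e _ _).trans (Eq.trans ?_ ((M.along_reindex e _ _ _).trans
      (congrArg (M.reindex _ _) (M.along_comp₂ e _ _ _))).symm)
    rw [M.along_comp₂ e]
    simp only [Equiv.trans_apply, Equiv.apply_symm_apply, M.along_id e]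
    exact U.associator x y z)
  leftUnitor x := (e _ _).injective (by
    refine (M.along_post e _ _).trans (Eq.trans ?_ ((M.along_reindex e _ _ _).trans
      (congrArg (M.reindex _ _) (M.along_id e _))).symm)
    rw [M.along_comp₂ e]
    simp only [Equiv.trans_apply, Equiv.apply_symm_apply, M.along_id e]
    exact U.leftUnitor x)
  rightUnitor x := (e _ _).injective (by
    refine (M.along_post e _ _).trans (Eq.trans ?_ ((M.along_reindex e _ _ _).trans
      (congrArg (M.reindex _ _) (M.along_id e _))).symm)
    rw [M.along_comp₂ e]
    simp only [Equiv.trans_apply, Equiv.apply_symm_apply, M.along_id e]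
    exact U.rightUnitor x)
  braiding x y := (e _ _).injective (by
    refine (M.along_post e _ _).trans (Eq.trans ?_ (M.along_reindex e _ _ _).symm)
    simp only [Equiv.trans_apply, Equiv.apply_symm_apply]
    exact U.braiding x y)

end TransportUnderlying

/-! ### Day convolution and the multicategory of natural transformations -/

section Main

/-- The multicategory of `Γ`-categories underlies the symmetric monoidal category. -/
noncomputable def gammaUnderlying : Underlying gammaMulticategory.{u}.toMultiOps :=
  gOpsUnderlying.transport fun x y => GMor.equivHom x y.functor

/-- The component is the value at the universal map of one variable, which is the bijection used in
`idFamily`. Naturality of `q` moves this bijection in front of `q`. -/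
theorem gammaFam_one (X Y : GammaCat.{u}) (q : X ⟶ Y) (m : Fin 1 → ℕ) :
    gammaFam (gammaUnderlying.one X Y q) m = idFamily X.levels m ≫ NatTrans.app q ⟨∏ i, m i⟩ := by
  refine Smash.arr_ext fun a => ?_
  refine (arr_gammaFam_tup (GMor.ofNat (X := X) q) m a).trans ?_
  refine Eq.trans ?_ (congrArg (ap (X := X.functor) q) (arr_idFamily X.levels m a)).symm
  refine Eq.trans ?_ (ap_act (X := X.functor) q _ (a 0)).symm
  refine congrArg (act · (ap (X := X.functor) q (a 0))) (hom_ext fun s => ?_)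
  refine Eq.trans ?_ (lexMap_some _ _)
  change (lexMap _).toFun _ = _
  congr 1
  funext i
  obtain rfl : i = 0 := Subsingleton.elim _ _
  rfl

theorem ev_ofHom_comp {r : ℕ} {X : Fin r → GammaCat.{u}} {Y : GammaCat.{u}}
    {Z : GammaOp ⥤ BasedCat.{u}} (f : externalSmash X ⟶ GammaOp.smash r ⋙ Y.functor)
    (g : Y.functor ⟶ Z) {m : Fin r → GammaOp} {k : GammaOp} (θ : PMap m k)
    (a : ∀ i, El (X i).functor (m i)) :
    (GMor.ofHom (f ≫ Functor.whiskerLeft (GammaOp.smash r) g)).ev θ a =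
      ap g ((GMor.ofHom f).ev θ a) :=
  (ap_act (X := Y.functor) g (lexLift θ) (BasedFunctor.arr (f.app m) (Smash.tup a))).symm

theorem ev_ofHom_boxMor_comp {X Y : GammaCat.{u}} {Z : GammaOp ⥤ BasedCat.{u}}
    (g : (X ⊗ Y).functor ⟶ Z) {m : Fin 2 → GammaOp} {k : GammaOp} (θ : PMap m k)
    (a : ∀ i, El (![X, Y] i).functor (m i)) :
    (GMor.ofHom ((boxMor X Y).toHom ≫ Functor.whiskerLeft (GammaOp.smash 2) g)).ev θ a =
      ap g ((boxMor X Y).ev θ a) := by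
  rw [ev_ofHom_comp]
  exact congrArg (fun Φ => ap g (GMor.ev Φ θ a)) ((GMor.equivHom _ _).right_inv (boxMor X Y))

theorem isLeftKanExtension_day (X Y : GammaCat.{u}) :
    (X ⊗ Y).functor.IsLeftKanExtension (gammaUnderlying.pair X Y) := by
  refine ⟨⟨Limits.IsInitial.ofUniqueHom
    (fun E => StructuredArrow.homMk (GMor.bi (GMor.ofHom E.hom)).desc ?_) fun E f => ?_⟩⟩
  · refine (GMor.equivHom ![X, Y] E.right).injective (GMor.ext fun θ a => ?_)
    refine (ev_ofHom_boxMor_comp _ θ a).trans ?_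
    refine (ap_act (X := (X ⊗ Y).functor) _ _ _).trans
      ((congrArg (act θ.hom₂) (BiMor.ap_desc_box _ _ _)).trans ?_)
    exact congrArg (GMor.ev · θ a) (GMor.mor_bi (GMor.ofHom E.hom))
  · refine StructuredArrow.ext _ _ (day_ext fun x y => ?_)
    refine Eq.trans ?_ (BiMor.ap_desc_box _ x y).symm
    refine Eq.trans ?_ (congrArg (fun h => (GMor.ofHom h).ev (PMap.of₂ (𝟙 _)) (two x y))
      (StructuredArrow.w f))
    refine Eq.trans ?_ (ev_ofHom_boxMor_comp f.right _ _).symm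
    exact congrArg (ap (X := (X ⊗ Y).functor) f.right)
      ((ev_boxMor_of₂ _ _ _).trans (act_id _)).symm

end Main

end Mandell

theorem theorem2p1 :
    ∃ (𝒢 : Multicategory GammaHom.{u}) (𝒯 : Multicategory MultilinearTrans.{u}),
      Levelwise 𝒢.toMultiOps GammaCat.levels gammaFam ∧
      Levelwise 𝒯.toMultiOps BasedMultifunctor.levels MultilinearTrans.fam ∧
      (∃ (_ : MonoidalCategory GammaCat.{u}) (_ : SymmetricCategory GammaCat.{u})
        (U : Underlying 𝒢.toMultiOps),
        (∀ (X Y : GammaCat.{u}) (q : X ⟶ Y) (m : Fin 1 → ℕ),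
          gammaFam (U.one X Y q) m = idFamily X.levels m ≫ NatTrans.app q ⟨∏ i, m i⟩) ∧
        ∀ X Y : GammaCat.{u}, (X ⊗ Y).functor.IsLeftKanExtension (U.pair X Y)) ∧
      ∃ A : MultifunctorOn 𝒢.toMultiOps 𝒯.toMultiOps constructionA.{u},
        ∀ {r : ℕ} {X : Fin r → GammaCat.{u}} {Y : GammaCat.{u}} (f : GammaHom X Y),
          (A.map f).fam = gammaFam f :=
  ⟨gammaMulticategory, multMulticategory, gammaMulticategory_levelwise,
    multMulticategory_levelwise, ⟨dayMonoidal, daySymmetric, gammaUnderlying, gammaFam_one,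
      isLeftKanExtension_day⟩, constructionAMultifunctor, fun _ => rfl⟩
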